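/- **Theorem 3.8.** Let $\mathbb K$ be a field of characteristic $0$, let $H$ be a Hopf algebra over $\mathbb K$ with bijective antipode $S$ (so that the category ${}^H_H\mathcal{YD}$ of left Yetter–Drinfeld modules is braided), and let $V$ be an object of ${}^H_H\mathcal{YD}$, with coaction $v\mapsto\sum v_{(-1)}\otimes v_{(0)}$ and natural braiding $\sigma(v\otimes w)=\sum v_{(-1)}\cdot w\otimes v_{(0)}$. Let $T(V)=\bigoplus_{n\ge 0}V^{\otimes n}$ carry the diagonal action and coaction of $H$, let $\varepsilon:T(V)\to\mathbb K$ be the projection onto degree $0$, let $\delta$ be the deconcatenation coproduct on $T(V)$, and let $\beta:T(V)\otimes T(V)\to T(V)\otimes T(V)$ be the map whose restriction $\beta_{ij}:V^{\otimes i}\otimes V^{\otimes j}\to V^{\otimes j}\otimes V^{\otimes i}$ is obtained from a reduced expression of the permutation moving the first $i$ factors past the last $j$, each simple transposition acting by $\sigma$ ($\beta_{0i},\beta_{i0}$ being the identity). Put $\Delta_\beta=(\mathrm{id}\otimes\beta\otimes\mathrm{id})(\delta\otimes\delta)$, $\Delta_\beta^{(0)}=\mathrm{id}$, $\Delta_\beta^{(n+1)}=(\Delta_\beta^{(n)}\otimes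 \mathrm{id})\Delta_\beta$. Let $M=\{M_{pq}:V^{\otimes p}\otimes V^{\otimes q}\to V\}_{p,q\ge0}$ be morphisms in ${}^H_H\mathcal{YD}$ that form a quantum multi-brace structure on $(V,\sigma)$. This means the following, where $M$ also denotes the induced map $T(V)\otimes T(V)\to V$. 1. $M_{00}=0$, $M_{10}=\mathrm{id}_V=M_{01}$, and $M_{n0}=0=M_{0n}$ for $n\ge2$. 2. For all $i,j,k\ge1$, $\beta_{1k}(M_{ij}\otimes\mathrm{id}^{\otimes k})=(\mathrm{id}^{\otimes k}\otimes M_{ij})\beta_{i+j,k}$ and $\beta_{i1}(\mathrm{id}^{\otimes i}\otimes M_{jk})=(M_{jk}\otimes\mathrm{id}^{\otimes i})\beta_{i,j+k}$. 3. For all $i,j,k\ge1$, $$\sum_{r=1}^{i+j}M_{rk}\big((M^{\otimes r}\Delta_\beta^{(r-1)})\otimes\mathrm{id}^{\otimes k}\big)=\sum_{l=1}^{j+k}M_{il}\big(\mathrm{id}^{\otimes i}\otimes(M^{\otimes l}\Delta_\beta^{(l-1)})\big).$$ Let $*=\varepsilon\otimes\varepsilon+\sum_{n\ge1}M^{\otimes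 n}\Delta_\beta^{(n-1)}:T(V)\otimes T(V)\to T(V)$. Let $T(V)\#H$ be the space $T(V)\otimes H$ with product $(x\#h)(y\#h')=\sum x*(h_{(1)}\cdot y)\#h_{(2)}h'$, let $P_0(x\#h)=\varepsilon(x)\,1\#h$ be the projection onto $H=\mathbb K\#H$, and let $$\Sigma\big((x\#h)\otimes(y\#h')\big)=\sum\big((x_{(-3)}h_{(1)})\cdot y\,\#\,x_{(-2)}h_{(2)}h'S(x_{(-1)}h_{(3)})\big)\otimes(x_{(0)}\#h_{(4)}).$$ Then $(T(V)\#H,P_0,\Sigma)$ is a braided Rota–Baxter algebra of weight $-1$. That is, writing $m$ for the product, $A=T(V)\#H$, $\Sigma_1=\Sigma\otimes\mathrm{id}$ and $\Sigma_2=\mathrm{id}\otimes\Sigma$: - $m$ is associative; - $\Sigma$ is bijective and $\Sigma_1\Sigma_2\Sigma_1=\Sigma_2\Sigma_1\Sigma_2$; - $(\mathrm{id}_A\otimes m)\Sigma_1\Sigma_2=\Sigma(m\otimes\mathrm{id}_A)$ and $(m\otimes\mathrm{id}_A)\Sigma_2\Sigma_1=\Sigma(\mathrm{id}_A\otimes m)$;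 - $P_0(a)P_0(b)=P_0(aP_0(b))+P_0(P_0(a)b)-P_0(ab)$ for all $a,b\in A$; - $\Sigma(P_0\otimes P_0)=(P_0\otimes P_0)\Sigma$. -/

import Mathlib

open scoped TensorProduct

noncomputable section

namespace BraidedRB

/-! ### Braided algebras and Rota-Baxter algebras -/

section Braided

variable {K : Type*} [Field K] {A : Type*} [AddCommGroup A] [Module K A]

/-- `σ₁ = σ ⊗ id` on `A ⊗ (A ⊗ A)`. -/
def sigmaOne (σ : A ⊗[K] A →ₗ[K] A ⊗[K] A) :
    A ⊗[K] (A ⊗[K] A) →ₗ[K] A ⊗[K] (A ⊗[K] A) :=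
  (TensorProduct.assoc K A A A).toLinearMap ∘ₗ σ.rTensor A ∘ₗ
    (TensorProduct.assoc K A A A).symm.toLinearMap

/-- `σ₂ = id ⊗ σ` on `A ⊗ (A ⊗ A)`. -/
def sigmaTwo (σ : A ⊗[K] A →ₗ[K] A ⊗[K] A) :
    A ⊗[K] (A ⊗[K] A) →ₗ[K] A ⊗[K] (A ⊗[K] A) :=
  σ.lTensor A

/-- A braiding: an invertible solution of the quantum Yang-Baxter equation `σ₁σ₂σ₁ = σ₂σ₁σ₂`. -/
structure IsBraiding (σ : A ⊗[K] A →ₗ[K] A ⊗[K] A) : Prop where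
  bijective : Function.Bijective σ
  yangBaxter : sigmaOne σ ∘ₗ sigmaTwo σ ∘ₗ sigmaOne σ = sigmaTwo σ ∘ₗ sigmaOne σ ∘ₗ sigmaTwo σ

/-- `(A, m)` is an associative, not necessarily unital, algebra. -/
def IsAssocAlgebra (m : A ⊗[K] A →ₗ[K] A) : Prop :=
  ∀ x y z : A, m (m (x ⊗ₜ y) ⊗ₜ z) = m (x ⊗ₜ m (y ⊗ₜ z))

/-- `(A, m, σ)` is a braided algebra. -/
structure IsBraidedAlgebra (m : A ⊗[K] A →ₗ[K] A) (σ : A ⊗[K] A →ₗ[K] A ⊗[K] A) : Prop where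
  assoc : IsAssocAlgebra m
  braiding : IsBraiding σ
  /-- `(id ⊗ m) σ₁ σ₂ = σ (m ⊗ id)` -/
  braid_mul_left : m.lTensor A ∘ₗ sigmaOne σ ∘ₗ sigmaTwo σ =
    σ ∘ₗ m.rTensor A ∘ₗ (TensorProduct.assoc K A A A).symm.toLinearMap
  /-- `(m ⊗ id) σ₂ σ₁ = σ (id ⊗ m)` -/
  braid_mul_right : m.rTensor A ∘ₗ (TensorProduct.assoc K A A A).symm.toLinearMap ∘ₗ
    sigmaTwo σ ∘ₗ sigmaOne σ = σ ∘ₗ m.lTensor A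

/-- `(A, m, P)` is a Rota-Baxter algebra of weight `c`. -/
structure IsRotaBaxter (m : A ⊗[K] A →ₗ[K] A) (P : A →ₗ[K] A) (c : K) : Prop where
  assoc : IsAssocAlgebra m
  rotaBaxter : ∀ x y : A,
    m (P x ⊗ₜ P y) = P (m (x ⊗ₜ P y)) + P (m (P x ⊗ₜ y)) + c • P (m (x ⊗ₜ y))

/-- `(A, P, σ)`, with the product `m` of `A`, is a braided Rota-Baxter algebra of weight `c`. -/
structure IsBraidedRotaBaxter (m : A ⊗[K] A →ₗ[K] A) (P : A →ₗ[K] A)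
    (σ : A ⊗[K] A →ₗ[K] A ⊗[K] A) (c : K) : Prop where
  braidedAlgebra : IsBraidedAlgebra m σ
  rotaBaxter : IsRotaBaxter m P c
  braid_comm : σ ∘ₗ TensorProduct.map P P = TensorProduct.map P P ∘ₗ σ

end Braided

/-! ### The tensor algebra -/

section TensorAlg

variable {K : Type*} [Field K] {V : Type*} [AddCommGroup V] [Module K V]
variable {X : Type*} [AddCommGroup X] [Module K X]

/-- Recursion on tensors from the left: the linear map `F : T(V) → X` with
`F 1 = x₀` and `F (v ⊗ y) = g v (F y)`. -/
def tensorFold (x₀ : X) (g : V →ₗ[K] X →ₗ[K] X) : TensorAlgebra K V →ₗ[K] X :=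
  LinearMap.applyₗ x₀ ∘ₗ
    (TensorAlgebra.lift K (A := Module.End K X) g).toLinearMap

theorem tensorFold_one (x₀ : X) (g : V →ₗ[K] X →ₗ[K] X) : tensorFold x₀ g 1 = x₀ := by
  simp [tensorFold]

theorem tensorFold_ι_mul (x₀ : X) (g : V →ₗ[K] X →ₗ[K] X) (v : V) (y : TensorAlgebra K V) :
    tensorFold x₀ g (TensorAlgebra.ι K v * y) = g v (tensorFold x₀ g y) := by
  simp [tensorFold]

/-- The linear map on `T(V) = ⨁ₙ V^{⊗n}` with prescribed restrictions to the `V^{⊗n}`. -/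
def gradedMap (f : ∀ n : ℕ, (⨂[K]^n V) →ₗ[K] X) : TensorAlgebra K V →ₗ[K] X :=
  DirectSum.toModule K ℕ X f ∘ₗ TensorAlgebra.toDirectSum.toLinearMap

/-- The linear map on `T(V) ⊗ T(V) = ⨁ V^{⊗p} ⊗ V^{⊗q}` with prescribed restrictions to the
`V^{⊗p} ⊗ V^{⊗q}`. -/
def bigradedMap (f : ∀ p q : ℕ, (⨂[K]^p V) ⊗[K] (⨂[K]^q V) →ₗ[K] X) :
    TensorAlgebra K V ⊗[K] TensorAlgebra K V →ₗ[K] X :=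
  TensorProduct.lift
    (gradedMap fun p => (gradedMap fun q => (TensorProduct.curry (f p q)).flip).flip)

/-- The inclusion of `V^{⊗n}` in `T(V)`. -/
abbrev incl {n : ℕ} (x : ⨂[K]^n V) : TensorAlgebra K V := TensorPower.toTensorAlgebra x

theorem toDirectSum_incl {n : ℕ} (x : ⨂[K]^n V) :
    TensorAlgebra.toDirectSum (incl x) = DirectSum.of (fun n => ⨂[K]^n V) n x := by
  rw [← TensorAlgebra.toDirectSum_ofDirectSum (DirectSum.of (fun n => ⨂[K]^n V) n x)]
  congr 1
  exact (DirectSum.toAddMonoid_of (β := fun n => ⨂[K]^n V)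
    (fun n => (TensorPower.toTensorAlgebra (R := K) (M := V) (n := n)).toAddMonoidHom) n x).symm

theorem gradedMap_incl (f : ∀ n : ℕ, (⨂[K]^n V) →ₗ[K] X) {n : ℕ} (x : ⨂[K]^n V) :
    gradedMap f (incl x) = f n x := by
  simp only [gradedMap, LinearMap.comp_apply, AlgHom.toLinearMap_apply, toDirectSum_incl]
  exact DirectSum.toModule_lof (ι := ℕ) (M := fun n => ⨂[K]^n V) K n x

theorem bigradedMap_incl (f : ∀ p q : ℕ, (⨂[K]^p V) ⊗[K] (⨂[K]^q V) →ₗ[K] X) {p q : ℕ}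
    (x : ⨂[K]^p V) (y : ⨂[K]^q V) :
    bigradedMap f (incl x ⊗ₜ incl y) = f p q (x ⊗ₜ y) := by
  simp [bigradedMap, gradedMap_incl]

/-- The projection `T(V) → V^{⊗n}`. -/
def degreePart (n : ℕ) : TensorAlgebra K V →ₗ[K] ⨂[K]^n V :=
  DirectSum.component K ℕ (fun n => ⨂[K]^n V) n ∘ₗ TensorAlgebra.toDirectSum.toLinearMap

/-- The projection `ε : T(V) → K` onto the degree `0` part. -/
def tensorCounit : TensorAlgebra K V →ₗ[K] K :=
  (TensorAlgebra.algebraMapInv (R := K) (M := V)).toLinearMap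

/-- The recursion step for `deconcat`. -/
def deconcatStep : V →ₗ[K]
    (TensorAlgebra K V × (TensorAlgebra K V ⊗[K] TensorAlgebra K V)) →ₗ[K]
    (TensorAlgebra K V × (TensorAlgebra K V ⊗[K] TensorAlgebra K V)) :=
  LinearMap.mk₂ K
    (fun v p => (TensorAlgebra.ι K v * p.1,
      1 ⊗ₜ (TensorAlgebra.ι K v * p.1) + (TensorAlgebra.ι K v ⊗ₜ 1) * p.2))
    (by intro v w p; simp only [map_add, add_mul, TensorProduct.tmul_add, TensorProduct.add_tmul,
          Prod.mk_add_mk, Prod.mk.injEq, true_and]; abel)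
    (by intro c v p; simp only [map_smul, smul_mul_assoc, TensorProduct.tmul_smul,
          ← TensorProduct.smul_tmul', Prod.smul_mk, smul_add])
    (by intro v p q; simp only [Prod.fst_add, Prod.snd_add, mul_add, TensorProduct.tmul_add,
          Prod.mk_add_mk, Prod.mk.injEq, true_and]; abel)
    (by intro c v p; simp)

/-- The deconcatenation coproduct
`δ(v₁ ⊗ ⋯ ⊗ vₙ) = ∑ᵢ (v₁ ⊗ ⋯ ⊗ vᵢ) ⊗ (vᵢ₊₁ ⊗ ⋯ ⊗ vₙ)` of `T(V)`, by the recursion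
`δ 1 = 1 ⊗ 1`, `δ(v y) = 1 ⊗ v y + (v ⊗ 1) δ(y)`; see `deconcat_prod`. -/
def deconcat : TensorAlgebra K V →ₗ[K] TensorAlgebra K V ⊗[K] TensorAlgebra K V :=
  LinearMap.snd K _ _ ∘ₗ tensorFold (1, 1 ⊗ₜ 1) deconcatStep

theorem deconcat_one : deconcat (1 : TensorAlgebra K V) = 1 ⊗ₜ 1 := by
  simp [deconcat, tensorFold_one]

theorem deconcat_ι_mul (v : V) (y : TensorAlgebra K V) :
    deconcat (TensorAlgebra.ι K v * y) =
      1 ⊗ₜ (TensorAlgebra.ι K v * y) + (TensorAlgebra.ι K v ⊗ₜ 1) * deconcat y := by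
  have h : ∀ z : TensorAlgebra K V,
      (tensorFold ((1, 1 ⊗ₜ 1) : TensorAlgebra K V × (TensorAlgebra K V ⊗[K] TensorAlgebra K V))
        deconcatStep z).1 = z := by
    intro z
    have key : ∀ a : TensorAlgebra K V,
        ∀ p : TensorAlgebra K V × (TensorAlgebra K V ⊗[K] TensorAlgebra K V),
        (TensorAlgebra.lift K (A := Module.End K
          (TensorAlgebra K V × (TensorAlgebra K V ⊗[K] TensorAlgebra K V))) deconcatStep a p).1 =
          a * p.1 := by
      intro a
      induction a using TensorAlgebra.induction with
      | algebraMap r => intro p; simp [Algebra.smul_def]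
      | ι v => intro p; simp [deconcatStep]
      | mul a b ha hb => intro p; simp [ha, hb, mul_assoc]
      | add a b ha hb => intro p; simp [ha, hb, add_mul]
    simp [tensorFold, key]
  have h' := h y
  simp only [deconcat, LinearMap.comp_apply, tensorFold_ι_mul]
  generalize tensorFold ((1, 1 ⊗ₜ 1) : TensorAlgebra K V ×
    (TensorAlgebra K V ⊗[K] TensorAlgebra K V)) deconcatStep y = p at h' ⊢
  simp [deconcatStep, h']

theorem deconcat_prod (l : List V) :
    deconcat (l.map (TensorAlgebra.ι K)).prod =
      ∑ i ∈ Finset.range (l.length + 1),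
        ((l.take i).map (TensorAlgebra.ι K)).prod ⊗ₜ[K]
          ((l.drop i).map (TensorAlgebra.ι K)).prod := by
  induction l with
  | nil => simp [deconcat_one]
  | cons v l ih =>
    rw [List.map_cons, List.prod_cons, deconcat_ι_mul, ih, List.length_cons,
      Finset.sum_range_succ' _ (l.length + 1), add_comm, Finset.mul_sum]
    simp

variable (σ : V ⊗[K] V →ₗ[K] V ⊗[K] V)

/-- Moving one vector to the right: as a function of `y`, the map `v ↦ β(v ⊗ y)` in `T(V) ⊗ V`.
On `V ⊗ V^{⊗j}` this is `β_{1j} = σ_j ⋯ σ_1`, by the recursion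
`β_{10} = id`, `β_{1,j+1} = (id ⊗ β_{1j})(σ ⊗ id)`. -/
def betaOne : TensorAlgebra K V →ₗ[K] V →ₗ[K] TensorAlgebra K V ⊗[K] V :=
  tensorFold (TensorProduct.mk K (TensorAlgebra K V) V 1)
    (LinearMap.mk₂ K
      (fun w f => (LinearMap.mul' K (TensorAlgebra K V)).rTensor V ∘ₗ
        (TensorProduct.assoc K _ _ _).symm.toLinearMap ∘ₗ
        TensorProduct.map (TensorAlgebra.ι K) f ∘ₗ σ ∘ₗ (TensorProduct.mk K V V).flip w)
      (by intro w w' f; ext v; simp)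
      (by intro c w f; ext v; simp)
      (by intro w f f'; ext v; simp [TensorProduct.map_add_right])
      (by intro c w f; ext v; simp [TensorProduct.map_smul_right]))

/-- The braiding `β` of `T(V)` in curried form, by the recursion
`β_{0j} = id`, `β_{i+1,j} = (β_{1j} ⊗ id)(id ⊗ β_{ij})`. -/
def betaCurried : TensorAlgebra K V →ₗ[K] TensorAlgebra K V →ₗ[K]
    TensorAlgebra K V ⊗[K] TensorAlgebra K V :=
  tensorFold ((TensorProduct.mk K (TensorAlgebra K V) (TensorAlgebra K V)).flip 1)
    (LinearMap.mk₂ K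
      (fun v f => (LinearMap.mul' K (TensorAlgebra K V)).lTensor (TensorAlgebra K V) ∘ₗ
        (TensorProduct.assoc K _ _ _).toLinearMap ∘ₗ
        ((TensorAlgebra.ι K).lTensor (TensorAlgebra K V) ∘ₗ
          (betaOne σ).flip v).rTensor (TensorAlgebra K V) ∘ₗ f)
      (by intro v v' f; ext y; simp [LinearMap.comp_add, LinearMap.rTensor_add])
      (by intro c v f; ext y; simp [LinearMap.comp_smul, LinearMap.rTensor_smul])
      (by intro v f f'; ext y; simp)
      (by intro c v f; ext y; simp))

/-- The map `β : T(V) ⊗ T(V) → T(V) ⊗ T(V)` whose restriction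
`β_{ij} : V^{⊗i} ⊗ V^{⊗j} → V^{⊗j} ⊗ V^{⊗i}` is the lift of the permutation moving a block of
length `i` past a block of length `j`. The recursions in `betaOne` and `betaCurried` spell out
one reduced expression of this permutation, each simple transposition `s_k` acting by `σ_k`. -/
def beta : TensorAlgebra K V ⊗[K] TensorAlgebra K V →ₗ[K]
    TensorAlgebra K V ⊗[K] TensorAlgebra K V :=
  TensorProduct.lift (betaCurried σ)

end TensorAlg

/-- `id ⊗ c ⊗ id` on `(A ⊗ B) ⊗ (C ⊗ D)`, for `c : B ⊗ C → C' ⊗ B'`. -/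
def midMap {K : Type*} [Field K] {A B C D B' C' : Type*}
    [AddCommGroup A] [Module K A] [AddCommGroup B] [Module K B] [AddCommGroup C] [Module K C]
    [AddCommGroup D] [Module K D] [AddCommGroup B'] [Module K B'] [AddCommGroup C'] [Module K C']
    (c : B ⊗[K] C →ₗ[K] C' ⊗[K] B') :
    (A ⊗[K] B) ⊗[K] (C ⊗[K] D) →ₗ[K] (A ⊗[K] C') ⊗[K] (B' ⊗[K] D) :=
  (TensorProduct.assoc K A C' (B' ⊗[K] D)).symm.toLinearMap ∘ₗ
    ((TensorProduct.assoc K C' B' D).toLinearMap ∘ₗ c.rTensor D ∘ₗ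
      (TensorProduct.assoc K B C D).symm.toLinearMap).lTensor A ∘ₗ
    (TensorProduct.assoc K A B (C ⊗[K] D)).toLinearMap

/-- The iterated coproduct `Δ^{(n)} : C → C^{⊗(n+1)}`, with `Δ^{(0)} = id` and
`Δ^{(n+1)} = (Δ^{(n)} ⊗ id) Δ`. -/
def iterCoprod {K : Type*} [Field K] {C : Type*} [AddCommGroup C] [Module K C]
    (Δ : C →ₗ[K] C ⊗[K] C) : ∀ n : ℕ, C →ₗ[K] ⨂[K]^(n + 1) C
  | 0 => (PiTensorProduct.subsingletonEquiv (R := K) (s := fun _ : Fin 1 => C) 0).symm.toLinearMap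
  | n + 1 => TensorPower.mulEquiv.toLinearMap ∘ₗ
      TensorProduct.map (iterCoprod Δ n)
        (PiTensorProduct.subsingletonEquiv (R := K) (s := fun _ : Fin 1 => C) 0).symm.toLinearMap ∘ₗ
      Δ

/-! ### Quantum multi-brace algebras -/

section MultiBrace

variable {K : Type*} [Field K] {V : Type*} [AddCommGroup V] [Module K V]

/-- The twisted coproduct `(id ⊗ β ⊗ id)(δ ⊗ δ)` of `T(V) ⊗ T(V)`. -/
def twistedCoprod (σ : V ⊗[K] V →ₗ[K] V ⊗[K] V) :
    TensorAlgebra K V ⊗[K] TensorAlgebra K V →ₗ[K]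
      (TensorAlgebra K V ⊗[K] TensorAlgebra K V) ⊗[K]
        (TensorAlgebra K V ⊗[K] TensorAlgebra K V) :=
  midMap (beta σ) ∘ₗ TensorProduct.map deconcat deconcat

variable (M : ∀ p q : ℕ, (⨂[K]^p V) ⊗[K] (⨂[K]^q V) →ₗ[K] V)

/-- The map `T(V) ⊗ T(V) → V` whose restriction to `V^{⊗p} ⊗ V^{⊗q}` is `M_{pq}`. -/
def totalBrace : TensorAlgebra K V ⊗[K] TensorAlgebra K V →ₗ[K] V := bigradedMap M

/-- `M_{pq}` read on `V^{⊗(p+q)} = V^{⊗p} ⊗ V^{⊗q}`, and extended by zero to `T(V)`. -/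
def flatBrace (p q : ℕ) : TensorAlgebra K V →ₗ[K] V :=
  M p q ∘ₗ TensorPower.mulEquiv.symm.toLinearMap ∘ₗ degreePart (p + q)

variable (σ : V ⊗[K] V →ₗ[K] V ⊗[K] V)

/-- `M^{⊗(n+1)} ∘ Δ_β^{(n)} : T(V) ⊗ T(V) → V^{⊗(n+1)}`. -/
def bracePow (n : ℕ) : TensorAlgebra K V ⊗[K] TensorAlgebra K V →ₗ[K] ⨂[K]^(n + 1) V :=
  PiTensorProduct.map (fun _ => totalBrace M) ∘ₗ iterCoprod (twistedCoprod σ) n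

/-- `M = {M_{pq}}` is a quantum multi-brace algebra structure on the braided vector space
`(V, σ)`. -/
structure IsQuantumMultiBrace : Prop where
  zero_zero : M 0 0 = 0
  one_zero : ∀ v : V, M 1 0 (PiTensorProduct.tprod K (fun _ : Fin 1 => v) ⊗ₜ
    PiTensorProduct.tprod K (fun i : Fin 0 => i.elim0)) = v
  zero_one : ∀ v : V, M 0 1 (PiTensorProduct.tprod K (fun i : Fin 0 => i.elim0) ⊗ₜ
    PiTensorProduct.tprod K (fun _ : Fin 1 => v)) = v
  right_zero : ∀ n, 2 ≤ n → M n 0 = 0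
  left_zero : ∀ n, 2 ≤ n → M 0 n = 0
  /-- `β_{1k}(M_{ij} ⊗ id^{⊗k}) = (id^{⊗k} ⊗ M_{ij}) β_{i+j,k}` -/
  braid_left : ∀ i j k : ℕ, 1 ≤ i → 1 ≤ j → 1 ≤ k →
    ∀ (x : ⨂[K]^i V) (y : ⨂[K]^j V) (z : ⨂[K]^k V),
      beta σ (TensorAlgebra.ι K (M i j (x ⊗ₜ y)) ⊗ₜ incl z) =
        (TensorAlgebra.ι K ∘ₗ flatBrace M i j).lTensor (TensorAlgebra K V)
          (beta σ ((incl x * incl y) ⊗ₜ incl z))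
  /-- `β_{i1}(id^{⊗i} ⊗ M_{jk}) = (M_{jk} ⊗ id^{⊗i}) β_{i,j+k}` -/
  braid_right : ∀ i j k : ℕ, 1 ≤ i → 1 ≤ j → 1 ≤ k →
    ∀ (x : ⨂[K]^i V) (y : ⨂[K]^j V) (z : ⨂[K]^k V),
      beta σ (incl x ⊗ₜ TensorAlgebra.ι K (M j k (y ⊗ₜ z))) =
        (TensorAlgebra.ι K ∘ₗ flatBrace M j k).rTensor (TensorAlgebra K V)
          (beta σ (incl x ⊗ₜ (incl y * incl z)))
  /-- `∑_{r=1}^{i+j} M_{rk}((M^{⊗r} Δ_β^{(r-1)}) ⊗ id^{⊗k}) =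
  ∑_{l=1}^{j+k} M_{il}(id^{⊗i} ⊗ (M^{⊗l} Δ_β^{(l-1)}))`, with `r = n + 1` and `l = n + 1`. -/
  brace_assoc : ∀ i j k : ℕ, 1 ≤ i → 1 ≤ j → 1 ≤ k →
    ∀ (x : ⨂[K]^i V) (y : ⨂[K]^j V) (z : ⨂[K]^k V),
      ∑ n ∈ Finset.range (i + j), M (n + 1) k (bracePow M σ n (incl x ⊗ₜ incl y) ⊗ₜ z) =
        ∑ n ∈ Finset.range (j + k), M i (n + 1) (x ⊗ₜ bracePow M σ n (incl y ⊗ₜ incl z))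

/-- The product `* = ε ⊗ ε + ∑_{n ≥ 1} M^{⊗n} Δ_β^{(n-1)}` of `T(V)`. On `V^{⊗p} ⊗ V^{⊗q}` the
terms with `n > p + q` vanish, because `M_{00} = 0`, and the sum stops at `n = p + q`. -/
def starProd : TensorAlgebra K V ⊗[K] TensorAlgebra K V →ₗ[K] TensorAlgebra K V :=
  Algebra.linearMap K (TensorAlgebra K V) ∘ₗ LinearMap.mul' K K ∘ₗ
      TensorProduct.map tensorCounit tensorCounit +
    bigradedMap (fun p q => ∑ n ∈ Finset.range (p + q),
      TensorPower.toTensorAlgebra ∘ₗ bracePow M σ n ∘ₗ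
        TensorProduct.map TensorPower.toTensorAlgebra TensorPower.toTensorAlgebra)

end MultiBrace

/-! ### Yetter-Drinfeld modules -/

section YD

variable {K : Type*} [Field K] {H : Type*} [Ring H] [HopfAlgebra K H]
variable {V : Type*} [AddCommGroup V] [Module K V]
variable {W : Type*} [AddCommGroup W] [Module K W]

open Coalgebra (comul counit)

/-- `(a ⊗ w) ⊗ k ↦ a k ⊗ w`. -/
def mulFirst : (H ⊗[K] V) ⊗[K] H →ₗ[K] H ⊗[K] V :=
  (LinearMap.mul' K H).rTensor V ∘ₗ (TensorProduct.rightComm K H V H).toLinearMap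

/-- A left action `act` (an `H`-module structure) and a left coaction `coact` (an `H`-comodule
structure) on `V` form a Yetter-Drinfeld module over `H`. -/
structure IsYetterDrinfeld (act : H →ₗ[K] Module.End K V) (coact : V →ₗ[K] H ⊗[K] V) :
    Prop where
  one_act : ∀ v, act 1 v = v
  mul_act : ∀ g h v, act (g * h) v = act g (act h v)
  counit_coact : ∀ v, TensorProduct.lid K V ((counit (R := K) (A := H)).rTensor V (coact v)) = v
  coassoc : ∀ v, TensorProduct.assoc K H H V ((comul (R := K) (A := H)).rTensor V (coact v)) =
    coact.lTensor H (coact v)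
  /-- `∑ h₁ v₋₁ ⊗ h₂ · v₀ = ∑ (h₁ · v)₋₁ h₂ ⊗ (h₁ · v)₀` -/
  compat : ∀ h v,
    TensorProduct.map (LinearMap.mul' K H) (TensorProduct.lift act)
        (TensorProduct.tensorTensorTensorComm K H H H V (comul (R := K) h ⊗ₜ coact v)) =
      mulFirst ((coact ∘ₗ act.flip v).rTensor H (comul (R := K) h))

/-- `f` is a morphism of Yetter-Drinfeld modules: a module and comodule homomorphism. -/
structure IsYDHom (actV : H →ₗ[K] Module.End K V) (coactV : V →ₗ[K] H ⊗[K] V)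
    (actW : H →ₗ[K] Module.End K W) (coactW : W →ₗ[K] H ⊗[K] W) (f : V →ₗ[K] W) : Prop where
  map_act : ∀ h v, f (actV h v) = actW h (f v)
  map_coact : ∀ v, coactW (f v) = f.lTensor H (coactV v)

/-- The diagonal action `h · (v ⊗ w) = ∑ h₁ · v ⊗ h₂ · w`. -/
def tensorAct (actV : H →ₗ[K] Module.End K V) (actW : H →ₗ[K] Module.End K W) :
    H →ₗ[K] Module.End K (V ⊗[K] W) :=
  TensorProduct.lift ((TensorProduct.mapBilinear (RingHom.id K) V W V W).compl₁₂ actV actW) ∘ₗ comul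

/-- The diagonal coaction `v ⊗ w ↦ ∑ v₋₁ w₋₁ ⊗ (v₀ ⊗ w₀)`. -/
def tensorCoact (coactV : V →ₗ[K] H ⊗[K] V) (coactW : W →ₗ[K] H ⊗[K] W) :
    V ⊗[K] W →ₗ[K] H ⊗[K] (V ⊗[K] W) :=
  (LinearMap.mul' K H).rTensor (V ⊗[K] W) ∘ₗ
    (TensorProduct.tensorTensorTensorComm K H V H W).toLinearMap ∘ₗ
    TensorProduct.map coactV coactW

/-- The natural braiding `v ⊗ w ↦ ∑ v₋₁ · w ⊗ v₀`. -/
def natBraiding (coactV : V →ₗ[K] H ⊗[K] V) (actW : H →ₗ[K] Module.End K W) :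
    V ⊗[K] W →ₗ[K] W ⊗[K] V :=
  (TensorProduct.lift actW).rTensor V ∘ₗ
    (TensorProduct.rightComm K H V W).toLinearMap ∘ₗ coactV.rTensor W

/-- The diagonal action of `H` on `T(V)`: `h · 1 = ε(h) 1` and
`h · (v ⊗ y) = ∑ h₁ · v ⊗ h₂ · y`. -/
def tensorAlgAct (act : H →ₗ[K] Module.End K V) : H →ₗ[K] Module.End K (TensorAlgebra K V) :=
  (tensorFold (Algebra.linearMap K (TensorAlgebra K V) ∘ₗ counit)
    (LinearMap.mk₂ K
      (fun v (f : H →ₗ[K] TensorAlgebra K V) => LinearMap.mul' K (TensorAlgebra K V) ∘ₗ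
        TensorProduct.map (TensorAlgebra.ι K ∘ₗ act.flip v) f ∘ₗ comul)
      (by intro v v' f; ext h
          simp [LinearMap.comp_add, TensorProduct.map_add_left])
      (by intro c v f; ext h
          simp [LinearMap.comp_smul, TensorProduct.map_smul_left])
      (by intro v f f'; ext h; simp [TensorProduct.map_add_right])
      (by intro c v f; ext h; simp [TensorProduct.map_smul_right]))).flip

/-- The diagonal coaction of `H` on `T(V)`,
`v₁ ⊗ ⋯ ⊗ vₙ ↦ ∑ (v₁)₋₁ ⋯ (vₙ)₋₁ ⊗ ((v₁)₀ ⊗ ⋯ ⊗ (vₙ)₀)`: the algebra homomorphism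
`T(V) → H ⊗ T(V)` that extends the coaction of `V`. -/
def tensorAlgCoact (coact : V →ₗ[K] H ⊗[K] V) :
    TensorAlgebra K V →ₗ[K] H ⊗[K] TensorAlgebra K V :=
  (TensorAlgebra.lift K ((TensorAlgebra.ι K).lTensor H ∘ₗ coact)).toLinearMap

/-- The diagonal action of `H` on `V^{⊗n}`: the action on `T(V)` in degree `n`. -/
def powAct (act : H →ₗ[K] Module.End K V) (n : ℕ) : H →ₗ[K] Module.End K (⨂[K]^n V) :=
  ((tensorAlgAct act).compr₂ (degreePart n)).compl₂ TensorPower.toTensorAlgebra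

/-- The diagonal coaction of `H` on `V^{⊗n}`: the coaction on `T(V)` in degree `n`. -/
def powCoact (coact : V →ₗ[K] H ⊗[K] V) (n : ℕ) : (⨂[K]^n V) →ₗ[K] H ⊗[K] (⨂[K]^n V) :=
  (degreePart n).lTensor H ∘ₗ tensorAlgCoact coact ∘ₗ TensorPower.toTensorAlgebra

/-- The adjoint action `h · k = ∑ h₁ k S(h₂)` of `H` on itself. -/
def adjointAct : H →ₗ[K] Module.End K H :=
  TensorProduct.lift ((LinearMap.mul K (Module.End K H)).compl₁₂ (LinearMap.mul K H)
    ((LinearMap.mul K H).flip ∘ₗ HopfAlgebra.antipode K)) ∘ₗ comul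

/-! ### The bosonization of `(T(V), *)` by `H` -/

/-- The product `(x # h)(y # h') = ∑ x * (h₁ · y) # h₂ h'` on `T(V) ⊗ H`. -/
def bosonMul (act : H →ₗ[K] Module.End K V) (coact : V →ₗ[K] H ⊗[K] V)
    (M : ∀ p q : ℕ, (⨂[K]^p V) ⊗[K] (⨂[K]^q V) →ₗ[K] V) :
    (TensorAlgebra K V ⊗[K] H) ⊗[K] (TensorAlgebra K V ⊗[K] H) →ₗ[K] TensorAlgebra K V ⊗[K] H :=
  TensorProduct.map (starProd M (natBraiding coact act)) (LinearMap.mul' K H) ∘ₗ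
    midMap (natBraiding (comul : H →ₗ[K] H ⊗[K] H) (tensorAlgAct act))

/-- The natural braiding of `T(V) # H`, for the Yetter-Drinfeld structure
`g · (y # h') = ∑ g₁ · y # g₂ h' S(g₃)`, `x # h ↦ ∑ x₋₁ h₁ ⊗ (x₀ # h₂)`, that is
`Σ((x # h) ⊗ (y # h')) =
  ∑ ((x₋₃ h₁) · y # x₋₂ h₂ h' S(x₋₁ h₃)) ⊗ (x₀ # h₄)`. -/
def bosonBraiding (act : H →ₗ[K] Module.End K V) (coact : V →ₗ[K] H ⊗[K] V) :
    (TensorAlgebra K V ⊗[K] H) ⊗[K] (TensorAlgebra K V ⊗[K] H) →ₗ[K]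
      (TensorAlgebra K V ⊗[K] H) ⊗[K] (TensorAlgebra K V ⊗[K] H) :=
  natBraiding (tensorCoact (tensorAlgCoact coact) comul)
    (tensorAct (tensorAlgAct act) adjointAct)

variable (K H V) in
/-- The projection `P₀` of `T(V) # H = (K # H) ⊕ (T⁺(V) # H)` onto `H = K # H`, that is
`x # h ↦ ε(x) 1 # h`. -/
def bosonProj : TensorAlgebra K V ⊗[K] H →ₗ[K] TensorAlgebra K V ⊗[K] H :=
  (Algebra.linearMap K (TensorAlgebra K V) ∘ₗ tensorCounit).rTensor H

end YD

end BraidedRB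

end

/-! Everything takes place in the braided monoidal category of Yetter–Drinfeld modules. `T(V)` with
its diagonal structure is one object; `H` with the adjoint action and the coaction `comul` is
another, and its multiplication is a morphism. With that coaction, the braiding of `H` past `T(V)`
is `h ⊗ y ↦ ∑ h₁ · y ⊗ h₂`. So the smash product is the braided tensor product of the algebras
`(T(V), *)` and `H`, and `Σ` is the braiding of the object `T(V) ⊗ H` with itself. The braided
algebra axioms are then formal: Yang–Baxter and the compatibilities with `m` are hexagons plus
naturality, `S⁻¹` inverts `Σ` (`natBraiding_bijective`), and associativity reduces to that of `*`
(`isAssocAlgebra_braidedTensor`).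

The substance is that `*` is an associative morphism. By the hexagons `β` is the natural braiding of
`T(V)` (`beta_natBraiding`), so `Δ_β` is coassociative with counit `ε ⊗ ε`. In the convolution
algebra `*` is the geometric series in `M`, hence solves `* = ε ⊗ ε + * ⋆ M` (`starProd_recursion`).
Because `M` kills degree `0`, recursions of this shape have at most one solution
(`eq_of_recursion`). This uniqueness is used three times: `*` is a coalgebra map from `Δ_β` to `δ`
(`IsStarProduct.deconcat_star`); `1` is a unit (`IsStarProduct.star_unit`); and the two bracketings
of a triple product, both obtained from coalgebra maps out of the braided tensor cube, coincide as
soon as their components in `V` do (`IsStarProduct.isAssocAlgebra`). In positive degrees those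
components are the two sides of the brace identity, and the unit takes care of degree `0`.

Finally, `P₀` is an idempotent algebra endomorphism, so the four terms of the weight `-1` identity
are all the same element; it is also a morphism, so it commutes with `Σ` by naturality. -/

open scoped TensorProduct

noncomputable section

namespace BraidedRB

/-! ### The Yetter–Drinfeld condition at a single vector. -/

section YetterDrinfeld

open Coalgebra (comul counit)
open TensorProduct (assoc tensorTensorTensorComm)

variable {K : Type*} [Field K] {H : Type*} [Ring H] [HopfAlgebra K H]
variable {X : Type*} [AddCommGroup X] [Module K X] {Y : Type*} [AddCommGroup Y] [Module K Y]
variable {Z : Type*} [AddCommGroup Z] [Module K Z] {W : Type*} [AddCommGroup W] [Module K W]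
variable {X' : Type*} [AddCommGroup X'] [Module K X'] {Y' : Type*} [AddCommGroup Y'] [Module K Y']

@[simp] theorem mulFirst_tmul (h : H) (x : X) (k : H) :
    mulFirst ((h ⊗ₜ[K] x) ⊗ₜ[K] k) = (h * k) ⊗ₜ x := by
  simp [mulFirst]

/-- `(g ⊗ x) ⊗ (k ⊗ y) ↦ g k ⊗ (x ⊗ y)`. -/
def coMerge : (H ⊗[K] X) ⊗[K] (H ⊗[K] Y) →ₗ[K] H ⊗[K] (X ⊗[K] Y) :=
  (LinearMap.mul' K H).rTensor (X ⊗[K] Y) ∘ₗ (tensorTensorTensorComm K H X H Y).toLinearMap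

@[simp] theorem coMerge_tmul (g k : H) (x : X) (y : Y) :
    coMerge ((g ⊗ₜ[K] x) ⊗ₜ[K] (k ⊗ₜ[K] y)) = (g * k) ⊗ₜ (x ⊗ₜ y) := by
  simp [coMerge]

theorem tensorCoact_tmul (coX : X →ₗ[K] H ⊗[K] X) (coY : Y →ₗ[K] H ⊗[K] Y) (x : X) (y : Y) :
    tensorCoact coX coY (x ⊗ₜ y) = coMerge (coX x ⊗ₜ coY y) := by
  simp [tensorCoact, coMerge]

theorem tensorAct_tmul (aX : H →ₗ[K] Module.End K X) (aY : H →ₗ[K] Module.End K Y) (h : H)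
    (x : X) (y : Y) :
    tensorAct aX aY h (x ⊗ₜ y) = TensorProduct.map (aX.flip x) (aY.flip y) (comul (R := K) h) := by
  simp only [tensorAct, LinearMap.comp_apply]
  induction comul (R := K) h using TensorProduct.induction_on with
  | zero => simp
  | tmul a b => simp
  | add s t hs ht => simp only [map_add, LinearMap.add_apply, hs, ht]

theorem natBraiding_tmul (coX : X →ₗ[K] H ⊗[K] X) (aY : H →ₗ[K] Module.End K Y) (x : X) (y : Y) :
    natBraiding coX aY (x ⊗ₜ y) = (aY.flip y).rTensor X (coX x) := by
  simp only [natBraiding, LinearMap.comp_apply, LinearMap.rTensor_tmul, LinearEquiv.coe_coe]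
  induction coX x using TensorProduct.induction_on with
  | zero => simp
  | tmul a b => simp
  | add s t hs ht => simp only [map_add, TensorProduct.add_tmul, hs, ht]

/-- `h₁ k ⊗ h₂ x` for `u = h₁ ⊗ h₂` and `t = k ⊗ x`. -/
def actMerge (aX : H →ₗ[K] Module.End K X) (t : H ⊗[K] X) : H ⊗[K] H →ₗ[K] H ⊗[K] X :=
  TensorProduct.map (LinearMap.mul' K H) (TensorProduct.lift aX) ∘ₗ
    (tensorTensorTensorComm K H H H X).toLinearMap ∘ₗ (TensorProduct.mk K _ _).flip t

@[simp] theorem actMerge_tmul (aX : H →ₗ[K] Module.End K X) (g h k : H) (x : X) :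
    actMerge aX (k ⊗ₜ x) (g ⊗ₜ h) = (g * k) ⊗ₜ (aX h x) := by
  simp [actMerge]

@[simp] theorem actMerge_zero (aX : H →ₗ[K] Module.End K X) : actMerge aX 0 = 0 := by
  ext; simp [actMerge]

theorem actMerge_add (aX : H →ₗ[K] Module.End K X) (s t : H ⊗[K] X) :
    actMerge aX (s + t) = actMerge aX s + actMerge aX t := by
  ext; simp [actMerge]

/-- The Yetter-Drinfeld compatibility condition at the vector `x`. -/
def CompatAt (aX : H →ₗ[K] Module.End K X) (coX : X →ₗ[K] H ⊗[K] X) (x : X) : Prop :=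
  actMerge aX (coX x) ∘ₗ comul = mulFirst ∘ₗ (coX ∘ₗ aX.flip x).rTensor H ∘ₗ comul

theorem IsYetterDrinfeld.compatAt {aX : H →ₗ[K] Module.End K X} {coX : X →ₗ[K] H ⊗[K] X}
    (hX : IsYetterDrinfeld aX coX) (x : X) : CompatAt aX coX x :=
  LinearMap.ext fun h => hX.compat h x

theorem CompatAt.add {aX : H →ₗ[K] Module.End K X} {coX : X →ₗ[K] H ⊗[K] X} {x y : X}
    (hx : CompatAt aX coX x) (hy : CompatAt aX coX y) : CompatAt aX coX (x + y) := by
  simp only [CompatAt, map_add, actMerge_add, LinearMap.add_comp, LinearMap.comp_add,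
    LinearMap.rTensor_add] at *
  rw [hx, hy]

theorem CompatAt.zero (aX : H →ₗ[K] Module.End K X) (coX : X →ₗ[K] H ⊗[K] X) :
    CompatAt aX coX 0 := by
  simp [CompatAt]

/-- A morphism carries each side of the condition at `x` to the same side at `f x`. Applied to
concatenation `V ⊗ T(V) → T(V)`, this raises the tensor degree in the induction on `T(V)`. -/
theorem CompatAt.map {aX : H →ₗ[K] Module.End K X} {coX : X →ₗ[K] H ⊗[K] X}
    {aY : H →ₗ[K] Module.End K Y} {coY : Y →ₗ[K] H ⊗[K] Y} {f : X →ₗ[K] Y}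
    (hf : IsYDHom aX coX aY coY f) {x : X} (hx : CompatAt aX coX x) : CompatAt aY coY (f x) := by
  ext h
  have h1 : ∀ (t : H ⊗[K] X) (u : H ⊗[K] H),
      actMerge aY (f.lTensor H t) u = f.lTensor H (actMerge aX t u) := by
    intro t u
    induction t using TensorProduct.induction_on with
    | zero => simp
    | add s t hs ht => simp only [map_add, actMerge_add, LinearMap.add_apply, hs, ht]
    | tmul k x =>
      induction u using TensorProduct.induction_on with
      | zero => simp
      | add s t hs ht => simp only [map_add, hs, ht]
      | tmul g h => simp [hf.map_act]
  have h2 : ∀ (t : (H ⊗[K] X) ⊗[K] H),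
      mulFirst ((f.lTensor H).rTensor H t) = f.lTensor H (mulFirst t) := by
    intro t
    induction t using TensorProduct.induction_on with
    | zero => simp
    | add s t hs ht => simp only [map_add, hs, ht]
    | tmul t h =>
      induction t using TensorProduct.induction_on with
      | zero => simp
      | add s t hs ht => simp only [map_add, TensorProduct.add_tmul, hs, ht]
      | tmul g h => simp
  have h3 : coY ∘ₗ aY.flip (f x) = f.lTensor H ∘ₗ coX ∘ₗ aX.flip x := by
    ext h; simp [← hf.map_act, hf.map_coact]
  simp only [LinearMap.comp_apply, hf.map_coact, h1, h3]
  rw [LinearMap.rTensor_comp, LinearMap.comp_apply, h2]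
  exact congrArg _ (LinearMap.congr_fun hx h)

theorem mulFirst_coMerge (s : H ⊗[K] X) (t : H ⊗[K] Y) (h : H) :
    mulFirst (coMerge (s ⊗ₜ t) ⊗ₜ h) = coMerge (s ⊗ₜ mulFirst (t ⊗ₜ[K] h)) := by
  induction s using TensorProduct.induction_on with
  | zero => simp
  | add s t hs ht => simp only [map_add, TensorProduct.add_tmul, hs, ht]
  | tmul g x =>
    induction t using TensorProduct.induction_on with
    | zero => simp
    | add s t hs ht => simp only [map_add, TensorProduct.add_tmul, TensorProduct.tmul_add, hs, ht]
    | tmul k y => simp [mul_assoc]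

/-- Associativity of `H`: a factor standing between `s₋₁` and `t₋₁` may be attached to either
neighbour. `CompatAt.tensor` uses it to hand the middle Sweedler leg from `y` to `x`. -/
theorem coMerge_actMerge (aY : H →ₗ[K] Module.End K Y) (s : H ⊗[K] X) (t : H ⊗[K] Y) (g h : H) :
    coMerge (s ⊗ₜ actMerge aY t (g ⊗ₜ h)) =
      coMerge (mulFirst (s ⊗ₜ[K] g) ⊗ₜ (aY h).lTensor H t) := by
  induction s using TensorProduct.induction_on with
  | zero => simp
  | add s t hs ht => simp only [map_add, TensorProduct.add_tmul, hs, ht]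
  | tmul g x =>
    induction t using TensorProduct.induction_on with
    | zero => simp
    | add s t hs ht =>
      simp only [map_add, TensorProduct.tmul_add, actMerge_add, LinearMap.add_apply, hs, ht]
    | tmul k y => simp [mul_assoc]

/-- In `∑ (h₁x)₋₁ (h₂y)₋₁ h₃ ⊗ (h₁x)₀ ⊗ (h₂y)₀` the condition at `y` moves a leg of `h` leftwards
past `y₋₁`, and then the condition at `x` moves one past `x₋₁`. Only the conditions at these two
vectors enter, so the lemma can serve as an inductive step on `T(V)`. -/
theorem CompatAt.tensor {aX : H →ₗ[K] Module.End K X} {coX : X →ₗ[K] H ⊗[K] X}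
    {aY : H →ₗ[K] Module.End K Y} {coY : Y →ₗ[K] H ⊗[K] Y} {x : X} {y : Y}
    (hx : CompatAt aX coX x) (hy : CompatAt aY coY y) :
    CompatAt (tensorAct aX aY) (tensorCoact coX coY) (x ⊗ₜ y) := by
  ext h
  simp only [LinearMap.comp_apply]
  set A := coX ∘ₗ aX.flip x with hA
  set B := coY ∘ₗ aY.flip y with hB
  -- `Q h = y₋₁ ⊗ h · y₀`, the contribution of `y` once the leg `h₂` has been passed to `x`.
  set Q : H →ₗ[K] H ⊗[K] Y := (LinearMap.lTensorHom H ∘ₗ aY).flip (coY y) with hQ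
  have r1 : ∀ u : H ⊗[K] H,
      mulFirst ((tensorCoact coX coY ∘ₗ (tensorAct aX aY).flip (x ⊗ₜ y)).rTensor H u) =
        coMerge (TensorProduct.map A (mulFirst ∘ₗ B.rTensor H)
          (assoc K H H H ((comul (R := K)).rTensor H u))) := by
    intro u
    induction u using TensorProduct.induction_on with
    | zero => simp
    | add s t hs ht => simp only [map_add, hs, ht]
    | tmul a b =>
      simp only [LinearMap.rTensor_tmul, LinearMap.comp_apply, LinearMap.flip_apply,
        tensorAct_tmul]
      induction comul (R := K) a using TensorProduct.induction_on with
      | zero => simp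
      | add s t hs ht => simp only [map_add, TensorProduct.add_tmul, hs, ht]
      | tmul c d =>
        simp [tensorCoact_tmul, mulFirst_coMerge, hA, hB]
  have r2 : ∀ u : H ⊗[K] (H ⊗[K] H),
      coMerge (TensorProduct.map A (actMerge aY (coY y)) u) =
        coMerge (TensorProduct.map (mulFirst ∘ₗ A.rTensor H) Q ((assoc K H H H).symm u)) := by
    intro u
    induction u using TensorProduct.induction_on with
    | zero => simp
    | add s t hs ht => simp only [map_add, hs, ht]
    | tmul a u =>
      induction u using TensorProduct.induction_on with
      | zero => simp
      | add s t hs ht => simp only [map_add, TensorProduct.tmul_add, hs, ht]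
      | tmul b c => simp [coMerge_actMerge, hQ]
  have r3 : ∀ u : H ⊗[K] H,
      actMerge (tensorAct aX aY) (tensorCoact coX coY (x ⊗ₜ y)) u =
      coMerge (TensorProduct.map (actMerge aX (coX x)) Q ((assoc K H H H).symm
        ((comul (R := K)).lTensor H u))) := by
    intro u
    rw [tensorCoact_tmul, hQ]
    generalize coX x = s
    generalize coY y = t
    induction s using TensorProduct.induction_on with
    | zero => simp [TensorProduct.map_zero_left]
    | add s t hs ht => simp only [map_add, TensorProduct.add_tmul, actMerge_add, LinearMap.add_apply,
        TensorProduct.map_add_left, hs, ht]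
    | tmul g x =>
      induction t using TensorProduct.induction_on with
      | zero => simp [TensorProduct.map_zero_right]
      | add s t hs ht => simp only [map_add, TensorProduct.tmul_add, actMerge_add,
          LinearMap.add_apply, TensorProduct.map_add_right, hs, ht]
      | tmul k y =>
        induction u using TensorProduct.induction_on with
        | zero => simp
        | add s t hs ht => simp only [map_add, hs, ht]
        | tmul a b =>
          simp only [coMerge_tmul, actMerge_tmul, tensorAct_tmul, LinearMap.lTensor_tmul]
          induction comul (R := K) b using TensorProduct.induction_on with
          | zero => simp
          | add s t hs ht => simp only [map_add, TensorProduct.tmul_add, hs, ht]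
          | tmul c d => simp [mul_assoc]
  have eL : ∀ (f : H →ₗ[K] H ⊗[K] X) (g : H ⊗[K] H →ₗ[K] H ⊗[K] Y) (u : H ⊗[K] H),
      TensorProduct.map f g ((comul (R := K)).lTensor H u) =
        TensorProduct.map f (g ∘ₗ comul) u := by
    intro f g u
    rw [← LinearMap.comp_apply, LinearMap.map_comp_lTensor]
  have eR : ∀ (f : H ⊗[K] H →ₗ[K] H ⊗[K] X) (g : H →ₗ[K] H ⊗[K] Y) (u : H ⊗[K] H),
      TensorProduct.map f g ((comul (R := K)).rTensor H u) =
        TensorProduct.map (f ∘ₗ comul) g u := by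
    intro f g u
    rw [← LinearMap.comp_apply, LinearMap.map_comp_rTensor]
  have hy' : (mulFirst ∘ₗ B.rTensor H) ∘ₗ comul = actMerge aY (coY y) ∘ₗ comul := hy.symm
  have hx' : (mulFirst ∘ₗ A.rTensor H) ∘ₗ comul = actMerge aX (coX x) ∘ₗ comul := hx.symm
  -- Coassociativity alternates between the bracketing in which `h₂, h₃` form a coproduct, needed
  -- for the condition at `y`, and the one in which `h₁, h₂` do, needed at `x`.
  rw [r1, Coalgebra.coassoc_apply, eL, hy', ← eL, r2, Coalgebra.coassoc_symm_apply, eR, hx', r3,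
    Coalgebra.coassoc_symm_apply, eR]

end YetterDrinfeld

/-! ### Tensor products, morphisms, and the natural braiding. -/

section YetterDrinfeldHom

open Coalgebra (comul counit)
open TensorProduct (assoc tensorTensorTensorComm)

variable {K : Type*} [Field K] {H : Type*} [Ring H] [HopfAlgebra K H]
variable {X : Type*} [AddCommGroup X] [Module K X] {Y : Type*} [AddCommGroup Y] [Module K Y]
variable {Z : Type*} [AddCommGroup Z] [Module K Z] {W : Type*} [AddCommGroup W] [Module K W]
variable {X' : Type*} [AddCommGroup X'] [Module K X'] {Y' : Type*} [AddCommGroup Y'] [Module K Y']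
variable {aX : H →ₗ[K] Module.End K X} {coX : X →ₗ[K] H ⊗[K] X}
variable {aY : H →ₗ[K] Module.End K Y} {coY : Y →ₗ[K] H ⊗[K] Y}
variable {aZ : H →ₗ[K] Module.End K Z} {coZ : Z →ₗ[K] H ⊗[K] Z}
variable {aX' : H →ₗ[K] Module.End K X'} {coX' : X' →ₗ[K] H ⊗[K] X'}
variable {aY' : H →ₗ[K] Module.End K Y'} {coY' : Y' →ₗ[K] H ⊗[K] Y'}

theorem tensorAct_one_tmul {x : X} {y : Y} (hx : aX 1 x = x) (hy : aY 1 y = y) :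
    tensorAct aX aY 1 (x ⊗ₜ y) = x ⊗ₜ y := by
  simp [tensorAct_tmul, Algebra.TensorProduct.one_def, hx, hy]

/-- `comul` is multiplicative. The hypotheses concern one pair of vectors, because on `T(V)` this is
applied before the module axioms are known on the whole second factor. -/
theorem tensorAct_mul_tmul {x : X} {y : Y} (hx : ∀ g h, aX (g * h) x = aX g (aX h x))
    (hy : ∀ g h, aY (g * h) y = aY g (aY h y)) (g h : H) :
    tensorAct aX aY (g * h) (x ⊗ₜ y) = tensorAct aX aY g (tensorAct aX aY h (x ⊗ₜ y)) := by
  simp only [tensorAct_tmul, Bialgebra.comul_mul]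
  induction comul (R := K) h using TensorProduct.induction_on with
  | zero => simp
  | add s t hs ht => simp only [map_add, mul_add, hs, ht]
  | tmul a b =>
    simp only [TensorProduct.map_tmul, LinearMap.flip_apply, tensorAct_tmul]
    induction comul (R := K) g using TensorProduct.induction_on with
    | zero => simp
    | add s t hs ht => simp only [map_add, add_mul, hs, ht]
    | tmul c d => simp [hx, hy]

theorem lid_counit_coMerge (s : H ⊗[K] X) (t : H ⊗[K] Y) :
    TensorProduct.lid K (X ⊗[K] Y) ((counit (R := K) (A := H)).rTensor _ (coMerge (s ⊗ₜ t))) =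
      TensorProduct.lid K X ((counit (R := K) (A := H)).rTensor _ s) ⊗ₜ
        TensorProduct.lid K Y ((counit (R := K) (A := H)).rTensor _ t) := by
  induction s using TensorProduct.induction_on with
  | zero => simp
  | add s t hs ht => simp only [map_add, TensorProduct.add_tmul, hs, ht]
  | tmul g x =>
    induction t using TensorProduct.induction_on with
    | zero => simp
    | add s t hs ht => simp only [map_add, TensorProduct.tmul_add, hs, ht]
    | tmul k y => simp [TensorProduct.smul_tmul', TensorProduct.tmul_smul, smul_smul, mul_comm]

/-- `(g ⊗ s) ⊗ (k ⊗ t) ↦ g k ⊗ s t`. -/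
def coMerge₂ : (H ⊗[K] (H ⊗[K] X)) ⊗[K] (H ⊗[K] (H ⊗[K] Y)) →ₗ[K]
    H ⊗[K] (H ⊗[K] (X ⊗[K] Y)) :=
  TensorProduct.map (LinearMap.mul' K H) coMerge ∘ₗ
    (tensorTensorTensorComm K H (H ⊗[K] X) H (H ⊗[K] Y)).toLinearMap

/-- Multiplicativity of `comul`; together with `tensorCoact_lTensor_coMerge` it reduces
coassociativity of a diagonal coaction to that of the two factors. -/
theorem comul_coMerge (s : H ⊗[K] X) (t : H ⊗[K] Y) :
    assoc K H H (X ⊗[K] Y) ((comul (R := K) (A := H)).rTensor _ (coMerge (s ⊗ₜ t))) =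
      coMerge₂ (assoc K H H X ((comul (R := K) (A := H)).rTensor _ s) ⊗ₜ
        assoc K H H Y ((comul (R := K) (A := H)).rTensor _ t)) := by
  induction s using TensorProduct.induction_on with
  | zero => simp
  | add s t hs ht => simp only [map_add, TensorProduct.add_tmul, hs, ht]
  | tmul g x =>
    induction t using TensorProduct.induction_on with
    | zero => simp
    | add s t hs ht => simp only [map_add, TensorProduct.tmul_add, hs, ht]
    | tmul k y =>
      simp only [coMerge_tmul, LinearMap.rTensor_tmul, Bialgebra.comul_mul]
      induction comul (R := K) g using TensorProduct.induction_on with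
      | zero => simp
      | add s t hs ht => simp only [map_add, TensorProduct.add_tmul, add_mul, hs, ht]
      | tmul a b =>
        induction comul (R := K) k using TensorProduct.induction_on with
        | zero => simp
        | add s t hs ht =>
          simp only [map_add, TensorProduct.add_tmul, TensorProduct.tmul_add, mul_add, hs, ht]
        | tmul c d => simp [coMerge₂]

theorem tensorCoact_lTensor_coMerge (s : H ⊗[K] X) (t : H ⊗[K] Y) :
    (tensorCoact coX coY).lTensor H (coMerge (s ⊗ₜ t)) =
      coMerge₂ (coX.lTensor H s ⊗ₜ coY.lTensor H t) := by
  induction s using TensorProduct.induction_on with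
  | zero => simp
  | add s t hs ht => simp only [map_add, TensorProduct.add_tmul, hs, ht]
  | tmul g x =>
    induction t using TensorProduct.induction_on with
    | zero => simp
    | add s t hs ht => simp only [map_add, TensorProduct.tmul_add, hs, ht]
    | tmul k y => simp [coMerge₂, tensorCoact_tmul]

theorem IsYetterDrinfeld.tensor (hX : IsYetterDrinfeld aX coX) (hY : IsYetterDrinfeld aY coY) :
    IsYetterDrinfeld (tensorAct aX aY) (tensorCoact coX coY) where
  one_act v := by
    induction v using TensorProduct.induction_on with
    | zero => simp
    | add s t hs ht => simp only [map_add, hs, ht]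
    | tmul x y => exact tensorAct_one_tmul (hX.one_act x) (hY.one_act y)
  mul_act g h v := by
    induction v using TensorProduct.induction_on with
    | zero => simp
    | add s t hs ht => simp only [map_add, hs, ht]
    | tmul x y =>
      exact tensorAct_mul_tmul (fun g h => hX.mul_act g h x) (fun g h => hY.mul_act g h y) g h
  counit_coact v := by
    induction v using TensorProduct.induction_on with
    | zero => simp
    | add s t hs ht => simp only [map_add, hs, ht]
    | tmul x y => rw [tensorCoact_tmul, lid_counit_coMerge, hX.counit_coact, hY.counit_coact]
  coassoc v := by
    induction v using TensorProduct.induction_on with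
    | zero => simp
    | add s t hs ht => simp only [map_add, hs, ht]
    | tmul x y =>
      rw [tensorCoact_tmul, comul_coMerge, hX.coassoc, hY.coassoc, tensorCoact_lTensor_coMerge]
  compat h v := by
    suffices CompatAt (tensorAct aX aY) (tensorCoact coX coY) v from LinearMap.congr_fun this h
    induction v using TensorProduct.induction_on with
    | zero => exact CompatAt.zero _ _
    | add s t hs ht => exact hs.add ht
    | tmul x y => exact (hX.compatAt x).tensor (hY.compatAt y)

theorem IsYDHom.id : IsYDHom aX coX aX coX LinearMap.id where
  map_act _ _ := rfl
  map_coact v := by simp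

theorem IsYDHom.add {f g : X →ₗ[K] Y} (hf : IsYDHom aX coX aY coY f)
    (hg : IsYDHom aX coX aY coY g) : IsYDHom aX coX aY coY (f + g) where
  map_act h v := by simp [hf.map_act, hg.map_act]
  map_coact v := by simp [hf.map_coact, hg.map_coact, LinearMap.lTensor_add]

theorem IsYDHom.comp {g : Y →ₗ[K] Z} {f : X →ₗ[K] Y} (hg : IsYDHom aY coY aZ coZ g)
    (hf : IsYDHom aX coX aY coY f) : IsYDHom aX coX aZ coZ (g ∘ₗ f) where
  map_act h v := by simp [hf.map_act, hg.map_act]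
  map_coact v := by simp [hf.map_coact, hg.map_coact, LinearMap.lTensor_comp]

theorem IsYDHom.symm {f : X ≃ₗ[K] Y} (hf : IsYDHom aX coX aY coY f.toLinearMap) :
    IsYDHom aY coY aX coX f.symm.toLinearMap where
  map_act h v := by
    apply f.injective
    have := hf.map_act h (f.symm v)
    simp only [LinearEquiv.coe_coe, LinearEquiv.apply_symm_apply] at this ⊢
    exact this.symm
  map_coact v := by
    have := hf.map_coact (f.symm v)
    simp only [LinearEquiv.coe_coe, LinearEquiv.apply_symm_apply] at this ⊢
    rw [this, ← LinearMap.comp_apply, ← LinearMap.lTensor_comp]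
    simp

/-- A linear map on a tensor product is a morphism if it is one on pure tensors. -/
theorem IsYDHom.of_tmul {f : X ⊗[K] Y →ₗ[K] Z}
    (h₁ : ∀ h x y, f (tensorAct aX aY h (x ⊗ₜ y)) = aZ h (f (x ⊗ₜ y)))
    (h₂ : ∀ x y, coZ (f (x ⊗ₜ y)) = f.lTensor H (coMerge (coX x ⊗ₜ coY y))) :
    IsYDHom (tensorAct aX aY) (tensorCoact coX coY) aZ coZ f where
  map_act h v := by
    induction v using TensorProduct.induction_on with
    | zero => simp
    | add s t hs ht => simp only [map_add, hs, ht]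
    | tmul x y => exact h₁ h x y
  map_coact v := by
    induction v using TensorProduct.induction_on with
    | zero => simp
    | add s t hs ht => simp only [map_add, hs, ht]
    | tmul x y => rw [h₂, tensorCoact_tmul]

theorem coMerge_lTensor (f : X →ₗ[K] X') (g : Y →ₗ[K] Y') (s : H ⊗[K] X) (t : H ⊗[K] Y) :
    coMerge (f.lTensor H s ⊗ₜ g.lTensor H t) =
      (TensorProduct.map f g).lTensor H (coMerge (s ⊗ₜ t)) := by
  induction s using TensorProduct.induction_on with
  | zero => simp
  | add s t hs ht => simp only [map_add, TensorProduct.add_tmul, hs, ht]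
  | tmul g x =>
    induction t using TensorProduct.induction_on with
    | zero => simp
    | add s t hs ht => simp only [map_add, TensorProduct.tmul_add, hs, ht]
    | tmul k y => simp

theorem IsYDHom.map {f : X →ₗ[K] X'} {g : Y →ₗ[K] Y'} (hf : IsYDHom aX coX aX' coX' f)
    (hg : IsYDHom aY coY aY' coY' g) :
    IsYDHom (tensorAct aX aY) (tensorCoact coX coY) (tensorAct aX' aY') (tensorCoact coX' coY')
      (TensorProduct.map f g) := by
  refine .of_tmul (fun h x y => ?_) fun x y => ?_
  · simp only [tensorAct_tmul, TensorProduct.map_tmul]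
    induction comul (R := K) h using TensorProduct.induction_on with
    | zero => simp
    | add s t hs ht => simp only [map_add, hs, ht]
    | tmul a b => simp [hf.map_act, hg.map_act]
  · rw [TensorProduct.map_tmul, tensorCoact_tmul, hf.map_coact, hg.map_coact, coMerge_lTensor]

theorem IsYDHom.rTensor {f : X →ₗ[K] X'} (hf : IsYDHom aX coX aX' coX' f) :
    IsYDHom (tensorAct aX aY) (tensorCoact coX coY) (tensorAct aX' aY) (tensorCoact coX' coY)
      (f.rTensor Y) := hf.map .id

theorem IsYDHom.lTensor {f : Y →ₗ[K] Y'} (hf : IsYDHom aY coY aY' coY' f) :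
    IsYDHom (tensorAct aX aY) (tensorCoact coX coY) (tensorAct aX aY') (tensorCoact coX coY')
      (f.lTensor X) := IsYDHom.id.map hf

/-- For the actions this is coassociativity of `H`, for the coactions associativity of `H`. -/
theorem isYDHom_assoc :
    IsYDHom (tensorAct (tensorAct aX aY) aZ) (tensorCoact (tensorCoact coX coY) coZ)
      (tensorAct aX (tensorAct aY aZ)) (tensorCoact coX (tensorCoact coY coZ))
      (assoc K X Y Z).toLinearMap := by
  refine .of_tmul (fun h t z => ?_) fun t z => ?_
  · induction t using TensorProduct.induction_on with
    | zero => simp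
    | add s t hs ht => simp only [map_add, TensorProduct.add_tmul, hs, ht]
    | tmul x y =>
      have r1 : ∀ u : H ⊗[K] H, assoc K X Y Z (TensorProduct.map ((tensorAct aX aY).flip (x ⊗ₜ y))
          (aZ.flip z) u) = TensorProduct.map (aX.flip x) (TensorProduct.map (aY.flip y) (aZ.flip z))
            (assoc K H H H ((comul (R := K)).rTensor H u)) := by
        intro u
        induction u using TensorProduct.induction_on with
        | zero => simp
        | add s t hs ht => simp only [map_add, hs, ht]
        | tmul a b =>
          simp only [TensorProduct.map_tmul, LinearMap.flip_apply, tensorAct_tmul,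
            LinearMap.rTensor_tmul]
          induction comul (R := K) a using TensorProduct.induction_on with
          | zero => simp
          | add s t hs ht => simp only [map_add, TensorProduct.add_tmul, hs, ht]
          | tmul c d => simp
      have r2 : ∀ u : H ⊗[K] H, TensorProduct.map (aX.flip x) ((tensorAct aY aZ).flip (y ⊗ₜ z)) u =
          TensorProduct.map (aX.flip x) (TensorProduct.map (aY.flip y) (aZ.flip z))
            ((comul (R := K)).lTensor H u) := by
        intro u
        induction u using TensorProduct.induction_on with
        | zero => simp
        | add s t hs ht => simp only [map_add, hs, ht]
        | tmul a b => simp [tensorAct_tmul]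
      simp only [tensorAct_tmul, LinearEquiv.coe_coe, TensorProduct.assoc_tmul, r1, r2,
        Coalgebra.coassoc_apply]
  · induction t using TensorProduct.induction_on with
    | zero => simp
    | add s t hs ht => simp only [map_add, TensorProduct.add_tmul, hs, ht]
    | tmul x y =>
      simp only [tensorCoact_tmul, LinearEquiv.coe_coe, TensorProduct.assoc_tmul]
      generalize coX x = s
      generalize coY y = t
      generalize coZ z = u
      induction s using TensorProduct.induction_on with
      | zero => simp
      | add s t hs ht => simp only [map_add, TensorProduct.add_tmul, hs, ht]
      | tmul g x =>
        induction t using TensorProduct.induction_on with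
        | zero => simp
        | add s t hs ht => simp only [map_add, TensorProduct.tmul_add, TensorProduct.add_tmul, hs, ht]
        | tmul k y =>
          induction u using TensorProduct.induction_on with
          | zero => simp
          | add s t hs ht => simp only [map_add, TensorProduct.tmul_add, hs, ht]
          | tmul l z => simp [mul_assoc]

/-- The braiding sees its first argument only through the coaction, so colinearity suffices for
naturality there. -/
theorem natBraiding_rTensor (f : X →ₗ[K] X') (hf : ∀ v, coX' (f v) = f.lTensor H (coX v))
    (t : X ⊗[K] Y) :
    natBraiding coX' aY (f.rTensor Y t) = f.lTensor Y (natBraiding coX aY t) := by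
  induction t using TensorProduct.induction_on with
  | zero => simp
  | add s t hs ht => simp only [map_add, hs, ht]
  | tmul x y =>
    rw [LinearMap.rTensor_tmul, natBraiding_tmul, natBraiding_tmul, hf]
    induction coX x using TensorProduct.induction_on with
    | zero => simp
    | add s t hs ht => simp only [map_add, hs, ht]
    | tmul a b => simp

/-- The braiding sees its second argument only through the action, so linearity over `H` suffices.
-/
theorem natBraiding_lTensor (f : Y →ₗ[K] Y') (hf : ∀ h v, f (aY h v) = aY' h (f v))
    (t : X ⊗[K] Y) :
    natBraiding coX aY' (f.lTensor X t) = f.rTensor X (natBraiding coX aY t) := by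
  induction t using TensorProduct.induction_on with
  | zero => simp
  | add s t hs ht => simp only [map_add, hs, ht]
  | tmul x y =>
    rw [LinearMap.lTensor_tmul, natBraiding_tmul, natBraiding_tmul]
    induction coX x using TensorProduct.induction_on with
    | zero => simp
    | add s t hs ht => simp only [map_add, hs, ht]
    | tmul a b => simp [hf]

/-- The hexagon `c_{X ⊗ Y, Z} = (c_{X,Z} ⊗ id)(id ⊗ c_{Y,Z})`. -/
theorem natBraiding_tensor_left (hZ : ∀ g h v, aZ (g * h) v = aZ g (aZ h v)) (x : X) (y : Y)
    (z : Z) :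
    natBraiding (tensorCoact coX coY) aZ ((x ⊗ₜ y) ⊗ₜ z) =
      assoc K Z X Y ((natBraiding coX aZ).rTensor Y ((assoc K X Z Y).symm
        (x ⊗ₜ natBraiding coY aZ (y ⊗ₜ z)))) := by
  rw [natBraiding_tmul, natBraiding_tmul, tensorCoact_tmul]
  induction coY y using TensorProduct.induction_on with
  | zero => simp
  | add s t hs ht => simp only [map_add, TensorProduct.tmul_add, hs, ht]
  | tmul h y =>
    simp only [LinearMap.rTensor_tmul, LinearMap.flip_apply, TensorProduct.assoc_symm_tmul,
      natBraiding_tmul]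
    induction coX x using TensorProduct.induction_on with
    | zero => simp
    | add s t hs ht => simp only [map_add, TensorProduct.add_tmul, hs, ht]
    | tmul a b => simp [hZ]

/-- The hexagon `c_{X, Y ⊗ Z} = (id ⊗ c_{X,Z})(c_{X,Y} ⊗ id)`. -/
theorem natBraiding_tensor_right (hX : ∀ v, assoc K H H X ((comul (R := K) (A := H)).rTensor X
    (coX v)) = coX.lTensor H (coX v)) (x : X) (y : Y) (z : Z) :
    natBraiding coX (tensorAct aY aZ) (x ⊗ₜ (y ⊗ₜ z)) =
      (assoc K Y Z X).symm ((natBraiding coX aZ).lTensor Y (assoc K Y X Z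
        (natBraiding coX aY (x ⊗ₜ y) ⊗ₜ z))) := by
  rw [natBraiding_tmul, natBraiding_tmul]
  have h1 : ∀ t : H ⊗[K] X, ((tensorAct aY aZ).flip (y ⊗ₜ z)).rTensor X t =
      (assoc K Y Z X).symm (TensorProduct.map (aY.flip y) ((aZ.flip z).rTensor X)
        (assoc K H H X ((comul (R := K) (A := H)).rTensor X t))) := by
    intro t
    induction t using TensorProduct.induction_on with
    | zero => simp
    | add s t hs ht => simp only [map_add, hs, ht]
    | tmul h x =>
      simp only [LinearMap.rTensor_tmul, LinearMap.flip_apply, tensorAct_tmul]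
      induction comul (R := K) h using TensorProduct.induction_on with
      | zero => simp
      | add s t hs ht => simp only [map_add, TensorProduct.add_tmul, hs, ht]
      | tmul a b => simp
  have h2 : ∀ t : H ⊗[K] X, (natBraiding coX aZ).lTensor Y (assoc K Y X Z
      ((aY.flip y).rTensor X t ⊗ₜ z)) =
      TensorProduct.map (aY.flip y) ((aZ.flip z).rTensor X) (coX.lTensor H t) := by
    intro t
    induction t using TensorProduct.induction_on with
    | zero => simp
    | add s t hs ht => simp only [map_add, TensorProduct.add_tmul, hs, ht]
    | tmul h x => simp [natBraiding_tmul]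
  rw [h1, h2, hX]

/-- Linearity over `H` is the compatibility condition at `x`, with the `H`-leg made to act on `y`.
Colinearity is the condition at `y`, evaluated at the leg `x₋₁`. -/
theorem isYDHom_natBraiding (hX : IsYetterDrinfeld aX coX) (hY : IsYetterDrinfeld aY coY) :
    IsYDHom (tensorAct aX aY) (tensorCoact coX coY) (tensorAct aY aX) (tensorCoact coY coX)
      (natBraiding coX aY) := by
  refine .of_tmul (fun h x y => ?_) fun x y => ?_
  · have r1 : ∀ u : H ⊗[K] H, natBraiding coX aY (TensorProduct.map (aX.flip x) (aY.flip y) u) =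
        (aY.flip y).rTensor X (mulFirst ((coX ∘ₗ aX.flip x).rTensor H u)) := by
      intro u
      induction u using TensorProduct.induction_on with
      | zero => simp
      | add s t hs ht => simp only [map_add, hs, ht]
      | tmul a b =>
        simp only [TensorProduct.map_tmul, natBraiding_tmul, LinearMap.rTensor_tmul,
          LinearMap.flip_apply, LinearMap.comp_apply]
        induction coX (aX a x) using TensorProduct.induction_on with
        | zero => simp
        | add s t hs ht => simp only [map_add, TensorProduct.add_tmul, hs, ht]
        | tmul c d => simp [hY.mul_act]
    have r2 : ∀ t : H ⊗[K] X, tensorAct aY aX h ((aY.flip y).rTensor X t) =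
        (aY.flip y).rTensor X (actMerge aX t (comul h)) := by
      intro t
      induction t using TensorProduct.induction_on with
      | zero => simp
      | add s t hs ht => simp only [map_add, actMerge_add, LinearMap.add_apply, hs, ht]
      | tmul k x =>
        simp only [LinearMap.rTensor_tmul, tensorAct_tmul]
        induction comul (R := K) h using TensorProduct.induction_on with
        | zero => simp
        | add s t hs ht => simp only [map_add, hs, ht]
        | tmul c d => simp [hY.mul_act]
    rw [tensorAct_tmul, r1, natBraiding_tmul, r2]
    exact congrArg _ (LinearMap.congr_fun (hX.compatAt x) h).symm
  -- `Q (k ⊗ l ⊗ x) = (k · y)₋₁ l ⊗ (k · y)₀ ⊗ x`.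
  · let Q : H ⊗[K] (H ⊗[K] X) →ₗ[K] H ⊗[K] (Y ⊗[K] X) :=
      (assoc K H Y X).toLinearMap ∘ₗ
        (mulFirst ∘ₗ (coY ∘ₗ aY.flip y).rTensor H).rTensor X ∘ₗ (assoc K H H X).symm.toLinearMap
    have r1 : ∀ t : H ⊗[K] X, tensorCoact coY coX ((aY.flip y).rTensor X t) =
        Q (coX.lTensor H t) := by
      intro t
      induction t using TensorProduct.induction_on with
      | zero => simp
      | add s t hs ht => simp only [map_add, hs, ht]
      | tmul k x =>
        simp only [LinearMap.rTensor_tmul, LinearMap.lTensor_tmul, tensorCoact_tmul]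
        induction coX x using TensorProduct.induction_on with
        | zero => simp
        | add s t hs ht => simp only [map_add, TensorProduct.tmul_add, hs, ht]
        | tmul l x =>
          simp only [Q, LinearMap.comp_apply, LinearEquiv.coe_coe, TensorProduct.assoc_symm_tmul,
            LinearMap.rTensor_tmul]
          induction coY (aY.flip y k) using TensorProduct.induction_on with
          | zero => simp
          | add s t hs ht => simp only [map_add, TensorProduct.add_tmul, hs, ht]
          | tmul c d => simp
    have r2 : ∀ t : H ⊗[K] X, Q (assoc K H H X ((comul (R := K) (A := H)).rTensor X t)) =
        assoc K H Y X ((actMerge aY (coY y) ∘ₗ comul).rTensor X t) := by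
      intro t
      rw [hY.compatAt y]
      simp only [Q, LinearMap.comp_apply, LinearEquiv.coe_coe, LinearEquiv.symm_apply_apply,
        LinearMap.rTensor_comp]
    have r3 : ∀ (t : H ⊗[K] X) (s : H ⊗[K] Y),
        assoc K H Y X ((actMerge aY s ∘ₗ comul).rTensor X t) =
        assoc K H Y X ((actMerge aY s).rTensor X ((assoc K H H X).symm
          (assoc K H H X ((comul (R := K) (A := H)).rTensor X t)))) := by
      intro t s
      simp only [LinearEquiv.symm_apply_apply, LinearMap.rTensor_comp, LinearMap.comp_apply]
    have r4 : ∀ (t : H ⊗[K] X) (s : H ⊗[K] Y),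
        assoc K H Y X ((actMerge aY s).rTensor X ((assoc K H H X).symm (coX.lTensor H t))) =
        (natBraiding coX aY).lTensor H (coMerge (t ⊗ₜ s)) := by
      intro t s
      induction t using TensorProduct.induction_on with
      | zero => simp
      | add s t hs ht => simp only [map_add, TensorProduct.add_tmul, hs, ht]
      | tmul k x =>
        induction s using TensorProduct.induction_on with
        | zero => simp
        | add s t hs ht => simp only [map_add, TensorProduct.tmul_add, actMerge_add,
            LinearMap.rTensor_add, LinearMap.add_apply, hs, ht]
        | tmul m y =>
          simp only [LinearMap.lTensor_tmul, coMerge_tmul, natBraiding_tmul]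
          induction coX x using TensorProduct.induction_on with
          | zero => simp
          | add s t hs ht => simp only [map_add, TensorProduct.tmul_add, hs, ht]
          | tmul c d => simp
    -- Coassociativity of `X` turns `x₋₁ ⊗ (x₀)₋₁` into the two legs of a coproduct, where the
    -- condition at `y` applies, and afterwards turns them back.
    rw [natBraiding_tmul, r1, ← hX.coassoc, r2, r3, hX.coassoc, r4]

end YetterDrinfeldHom

/-! ### Twisted tensor products of associative algebras. -/

section MidMap

open TensorProduct (assoc)

variable {K : Type*} [Field K]
variable {X : Type*} [AddCommGroup X] [Module K X] {Y : Type*} [AddCommGroup Y] [Module K Y]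
variable {A B C D B' C' : Type*}
    [AddCommGroup A] [Module K A] [AddCommGroup B] [Module K B] [AddCommGroup C] [Module K C]
    [AddCommGroup D] [Module K D] [AddCommGroup B'] [Module K B'] [AddCommGroup C'] [Module K C']

/-- Insertion of `u` in the middle of `a ⊗ u ⊗ d`. -/
def insertMid (a : A) (d : D) : C' ⊗[K] B' →ₗ[K] (A ⊗[K] C') ⊗[K] (B' ⊗[K] D) :=
  TensorProduct.map (TensorProduct.mk K A C' a) ((TensorProduct.mk K B' D).flip d)

@[simp] theorem insertMid_tmul (a : A) (d : D) (c : C') (b : B') :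
    insertMid a d (c ⊗ₜ[K] b) = (a ⊗ₜ c) ⊗ₜ (b ⊗ₜ d) := rfl

theorem midMap_tmul (c : B ⊗[K] C →ₗ[K] C' ⊗[K] B') (a : A) (b : B) (x : C) (d : D) :
    midMap c ((a ⊗ₜ b) ⊗ₜ (x ⊗ₜ d)) = insertMid a d (c (b ⊗ₜ x)) := by
  simp only [midMap, LinearMap.comp_apply, LinearEquiv.coe_coe, TensorProduct.assoc_tmul,
    LinearMap.lTensor_tmul, TensorProduct.assoc_symm_tmul, LinearMap.rTensor_tmul]
  induction c (b ⊗ₜ x) using TensorProduct.induction_on with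
  | zero => simp
  | add s t hs ht => simp only [map_add, TensorProduct.tmul_add, TensorProduct.add_tmul, hs, ht]
  | tmul p q => simp

variable {mX : X ⊗[K] X →ₗ[K] X} {mY : Y ⊗[K] Y →ₗ[K] Y}

/-- The twisted tensor product of two associative algebras is associative if the twist is
compatible with both products. -/
theorem isAssocAlgebra_twist (hX : IsAssocAlgebra mX) (hY : IsAssocAlgebra mY)
    {c : Y ⊗[K] X →ₗ[K] X ⊗[K] Y}
    (h₁ : ∀ y y' x, c (mY (y ⊗ₜ y') ⊗ₜ x) = mY.lTensor X (assoc K X Y Y (c.rTensor Y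
      ((assoc K Y X Y).symm (y ⊗ₜ c (y' ⊗ₜ x))))))
    (h₂ : ∀ y x x', c (y ⊗ₜ mX (x ⊗ₜ x')) = mX.rTensor Y ((assoc K X X Y).symm (c.lTensor X
      (assoc K X Y X (c (y ⊗ₜ x) ⊗ₜ x'))))) :
    IsAssocAlgebra (TensorProduct.map mX mY ∘ₗ midMap c) := by
  intro s t r
  induction s using TensorProduct.induction_on with
  | zero => simp
  | add s t hs ht => simp only [map_add, TensorProduct.add_tmul, hs, ht]
  | tmul x h =>
  induction t using TensorProduct.induction_on with
  | zero => simp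
  | add s t hs ht => simp only [map_add, TensorProduct.tmul_add, TensorProduct.add_tmul, hs, ht]
  | tmul y k =>
  induction r using TensorProduct.induction_on with
  | zero => simp
  | add s t hs ht => simp only [map_add, TensorProduct.tmul_add, hs, ht]
  | tmul z l =>
  simp only [LinearMap.comp_apply, midMap_tmul]
  set m := TensorProduct.map mX mY ∘ₗ midMap c with hm
  -- `Ψ ((a ⊗ b) ⊗ (p ⊗ q)) = x (a b) ⊗ (p q) l`. In both bracketings `h` crosses `y`, `k` crosses
  -- `z`, and then `h` crosses `z`; only the order of multiplication differs.
  set Ψ : (X ⊗[K] X) ⊗[K] (Y ⊗[K] Y) →ₗ[K] X ⊗[K] Y :=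
    TensorProduct.map (mX ∘ₗ (TensorProduct.mk K X X x) ∘ₗ mX)
      (mY ∘ₗ (TensorProduct.mk K Y Y).flip l ∘ₗ mY) with hΨ
  have e₁ : ∀ u, m (TensorProduct.map mX mY (insertMid x k u) ⊗ₜ (z ⊗ₜ l)) =
      Ψ (midMap c (u ⊗ₜ c (k ⊗ₜ z))) := by
    intro u
    induction u using TensorProduct.induction_on with
    | zero => simp
    | add s t hs ht => simp only [map_add, TensorProduct.add_tmul, hs, ht]
    | tmul y h =>
      simp only [insertMid_tmul, TensorProduct.map_tmul, hm, LinearMap.comp_apply, midMap_tmul, h₁]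
      induction c (k ⊗ₜ z) using TensorProduct.induction_on with
      | zero => simp
      | add s t hs ht => simp only [map_add, TensorProduct.tmul_add, hs, ht]
      | tmul z k =>
        simp only [TensorProduct.assoc_symm_tmul, LinearMap.rTensor_tmul, midMap_tmul]
        induction c (h ⊗ₜ z) using TensorProduct.induction_on with
        | zero => simp
        | add s t hs ht => simp only [map_add, TensorProduct.add_tmul, hs, ht]
        | tmul z h => simp [hΨ, hX x]
  have e₂ : ∀ v, m ((x ⊗ₜ h) ⊗ₜ TensorProduct.map mX mY (insertMid y l v)) =
      Ψ (midMap c (c (h ⊗ₜ y) ⊗ₜ v)) := by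
    intro v
    induction v using TensorProduct.induction_on with
    | zero => simp
    | add s t hs ht => simp only [map_add, TensorProduct.tmul_add, hs, ht]
    | tmul z k =>
      simp only [insertMid_tmul, TensorProduct.map_tmul, hm, LinearMap.comp_apply, midMap_tmul, h₂]
      induction c (h ⊗ₜ y) using TensorProduct.induction_on with
      | zero => simp
      | add s t hs ht => simp only [map_add, TensorProduct.add_tmul, hs, ht]
      | tmul y h =>
        simp only [TensorProduct.assoc_tmul, LinearMap.lTensor_tmul, midMap_tmul]
        induction c (h ⊗ₜ z) using TensorProduct.induction_on with
        | zero => simp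
        | add s t hs ht => simp only [map_add, TensorProduct.tmul_add, hs, ht]
        | tmul z h => simp [hΨ, hY h]
  have e₁' := e₁ (c (h ⊗ₜ y))
  have e₂' := e₂ (c (k ⊗ₜ z))
  rw [hm, LinearMap.comp_apply] at e₁' e₂'
  rw [e₁', e₂']

end MidMap

/-! ### The natural braiding as a Yang–Baxter operator, and braided algebras. -/

section YetterDrinfeldBraiding

open Coalgebra (comul counit)
open TensorProduct (assoc tensorTensorTensorComm)

variable {K : Type*} [Field K] {H : Type*} [Ring H] [HopfAlgebra K H]
variable {X : Type*} [AddCommGroup X] [Module K X] {Y : Type*} [AddCommGroup Y] [Module K Y]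
variable {A B C D B' C' : Type*}
    [AddCommGroup A] [Module K A] [AddCommGroup B] [Module K B] [AddCommGroup C] [Module K C]
    [AddCommGroup D] [Module K D] [AddCommGroup B'] [Module K B'] [AddCommGroup C'] [Module K C']
variable {aX : H →ₗ[K] Module.End K X} {coX : X →ₗ[K] H ⊗[K] X}
variable {aY : H →ₗ[K] Module.End K Y} {coY : Y →ₗ[K] H ⊗[K] Y}
variable {aA : H →ₗ[K] Module.End K A} {coA : A →ₗ[K] H ⊗[K] A}
variable {aB : H →ₗ[K] Module.End K B} {coB : B →ₗ[K] H ⊗[K] B}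
variable {aC : H →ₗ[K] Module.End K C} {coC : C →ₗ[K] H ⊗[K] C}
variable {aD : H →ₗ[K] Module.End K D} {coD : D →ₗ[K] H ⊗[K] D}
variable {aB' : H →ₗ[K] Module.End K B'} {coB' : B' →ₗ[K] H ⊗[K] B'}
variable {aC' : H →ₗ[K] Module.End K C'} {coC' : C' →ₗ[K] H ⊗[K] C'}

theorem IsYDHom.midMap {c : B ⊗[K] C →ₗ[K] C' ⊗[K] B'}
    (hc : IsYDHom (tensorAct aB aC) (tensorCoact coB coC) (tensorAct aC' aB')
      (tensorCoact coC' coB') c) :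
    IsYDHom (tensorAct (tensorAct aA aB) (tensorAct aC aD))
      (tensorCoact (tensorCoact coA coB) (tensorCoact coC coD))
      (tensorAct (tensorAct aA aC') (tensorAct aB' aD))
      (tensorCoact (tensorCoact coA coC') (tensorCoact coB' coD)) (midMap c) :=
  (isYDHom_assoc.symm).comp
    ((IsYDHom.lTensor (isYDHom_assoc.comp (hc.rTensor.comp isYDHom_assoc.symm))).comp
      isYDHom_assoc)

/-- `S` reverses products, so it sends `∑ h₂ S⁻¹(h₁)` to `∑ h₁ S(h₂)`, where the antipode axiom
applies; injectivity of `S` brings the identity back. The companion lemma treats `∑ S⁻¹(h₂) h₁`. -/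
theorem mul_comm_antipodeInv_rTensor_comul
    (hS : Function.Bijective (HopfAlgebra.antipode K : H →ₗ[K] H)) (h : H) :
    LinearMap.mul' K H (TensorProduct.comm K H H
      ((LinearEquiv.ofBijective _ hS).symm.toLinearMap.rTensor H (comul h))) =
      algebraMap K H (counit h) := by
  apply hS.injective
  have : ∀ u : H ⊗[K] H, HopfAlgebra.antipode K (LinearMap.mul' K H (TensorProduct.comm K H H
      ((LinearEquiv.ofBijective _ hS).symm.toLinearMap.rTensor H u))) =
      LinearMap.mul' K H ((HopfAlgebra.antipode K).lTensor H u) := by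
    intro u
    induction u using TensorProduct.induction_on with
    | zero => simp
    | add s t hs ht => simp only [map_add, hs, ht]
    | tmul a b =>
      have : HopfAlgebra.antipode K ((LinearEquiv.ofBijective _ hS).symm a) = a :=
        (LinearEquiv.ofBijective _ hS).apply_symm_apply a
      simp [HopfAlgebra.antipode_mul_antidistrib, this]
  rw [this, HopfAlgebra.mul_antipode_lTensor_comul_apply]
  simp [Algebra.algebraMap_eq_smul_one]

theorem mul_comm_antipodeInv_lTensor_comul
    (hS : Function.Bijective (HopfAlgebra.antipode K : H →ₗ[K] H)) (h : H) :
    LinearMap.mul' K H (TensorProduct.comm K H H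
      ((LinearEquiv.ofBijective _ hS).symm.toLinearMap.lTensor H (comul h))) =
      algebraMap K H (counit h) := by
  apply hS.injective
  have : ∀ u : H ⊗[K] H, HopfAlgebra.antipode K (LinearMap.mul' K H (TensorProduct.comm K H H
      ((LinearEquiv.ofBijective _ hS).symm.toLinearMap.lTensor H u))) =
      LinearMap.mul' K H ((HopfAlgebra.antipode K).rTensor H u) := by
    intro u
    induction u using TensorProduct.induction_on with
    | zero => simp
    | add s t hs ht => simp only [map_add, hs, ht]
    | tmul a b =>
      have : HopfAlgebra.antipode K ((LinearEquiv.ofBijective _ hS).symm b) = b :=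
        (LinearEquiv.ofBijective _ hS).apply_symm_apply b
      simp [HopfAlgebra.antipode_mul_antidistrib, this]
  rw [this, HopfAlgebra.mul_antipode_rTensor_comul_apply]
  simp [Algebra.algebraMap_eq_smul_one]

/-- If `φ` is the counit on the coproduct, then it contracts a coaction. -/
theorem contract_coact (hX : IsYetterDrinfeld aX coX) (one_act : ∀ v, aY 1 v = v)
    (φ : H ⊗[K] H →ₗ[K] H) (hφ : ∀ h, φ (comul h) = algebraMap K H (counit h)) (x : X) (y : Y) :
    (aY.flip y ∘ₗ φ).rTensor X ((assoc K H H X).symm (coX.lTensor H (coX x))) = y ⊗ₜ x := by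
  rw [← hX.coassoc, LinearEquiv.symm_apply_apply]
  conv_rhs => rw [← hX.counit_coact x]
  induction coX x using TensorProduct.induction_on with
  | zero => simp
  | add s t hs ht => simp only [map_add, TensorProduct.tmul_add, hs, ht]
  | tmul h x =>
    simp [hφ, Algebra.algebraMap_eq_smul_one, one_act, TensorProduct.smul_tmul]

/-- The inverse is `y ⊗ x ↦ ∑ x₀ ⊗ S⁻¹(x₋₁) · y`. Either composite acts on `y` by a product of two
successive legs of the coaction of `x`, one of them under `S⁻¹`, and `contract_coact` collapses it.
-/
theorem natBraiding_bijective (hS : Function.Bijective (HopfAlgebra.antipode K : H →ₗ[K] H))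
    (hX : IsYetterDrinfeld aX coX) (hY : IsYetterDrinfeld aY coY) :
    Function.Bijective (natBraiding coX aY) := by
  set T : H →ₗ[K] H := (LinearEquiv.ofBijective _ hS).symm.toLinearMap with hT
  rw [Function.bijective_iff_has_inverse]
  -- `aY ∘ₗ T` need not be an action, but `natBraiding` is defined for any linear map, so its
  -- formula can be reused with `S⁻¹` inserted.
  set inv : Y ⊗[K] X →ₗ[K] X ⊗[K] Y := (TensorProduct.comm K Y X).toLinearMap ∘ₗ
    natBraiding coX (aY ∘ₗ T) ∘ₗ (TensorProduct.comm K Y X).toLinearMap with hinv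
  have inv_tmul : ∀ y x, inv (y ⊗ₜ x) =
      TensorProduct.comm K Y X (((aY ∘ₗ T).flip y).rTensor X (coX x)) := by
    intro y x
    simp only [hinv, LinearMap.comp_apply, LinearEquiv.coe_coe, TensorProduct.comm_tmul,
      natBraiding_tmul]
  refine ⟨inv, fun t => ?_, fun t => ?_⟩
  · induction t using TensorProduct.induction_on with
    | zero => simp
    | add s t hs ht => simp only [map_add, hs, ht]
    | tmul x y =>
      apply (TensorProduct.comm K X Y).injective
      rw [natBraiding_tmul, TensorProduct.comm_tmul, ← contract_coact hX hY.one_act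
        (LinearMap.mul' K H ∘ₗ (TensorProduct.comm K H H).toLinearMap ∘ₗ T.lTensor H)
        (mul_comm_antipodeInv_lTensor_comul hS)]
      induction coX x using TensorProduct.induction_on with
      | zero => simp
      | add s t hs ht => simp only [map_add, hs, ht]
      | tmul h x =>
        simp only [LinearMap.rTensor_tmul, LinearMap.lTensor_tmul, inv_tmul]
        induction coX x using TensorProduct.induction_on with
        | zero => simp
        | add s t hs ht => simp only [map_add, TensorProduct.tmul_add, hs, ht]
        | tmul k x => simp [hY.mul_act]
  · induction t using TensorProduct.induction_on with
    | zero => simp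
    | add s t hs ht => simp only [map_add, hs, ht]
    | tmul y x =>
      rw [inv_tmul, ← contract_coact hX hY.one_act
        (LinearMap.mul' K H ∘ₗ (TensorProduct.comm K H H).toLinearMap ∘ₗ T.rTensor H)
        (mul_comm_antipodeInv_rTensor_comul hS)]
      induction coX x using TensorProduct.induction_on with
      | zero => simp
      | add s t hs ht => simp only [map_add, hs, ht]
      | tmul h x =>
        simp only [LinearMap.rTensor_tmul, LinearMap.lTensor_tmul, TensorProduct.comm_tmul,
          natBraiding_tmul]
        induction coX x using TensorProduct.induction_on with
        | zero => simp
        | add s t hs ht => simp only [map_add, TensorProduct.tmul_add, hs, ht]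
        | tmul k x => simp [hY.mul_act]

theorem sigmaOne_assoc (σ : X ⊗[K] X →ₗ[K] X ⊗[K] X) (t : (X ⊗[K] X) ⊗[K] X) :
    sigmaOne σ (assoc K X X X t) = assoc K X X X (σ.rTensor X t) := by
  simp [sigmaOne]

/-- A hexagon: two successive crossings of `x` are one crossing past the object `X ⊗ X`. In this
form naturality can act on `t`. -/
theorem sigmaTwo_sigmaOne_natBraiding (hX : IsYetterDrinfeld aX coX) (x : X) (t : X ⊗[K] X) :
    sigmaTwo (natBraiding coX aX) (sigmaOne (natBraiding coX aX) (x ⊗ₜ t)) =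
      assoc K X X X (natBraiding coX (tensorAct aX aX) (x ⊗ₜ t)) := by
  induction t using TensorProduct.induction_on with
  | zero => simp
  | add s t hs ht => simp only [map_add, TensorProduct.tmul_add, hs, ht]
  | tmul y z => simp [sigmaOne, sigmaTwo, natBraiding_tensor_right hX.coassoc]

/-- After the hexagon, the Yang–Baxter equation is naturality of the crossing past `X ⊗ X` with
respect to the `H`-linear map `natBraiding coX aX` itself. -/
theorem isBraiding_natBraiding (hS : Function.Bijective (HopfAlgebra.antipode K : H →ₗ[K] H))
    (hX : IsYetterDrinfeld aX coX) : IsBraiding (natBraiding coX aX) where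
  bijective := natBraiding_bijective hS hX hX
  yangBaxter := by
    refine TensorProduct.ext' fun x t => ?_
    simp only [LinearMap.comp_apply]
    have : sigmaTwo (natBraiding coX aX) (x ⊗ₜ t) = x ⊗ₜ natBraiding coX aX t := rfl
    rw [this, sigmaTwo_sigmaOne_natBraiding hX, sigmaTwo_sigmaOne_natBraiding hX, sigmaOne_assoc,
      ← natBraiding_lTensor (natBraiding coX aX) (isYDHom_natBraiding hX hX).map_act]
    rfl

/-- Both mixed axioms are naturality of the braiding in the morphism `m`, with the crossing of `X ⊗
X` expanded by a hexagon. The left axiom needs `m` colinear, the right one needs it linear over `H`.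
-/
theorem isBraidedAlgebra_natBraiding
    (hS : Function.Bijective (HopfAlgebra.antipode K : H →ₗ[K] H)) (hX : IsYetterDrinfeld aX coX)
    {m : X ⊗[K] X →ₗ[K] X} (hm : IsAssocAlgebra m)
    (hmX : IsYDHom (tensorAct aX aX) (tensorCoact coX coX) aX coX m) :
    IsBraidedAlgebra m (natBraiding coX aX) where
  assoc := hm
  braiding := isBraiding_natBraiding hS hX
  braid_mul_left := by
    refine TensorProduct.ext_threefold' fun x y z => ?_
    have := natBraiding_rTensor (aY := aX) m hmX.map_coact ((x ⊗ₜ y) ⊗ₜ z)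
    rw [natBraiding_tensor_left hX.mul_act] at this
    exact this.symm
  braid_mul_right := by
    refine TensorProduct.ext' fun x t => ?_
    have := natBraiding_lTensor (coX := coX) m hmX.map_act (x ⊗ₜ t)
    simp only [LinearMap.comp_apply, sigmaTwo_sigmaOne_natBraiding hX, LinearEquiv.coe_coe,
      LinearEquiv.symm_apply_apply, this]

theorem natBraiding_map {f : X →ₗ[K] X} (hf : IsYDHom aX coX aX coX f) :
    natBraiding coX aX ∘ₗ TensorProduct.map f f = TensorProduct.map f f ∘ₗ natBraiding coX aX := by
  refine TensorProduct.ext' fun x y => ?_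
  have h1 := natBraiding_rTensor (aY := aX) f hf.map_coact (x ⊗ₜ f y)
  have h2 := natBraiding_lTensor (coX := coX) f hf.map_act (x ⊗ₜ y)
  simp only [LinearMap.rTensor_tmul, LinearMap.lTensor_tmul] at h1 h2
  simp only [LinearMap.comp_apply, TensorProduct.map_tmul, h1, h2]
  rw [← LinearMap.comp_apply, LinearMap.lTensor_comp_rTensor]

/-- The braided tensor product of two algebras in the category of Yetter-Drinfeld modules. -/
theorem isAssocAlgebra_braidedTensor (hX : IsYetterDrinfeld aX coX) (hY : IsYetterDrinfeld aY coY)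
    {mX : X ⊗[K] X →ₗ[K] X} {mY : Y ⊗[K] Y →ₗ[K] Y} (hmX : IsAssocAlgebra mX)
    (hmY : IsAssocAlgebra mY) (hX' : IsYDHom (tensorAct aX aX) (tensorCoact coX coX) aX coX mX)
    (hY' : IsYDHom (tensorAct aY aY) (tensorCoact coY coY) aY coY mY) :
    IsAssocAlgebra (TensorProduct.map mX mY ∘ₗ midMap (natBraiding coY aX)) := by
  -- The two compatibilities of the twist are again a hexagon combined with naturality in the
  -- respective multiplication.
  refine isAssocAlgebra_twist hmX hmY (fun y y' x => ?_) fun y x x' => ?_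
  · have := natBraiding_rTensor (aY := aX) mY hY'.map_coact ((y ⊗ₜ y') ⊗ₜ x)
    rwa [natBraiding_tensor_left hX.mul_act] at this
  · have := natBraiding_lTensor (coX := coY) mX hX'.map_act (y ⊗ₜ (x ⊗ₜ x'))
    rwa [natBraiding_tensor_right hY.coassoc] at this

theorem isYDHom_braidedTensor_mul (hX : IsYetterDrinfeld aX coX) (hY : IsYetterDrinfeld aY coY)
    {mX : X ⊗[K] X →ₗ[K] X} {mY : Y ⊗[K] Y →ₗ[K] Y}
    (hX' : IsYDHom (tensorAct aX aX) (tensorCoact coX coX) aX coX mX)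
    (hY' : IsYDHom (tensorAct aY aY) (tensorCoact coY coY) aY coY mY) :
    IsYDHom (tensorAct (tensorAct aX aY) (tensorAct aX aY))
      (tensorCoact (tensorCoact coX coY) (tensorCoact coX coY)) (tensorAct aX aY)
      (tensorCoact coX coY) (TensorProduct.map mX mY ∘ₗ midMap (natBraiding coY aX)) :=
  (hX'.map hY').comp (isYDHom_natBraiding hY hX).midMap

end YetterDrinfeldBraiding

/-! ### `H` as an algebra in its own Yetter–Drinfeld category. -/

section Adjoint

open Coalgebra (comul counit)
open TensorProduct (assoc tensorTensorTensorComm)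

variable {K : Type*} [Field K] {H : Type*} [Ring H] [HopfAlgebra K H]

/-- `a ⊗ b ↦ a k S(b)`. -/
def conjMap (k : H) : H ⊗[K] H →ₗ[K] H :=
  LinearMap.mul' K H ∘ₗ TensorProduct.map (LinearMap.mulRight K k) (HopfAlgebra.antipode K)

@[simp] theorem conjMap_tmul (k a b : H) :
    conjMap k (a ⊗ₜ[K] b) = a * k * HopfAlgebra.antipode K b := rfl

theorem adjointAct_apply (h k : H) : adjointAct (K := K) h k = conjMap k (comul (R := K) h) := by
  simp only [adjointAct, LinearMap.comp_apply]
  induction comul (R := K) h using TensorProduct.induction_on with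
  | zero => simp
  | add s t hs ht => simp only [map_add, LinearMap.add_apply, hs, ht]
  | tmul a b => simp [mul_assoc]

/-- `∑ (h₁ · k) h₂ = h k`. -/
theorem adjointAct_mul (h k : H) :
    LinearMap.mul' K H ((adjointAct.flip k).rTensor H (comul (R := K) h)) = h * k := by
  have h1 : ∀ u : H ⊗[K] H, LinearMap.mul' K H ((adjointAct.flip k).rTensor H u) =
      LinearMap.mul' K H ((LinearMap.mul' K H ∘ₗ (HopfAlgebra.antipode K).rTensor H).lTensor H
        ((LinearMap.mulRight K k).rTensor _
          (assoc K H H H ((comul (R := K)).rTensor H u)))) := by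
    intro u
    induction u using TensorProduct.induction_on with
    | zero => simp
    | add s t hs ht => simp only [map_add, hs, ht]
    | tmul a b =>
      simp only [LinearMap.rTensor_tmul, LinearMap.flip_apply, adjointAct_apply]
      induction comul (R := K) a using TensorProduct.induction_on with
      | zero => simp
      | add s t hs ht => simp only [map_add, TensorProduct.add_tmul, hs, ht]
      | tmul c d => simp [mul_assoc]
  have h2 : ∀ u : H ⊗[K] H,
      LinearMap.mul' K H ((LinearMap.mul' K H ∘ₗ (HopfAlgebra.antipode K).rTensor H).lTensor H
        ((LinearMap.mulRight K k).rTensor _ ((comul (R := K)).lTensor H u))) =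
      TensorProduct.rid K H ((counit (R := K)).lTensor H u) * k := by
    intro u
    induction u using TensorProduct.induction_on with
    | zero => simp
    | add s t hs ht => simp only [map_add, add_mul, hs, ht]
    | tmul a b =>
      simp [HopfAlgebra.mul_antipode_rTensor_comul_apply, Algebra.algebraMap_eq_smul_one]
  rw [h1, Coalgebra.coassoc_apply, h2, Coalgebra.lTensor_counit_comul]
  simp

/-- `∑ (h₁ ⊗ h₂) (1 ⊗ S(h₃)) = h ⊗ 1`. -/
theorem comul_mul_antipode (h : H) :
    LinearMap.mul' K (H ⊗[K] H) (TensorProduct.map comul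
      (TensorProduct.mk K H H 1 ∘ₗ HopfAlgebra.antipode K) (comul (R := K) h)) = h ⊗ₜ 1 := by
  have h1 : ∀ u : H ⊗[K] H, LinearMap.mul' K (H ⊗[K] H) (TensorProduct.map comul
      (TensorProduct.mk K H H 1 ∘ₗ HopfAlgebra.antipode K) u) =
      (LinearMap.mul' K H ∘ₗ (HopfAlgebra.antipode K).lTensor H).lTensor H
        (assoc K H H H ((comul (R := K)).rTensor H u)) := by
    intro u
    induction u using TensorProduct.induction_on with
    | zero => simp
    | add s t hs ht => simp only [map_add, hs, ht]
    | tmul a b =>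
      simp only [TensorProduct.map_tmul, LinearMap.rTensor_tmul]
      induction comul (R := K) a using TensorProduct.induction_on with
      | zero => simp
      | add s t hs ht => simp only [map_add, TensorProduct.add_tmul, hs, ht]
      | tmul c d => simp
  have h2 : ∀ u : H ⊗[K] H,
      (LinearMap.mul' K H ∘ₗ (HopfAlgebra.antipode K).lTensor H).lTensor H
        ((comul (R := K)).lTensor H u) =
      TensorProduct.rid K H ((counit (R := K)).lTensor H u) ⊗ₜ 1 := by
    intro u
    induction u using TensorProduct.induction_on with
    | zero => simp
    | add s t hs ht => simp only [map_add, TensorProduct.add_tmul, hs, ht]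
    | tmul a b =>
      simp [HopfAlgebra.mul_antipode_lTensor_comul_apply, Algebra.algebraMap_eq_smul_one,
        TensorProduct.smul_tmul]
  rw [h1, Coalgebra.coassoc_apply, h2, Coalgebra.lTensor_counit_comul]
  simp

theorem mulFirst_eq_mul (t : H ⊗[K] H) (h : H) : mulFirst (t ⊗ₜ[K] h) = t * (h ⊗ₜ 1) := by
  induction t using TensorProduct.induction_on with
  | zero => simp
  | add s t hs ht => simp only [map_add, TensorProduct.add_tmul, add_mul, hs, ht]
  | tmul a b => simp

/-- For compatibility, replace `h₂ ⊗ 1` in `∑ Δ(h₁ · k)(h₂ ⊗ 1)` by `∑ Δ(h₂)(1 ⊗ S(h₃))`. Then `∑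
(h₁ · k) h₂ = h k` under `Δ` gives `∑ Δ(h₁) Δ(k) (1 ⊗ S(h₂))`, which is the other side. This way the
coproduct of an antipode is never expanded. -/
theorem isYetterDrinfeld_adjoint :
    IsYetterDrinfeld (K := K) (H := H) (V := H) adjointAct comul where
  one_act v := by simp [adjointAct_apply, Algebra.TensorProduct.one_def]
  mul_act g h v := by
    rw [adjointAct_apply, adjointAct_apply h, Bialgebra.comul_mul]
    induction comul (R := K) h using TensorProduct.induction_on with
    | zero => simp
    | add s t hs ht => simp only [map_add, mul_add, hs, ht]
    | tmul a b =>
      rw [adjointAct_apply]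
      induction comul (R := K) g using TensorProduct.induction_on with
      | zero => simp
      | add s t hs ht => simp only [map_add, add_mul, hs, ht]
      | tmul c d => simp [HopfAlgebra.antipode_mul_antidistrib, mul_assoc]
  counit_coact v := by simp
  coassoc v := Coalgebra.coassoc_apply v
  compat h k := by
    suffices CompatAt (K := K) adjointAct comul k from LinearMap.congr_fun this h
    ext h
    simp only [LinearMap.comp_apply]
    let S' : H →ₗ[K] H ⊗[K] H := TensorProduct.mk K H H 1 ∘ₗ HopfAlgebra.antipode K
    -- `F (a ⊗ b ⊗ c) = Δ((a · k) b) (1 ⊗ S(c))`.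
    let F : H ⊗[K] (H ⊗[K] H) →ₗ[K] H ⊗[K] H := LinearMap.mul' K (H ⊗[K] H) ∘ₗ
      TensorProduct.map (comul ∘ₗ LinearMap.mul' K H ∘ₗ (adjointAct.flip k).rTensor H) S' ∘ₗ
      (assoc K H H H).symm.toLinearMap
    have r1 : ∀ u : H ⊗[K] H, mulFirst ((comul ∘ₗ adjointAct.flip k).rTensor H u) =
        F ((comul (R := K)).lTensor H u) := by
      intro u
      induction u using TensorProduct.induction_on with
      | zero => simp
      | add s t hs ht => simp only [map_add, hs, ht]
      | tmul a b =>
        rw [LinearMap.rTensor_tmul, mulFirst_eq_mul, ← comul_mul_antipode, LinearMap.lTensor_tmul]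
        induction comul (R := K) b using TensorProduct.induction_on with
        | zero => simp
        | add s t hs ht => simp only [map_add, mul_add, TensorProduct.tmul_add, hs, ht]
        | tmul c d => simp [F, S', mul_assoc]
    have r2 : ∀ u : H ⊗[K] H, F (assoc K H H H ((comul (R := K)).rTensor H u)) =
        LinearMap.mul' K (H ⊗[K] H)
          (TensorProduct.map (LinearMap.mulRight K (comul k) ∘ₗ comul) S' u) := by
      intro u
      induction u using TensorProduct.induction_on with
      | zero => simp
      | add s t hs ht => simp only [map_add, hs, ht]
      | tmul a b => simp [F, adjointAct_mul]
    have r3 : ∀ t u : H ⊗[K] H, actMerge adjointAct t u = LinearMap.mul' K (H ⊗[K] H)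
        (TensorProduct.map (LinearMap.mulRight K t) S'
          ((assoc K H H H).symm ((comul (R := K)).lTensor H u))) := by
      intro t u
      induction u using TensorProduct.induction_on with
      | zero => simp
      | add s t hs ht => simp only [map_add, hs, ht]
      | tmul a b =>
        induction t using TensorProduct.induction_on with
        | zero =>
          simp only [actMerge_zero, LinearMap.zero_apply, LinearMap.lTensor_tmul]
          induction comul (R := K) b using TensorProduct.induction_on with
          | zero => simp
          | add s t hs ht => rw [TensorProduct.tmul_add, map_add, map_add, map_add, ← hs, ← ht,
              add_zero]
          | tmul e f => simp
        | add s t hs ht =>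
          rw [actMerge_add, LinearMap.add_apply, hs, ht, LinearMap.lTensor_tmul]
          induction comul (R := K) b using TensorProduct.induction_on with
          | zero => simp
          | add s t hs ht =>
            simp only [TensorProduct.tmul_add, map_add] at hs ht ⊢
            rw [← hs, ← ht]
            abel
          | tmul e f => simp [mul_add, add_mul]
        | tmul c d =>
          simp only [actMerge_tmul, LinearMap.lTensor_tmul, adjointAct_apply]
          induction comul (R := K) b using TensorProduct.induction_on with
          | zero => simp
          | add s t hs ht => simp only [map_add, TensorProduct.tmul_add, hs, ht]
          | tmul e f => simp [S', mul_assoc]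
    rw [r1, ← Coalgebra.coassoc_apply, r2, r3, Coalgebra.coassoc_symm_apply]
    induction comul (R := K) h using TensorProduct.induction_on with
    | zero => simp
    | add s t hs ht => simp only [map_add, hs, ht]
    | tmul a b => simp

/-- In `∑ (h₁ · x)(h₂ · y)` expand only the second action, as `h₂ y S(h₃)`; then `adjointAct_mul`
merges `(h₁ · x) h₂` into `h₁ x`. Colinearity is multiplicativity of `comul`. -/
theorem isYDHom_mul :
    IsYDHom (K := K) (H := H) (tensorAct adjointAct adjointAct) (tensorCoact comul comul)
      adjointAct comul (LinearMap.mul' K H) := by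
  refine .of_tmul (fun h x y => ?_) fun x y => ?_
  · let F : H ⊗[K] (H ⊗[K] H) →ₗ[K] H := LinearMap.mul' K H ∘ₗ
      TensorProduct.map (LinearMap.mulRight K y ∘ₗ LinearMap.mul' K H ∘ₗ
        (adjointAct.flip x).rTensor H) (HopfAlgebra.antipode K) ∘ₗ (assoc K H H H).symm.toLinearMap
    have r1 : ∀ u : H ⊗[K] H, LinearMap.mul' K H
        (TensorProduct.map (adjointAct.flip x) (adjointAct.flip y) u) =
        F ((comul (R := K)).lTensor H u) := by
      intro u
      induction u using TensorProduct.induction_on with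
      | zero => simp
      | add s t hs ht => simp only [map_add, hs, ht]
      | tmul a b =>
        simp only [TensorProduct.map_tmul, LinearMap.flip_apply, adjointAct_apply b,
          LinearMap.lTensor_tmul]
        induction comul (R := K) b using TensorProduct.induction_on with
        | zero => simp
        | add s t hs ht => simp only [map_add, TensorProduct.tmul_add, hs, ht]
        | tmul c d => simp [F, mul_assoc]
    have r2 : ∀ u : H ⊗[K] H, F (assoc K H H H ((comul (R := K)).rTensor H u)) =
        conjMap (x * y) u := by
      intro u
      induction u using TensorProduct.induction_on with
      | zero => simp
      | add s t hs ht => simp only [map_add, hs, ht]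
      | tmul a b => simp [F, adjointAct_mul, mul_assoc]
    rw [tensorAct_tmul, r1, ← Coalgebra.coassoc_apply, r2, adjointAct_apply, LinearMap.mul'_apply]
  · rw [LinearMap.mul'_apply, Bialgebra.comul_mul]
    induction comul (R := K) x using TensorProduct.induction_on with
    | zero => simp
    | add s t hs ht => simp only [map_add, TensorProduct.add_tmul, add_mul, hs, ht]
    | tmul a b =>
      induction comul (R := K) y using TensorProduct.induction_on with
      | zero => simp
      | add s t hs ht => simp only [map_add, TensorProduct.tmul_add, mul_add, hs, ht]
      | tmul c d => simp

end Adjoint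

/-! ### The tensor algebra as a Yetter–Drinfeld module, and its braiding. -/

section TensorAlgebraYD

open Coalgebra (comul counit)
open TensorProduct (assoc tensorTensorTensorComm)

variable {K : Type*} [Field K] {V : Type*} [AddCommGroup V] [Module K V]

/-- The elements whose left multiplication preserves `P` include the scalars and `V` and are closed
under sums and products. The principle matches `tensorFold`, which peels off the leftmost vector. -/
theorem tensorAlgebra_induction_left {P : TensorAlgebra K V → Prop} (one : P 1)
    (smul : ∀ (c : K) x, P x → P (c • x)) (add : ∀ x y, P x → P y → P (x + y))
    (ι_mul : ∀ v y, P y → P (TensorAlgebra.ι K v * y)) (x : TensorAlgebra K V) : P x := by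
  suffices ∀ x y : TensorAlgebra K V, P y → P (x * y) by simpa using this x 1 one
  intro x
  induction x using TensorAlgebra.induction with
  | algebraMap r => intro y hy; rw [← Algebra.smul_def]; exact smul r y hy
  | ι v => intro y hy; exact ι_mul v y hy
  | mul a b ha hb => intro y hy; rw [mul_assoc]; exact ha _ (hb _ hy)
  | add a b ha hb => intro y hy; rw [add_mul]; exact add _ _ (ha _ hy) (hb _ hy)

variable (K V) in
/-- `v ⊗ y ↦ v y`. -/
def consMap : V ⊗[K] TensorAlgebra K V →ₗ[K] TensorAlgebra K V :=
  LinearMap.mul' K (TensorAlgebra K V) ∘ₗ (TensorAlgebra.ι K).rTensor (TensorAlgebra K V)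

@[simp] theorem consMap_tmul (v : V) (y : TensorAlgebra K V) :
    consMap K V (v ⊗ₜ y) = TensorAlgebra.ι K v * y := rfl

theorem betaOne_one (σ : V ⊗[K] V →ₗ[K] V ⊗[K] V) (v : V) : betaOne σ 1 v = 1 ⊗ₜ v := by
  simp [betaOne, tensorFold_one]

/-- The defining recursion, rewritten through `consMap` so that it has the shape of the hexagon
`natBraiding_tensor_right`. -/
theorem betaOne_ι_mul (σ : V ⊗[K] V →ₗ[K] V ⊗[K] V) (v w : V) (y : TensorAlgebra K V) :
    betaOne σ (TensorAlgebra.ι K w * y) v = (consMap K V).rTensor V ((assoc K _ _ _).symm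
      ((betaOne σ y).lTensor V (σ (v ⊗ₜ w)))) := by
  simp only [betaOne, tensorFold_ι_mul]
  generalize tensorFold (X := V →ₗ[K] TensorAlgebra K V ⊗[K] V) _ _ y = f
  simp only [LinearMap.mk₂_apply, LinearMap.comp_apply, LinearEquiv.coe_coe, LinearMap.flip_apply,
    TensorProduct.mk_apply]
  induction σ (v ⊗ₜ w) using TensorProduct.induction_on with
  | zero => simp
  | add s t hs ht => simp only [map_add, hs, ht]
  | tmul a b =>
    simp only [TensorProduct.map_tmul, LinearMap.lTensor_tmul]
    induction f b using TensorProduct.induction_on with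
    | zero => simp
    | add s t hs ht => simp only [map_add, TensorProduct.tmul_add, hs, ht]
    | tmul c d => simp

theorem betaCurried_one (σ : V ⊗[K] V →ₗ[K] V ⊗[K] V) (y : TensorAlgebra K V) :
    betaCurried σ 1 y = y ⊗ₜ 1 := by
  simp [betaCurried, tensorFold_one]

theorem betaCurried_ι_mul (σ : V ⊗[K] V →ₗ[K] V ⊗[K] V) (v : V) (x y : TensorAlgebra K V) :
    betaCurried σ (TensorAlgebra.ι K v * x) y = (consMap K V).lTensor _ (assoc K _ _ _
      (((betaOne σ).flip v).rTensor _ (betaCurried σ x y))) := by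
  simp only [betaCurried, tensorFold_ι_mul]
  generalize tensorFold
    (X := TensorAlgebra K V →ₗ[K] TensorAlgebra K V ⊗[K] TensorAlgebra K V) _ _ x = f
  simp only [LinearMap.mk₂_apply, LinearMap.comp_apply, LinearEquiv.coe_coe]
  induction f y using TensorProduct.induction_on with
  | zero => simp
  | add s t hs ht => simp only [map_add, hs, ht]
  | tmul a b =>
    simp only [LinearMap.rTensor_tmul, LinearMap.comp_apply, LinearMap.flip_apply]
    induction betaOne σ a v using TensorProduct.induction_on with
    | zero => simp
    | add s t hs ht => simp only [map_add, TensorProduct.add_tmul, hs, ht]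
    | tmul c d => simp

theorem tensorCounit_ι_mul (v : V) (y : TensorAlgebra K V) :
    tensorCounit (TensorAlgebra.ι K v * y) = 0 := by
  simp [tensorCounit, TensorAlgebra.algebraMapInv]

theorem tensorCounit_mul (x y : TensorAlgebra K V) :
    tensorCounit (x * y) = tensorCounit x * tensorCounit y := by
  simp [tensorCounit]

@[simp] theorem tensorCounit_one : tensorCounit (1 : TensorAlgebra K V) = 1 := by
  simp [tensorCounit]

@[simp] theorem tensorCounit_algebraMap (r : K) :
    tensorCounit (algebraMap K (TensorAlgebra K V) r) = r := by
  simp [tensorCounit]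

@[simp] theorem tensorCounit_ι (v : V) : tensorCounit (TensorAlgebra.ι K v) = 0 := by
  simpa using tensorCounit_ι_mul v 1

/-- The recursion of `deconcat` expressed through `consMap`, the associator and insertion of `1`,
maps that will all be morphisms. -/
theorem deconcat_consMap (t : V ⊗[K] TensorAlgebra K V) :
    deconcat (consMap K V t) = 1 ⊗ₜ consMap K V t +
      (consMap K V).rTensor _ ((assoc K _ _ _).symm (deconcat.lTensor V t)) := by
  induction t using TensorProduct.induction_on with
  | zero => simp
  | add s t hs ht => simp only [map_add, TensorProduct.tmul_add, hs, ht]; abel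
  | tmul v y =>
    rw [consMap_tmul, deconcat_ι_mul, LinearMap.lTensor_tmul]
    congr 1
    induction deconcat y using TensorProduct.induction_on with
    | zero => simp
    | add s t hs ht => simp only [map_add, mul_add, TensorProduct.tmul_add, hs, ht]
    | tmul a b => simp

/-- The mirror image of the defining recursion. It is needed because the recursion for `*`
multiplies by a vector on the right. -/
theorem deconcat_mul_ι (y : TensorAlgebra K V) (v : V) :
    deconcat (y * TensorAlgebra.ι K v) =
      (y * TensorAlgebra.ι K v) ⊗ₜ 1 + deconcat y * (1 ⊗ₜ TensorAlgebra.ι K v) := by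
  induction y using tensorAlgebra_induction_left with
  | one =>
    have := deconcat_ι_mul (K := K) v 1
    rw [mul_one, deconcat_one] at this
    rw [one_mul, this, deconcat_one, add_comm]
    simp
  | smul c x hx => simp only [smul_mul_assoc, map_smul, hx, smul_add, TensorProduct.smul_tmul']
  | add x y hx hy => simp only [add_mul, map_add, hx, hy, TensorProduct.add_tmul]; abel
  | ι_mul w y hy =>
    rw [mul_assoc, deconcat_ι_mul, hy, deconcat_ι_mul]
    simp [mul_add, add_mul, mul_assoc]
    abel

theorem deconcat_coassoc (y : TensorAlgebra K V) :
    assoc K _ _ _ (deconcat.rTensor _ (deconcat y)) = deconcat.lTensor _ (deconcat y) := by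
  induction y using tensorAlgebra_induction_left with
  | one => simp [deconcat_one]
  | smul c x hx => simp only [map_smul, hx]
  | add x y hx hy => simp only [map_add, hx, hy]
  | ι_mul v y hy =>
    have h1 : ∀ s : TensorAlgebra K V ⊗[K] TensorAlgebra K V,
        assoc K _ _ _ (deconcat.rTensor _ ((TensorAlgebra.ι K v ⊗ₜ 1) * s)) =
          1 ⊗ₜ ((TensorAlgebra.ι K v ⊗ₜ 1) * s) +
          (TensorAlgebra.ι K v ⊗ₜ 1) * assoc K _ _ _ (deconcat.rTensor _ s) := by
      intro s
      induction s using TensorProduct.induction_on with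
      | zero => simp
      | add s t hs ht => simp only [map_add, mul_add, TensorProduct.tmul_add, hs, ht]; abel
      | tmul p q =>
        simp only [Algebra.TensorProduct.tmul_mul_tmul, one_mul, LinearMap.rTensor_tmul,
          deconcat_ι_mul, TensorProduct.add_tmul, map_add, TensorProduct.assoc_tmul]
        congr 1
        induction deconcat p using TensorProduct.induction_on with
        | zero => simp
        | add s t hs ht => simp only [map_add, mul_add, TensorProduct.add_tmul, hs, ht]
        | tmul a b => simp [Algebra.TensorProduct.one_def]
    have h2 : ∀ s : TensorAlgebra K V ⊗[K] TensorAlgebra K V,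
        deconcat.lTensor _ ((TensorAlgebra.ι K v ⊗ₜ 1) * s) =
          (TensorAlgebra.ι K v ⊗ₜ 1) * deconcat.lTensor _ s := by
      intro s
      induction s using TensorProduct.induction_on with
      | zero => simp
      | add s t hs ht => simp only [map_add, mul_add, hs, ht]
      | tmul p q => simp
    rw [deconcat_ι_mul, map_add, map_add, map_add, h1, h2, hy]
    simp only [LinearMap.rTensor_tmul, deconcat_one, TensorProduct.assoc_tmul,
      LinearMap.lTensor_tmul, deconcat_ι_mul, TensorProduct.tmul_add]
    abel

theorem rid_tensorCounit_deconcat (y : TensorAlgebra K V) :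
    TensorProduct.rid K _ (tensorCounit.lTensor _ (deconcat y)) = y := by
  induction y using tensorAlgebra_induction_left with
  | one => simp [deconcat_one]
  | smul c x hx => simp only [map_smul, hx]
  | add x y hx hy => simp only [map_add, hx, hy]
  | ι_mul v y hy =>
    rw [deconcat_ι_mul, map_add, map_add]
    nth_rewrite 3 [← hy]
    simp only [LinearMap.lTensor_tmul, tensorCounit_ι_mul, TensorProduct.tmul_zero, map_zero,
      zero_add]
    induction deconcat y using TensorProduct.induction_on with
    | zero => simp
    | add s t hs ht => simp only [map_add, mul_add, hs, ht]
    | tmul p q => simp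

theorem lid_tensorCounit_deconcat (y : TensorAlgebra K V) :
    TensorProduct.lid K _ (tensorCounit.rTensor _ (deconcat y)) = y := by
  induction y using tensorAlgebra_induction_left with
  | one => simp [deconcat_one]
  | smul c x hx => simp only [map_smul, hx]
  | add x y hx hy => simp only [map_add, hx, hy]
  | ι_mul v y hy =>
    rw [deconcat_ι_mul, map_add, map_add]
    have : ∀ s, tensorCounit.rTensor (TensorAlgebra K V)
        ((TensorAlgebra.ι K v ⊗ₜ[K] (1 : TensorAlgebra K V)) * s) = 0 := by
      intro s
      induction s using TensorProduct.induction_on with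
      | zero => simp
      | add s t hs ht => simp only [map_add, mul_add, hs, ht, add_zero]
      | tmul p q => simp [tensorCounit_ι_mul]
    simp [this]

variable {H : Type*} [Ring H] [HopfAlgebra K H]
variable (act : H →ₗ[K] Module.End K V) (coact : V →ₗ[K] H ⊗[K] V)

theorem tensorAlgAct_one (h : H) : tensorAlgAct act h 1 = algebraMap K _ (counit h) := by
  simp [tensorAlgAct, tensorFold_one]

theorem tensorAlgAct_consMap (h : H) (t : V ⊗[K] TensorAlgebra K V) :
    tensorAlgAct act h (consMap K V t) = consMap K V (tensorAct act (tensorAlgAct act) h t) := by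
  induction t using TensorProduct.induction_on with
  | zero => simp
  | add s t hs ht => simp only [map_add, hs, ht]
  | tmul v y =>
    rw [consMap_tmul, tensorAct_tmul]
    simp only [tensorAlgAct, LinearMap.flip_apply, tensorFold_ι_mul, LinearMap.flip_flip]
    simp only [LinearMap.mk₂_apply, LinearMap.comp_apply]
    induction comul (R := K) h using TensorProduct.induction_on with
    | zero => simp
    | add s t hs ht => simp only [map_add, hs, ht]
    | tmul a b => simp

theorem tensorAlgCoact_mul (x y : TensorAlgebra K V) :
    tensorAlgCoact coact (x * y) = (LinearMap.mul' K _).lTensor H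
      (coMerge (tensorAlgCoact coact x ⊗ₜ tensorAlgCoact coact y)) := by
  have : ∀ s t : H ⊗[K] TensorAlgebra K V,
      s * t = (LinearMap.mul' K _).lTensor H (coMerge (s ⊗ₜ t)) := by
    intro s t
    induction s using TensorProduct.induction_on with
    | zero => simp
    | add s t hs ht => simp only [map_add, TensorProduct.add_tmul, add_mul, hs, ht]
    | tmul a b =>
      induction t using TensorProduct.induction_on with
      | zero => simp
      | add s t hs ht => simp only [map_add, TensorProduct.tmul_add, mul_add, hs, ht]
      | tmul c d => simp
  rw [← this]
  simp [tensorAlgCoact]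

theorem tensorAlgCoact_ι (v : V) :
    tensorAlgCoact coact (TensorAlgebra.ι K v) = (TensorAlgebra.ι K).lTensor H (coact v) := by
  simp [tensorAlgCoact]

@[simp] theorem tensorAlgCoact_one : tensorAlgCoact coact 1 = 1 ⊗ₜ[K] 1 := by
  simp [tensorAlgCoact, Algebra.TensorProduct.one_def]

/-- This drives the inductions on `T(V)`: facts about `v` and about `y` combine on `V ⊗ T(V)`, and
concatenation transports the result to `T(V)`. -/
theorem isYDHom_consMap :
    IsYDHom (tensorAct act (tensorAlgAct act)) (tensorCoact coact (tensorAlgCoact coact))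
      (tensorAlgAct act) (tensorAlgCoact coact) (consMap K V) := by
  refine .of_tmul (fun h v y => (tensorAlgAct_consMap act h _).symm) fun v y => ?_
  rw [consMap_tmul, tensorAlgCoact_mul, tensorAlgCoact_ι]
  have := coMerge_lTensor (TensorAlgebra.ι K) LinearMap.id (coact v) (tensorAlgCoact coact y)
  rw [LinearMap.lTensor_id, LinearMap.id_apply] at this
  rw [this, ← LinearMap.comp_apply, ← LinearMap.lTensor_comp]
  rfl

variable {act coact}

theorem isYetterDrinfeld_tensorAlgebra (hV : IsYetterDrinfeld act coact) :
    IsYetterDrinfeld (tensorAlgAct act) (tensorAlgCoact coact) where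
  one_act y := by
    induction y using tensorAlgebra_induction_left with
    | one => simp [tensorAlgAct_one]
    | smul c x hx => simp only [map_smul, hx]
    | add x y hx hy => simp only [map_add, hx, hy]
    | ι_mul v y hy =>
      rw [← consMap_tmul, tensorAlgAct_consMap, tensorAct_one_tmul (hV.one_act v) hy]
  mul_act g h y := by
    induction y using tensorAlgebra_induction_left generalizing g h with
    | one => simp [tensorAlgAct_one, Algebra.algebraMap_eq_smul_one, smul_smul, mul_comm]
    | smul c x hx => simp only [map_smul, hx]
    | add x y hx hy => simp only [map_add, hx, hy]
    | ι_mul v y hy =>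
      rw [← consMap_tmul, tensorAlgAct_consMap, tensorAlgAct_consMap, tensorAlgAct_consMap,
        tensorAct_mul_tmul (fun g h => hV.mul_act g h v) hy]
  counit_coact y := by
    induction y using tensorAlgebra_induction_left with
    | one => simp
    | smul c x hx => simp only [map_smul, hx]
    | add x y hx hy => simp only [map_add, hx, hy]
    | ι_mul v y hy =>
      rw [← consMap_tmul, (isYDHom_consMap act coact).map_coact, tensorCoact_tmul]
      have : ∀ t : H ⊗[K] (V ⊗[K] TensorAlgebra K V), TensorProduct.lid K _
          ((counit (R := K) (A := H)).rTensor _ ((consMap K V).lTensor H t)) =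
          consMap K V (TensorProduct.lid K _ ((counit (R := K) (A := H)).rTensor _ t)) := by
        intro t
        induction t using TensorProduct.induction_on with
        | zero => simp
        | add s t hs ht => simp only [map_add, hs, ht]
        | tmul h t => simp
      rw [this, lid_counit_coMerge, hV.counit_coact, hy]
  coassoc y := by
    induction y using tensorAlgebra_induction_left with
    | one => simp [Algebra.TensorProduct.one_def]
    | smul c x hx => simp only [map_smul, hx]
    | add x y hx hy => simp only [map_add, hx, hy]
    | ι_mul v y hy =>
      rw [← consMap_tmul, (isYDHom_consMap act coact).map_coact, tensorCoact_tmul]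
      have h1 : ∀ t : H ⊗[K] (V ⊗[K] TensorAlgebra K V), assoc K H H _
          ((comul (R := K) (A := H)).rTensor _ ((consMap K V).lTensor H t)) =
          ((consMap K V).lTensor H).lTensor H
            (assoc K H H _ ((comul (R := K) (A := H)).rTensor _ t)) := by
        intro t
        induction t using TensorProduct.induction_on with
        | zero => simp
        | add s t hs ht => simp only [map_add, hs, ht]
        | tmul h t =>
          simp only [LinearMap.rTensor_tmul, LinearMap.lTensor_tmul]
          induction comul (R := K) h using TensorProduct.induction_on with
          | zero => simp
          | add s t hs ht => simp only [map_add, TensorProduct.add_tmul, hs, ht]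
          | tmul c d => simp
      have h2 : tensorAlgCoact coact ∘ₗ consMap K V =
          (consMap K V).lTensor H ∘ₗ tensorCoact coact (tensorAlgCoact coact) :=
        LinearMap.ext (isYDHom_consMap act coact).map_coact
      rw [h1, comul_coMerge, hV.coassoc, hy, ← LinearMap.comp_apply (LinearMap.lTensor H _)
        (LinearMap.lTensor H _) (coMerge _), ← LinearMap.lTensor_comp, h2, LinearMap.lTensor_comp,
        LinearMap.comp_apply, tensorCoact_lTensor_coMerge]
  compat h y := by
    -- The inductive step splits `h` by `comul`, so the condition at `y` must be available for all
    -- elements of `H` at once.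
    suffices CompatAt (tensorAlgAct act) (tensorAlgCoact coact) y from LinearMap.congr_fun this h
    clear h
    induction y using tensorAlgebra_induction_left with
    | one =>
      ext h
      simp only [LinearMap.comp_apply, tensorAlgCoact_one]
      -- At the vector `1` each side becomes `h ⊗ 1`, by one of the two counit axioms of `H`.
      have h1 : ∀ u : H ⊗[K] H, actMerge (tensorAlgAct act) ((1 : H) ⊗ₜ[K] 1) u =
          TensorProduct.rid K H ((counit (R := K)).lTensor H u) ⊗ₜ 1 := by
        intro u
        induction u using TensorProduct.induction_on with
        | zero => simp
        | add s t hs ht => simp only [map_add, TensorProduct.add_tmul, hs, ht]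
        | tmul a b => simp [tensorAlgAct_one, Algebra.algebraMap_eq_smul_one,
            TensorProduct.smul_tmul]
      have h2 : ∀ u : H ⊗[K] H, mulFirst ((tensorAlgCoact coact ∘ₗ
          (tensorAlgAct act).flip 1).rTensor H u) =
          TensorProduct.lid K H ((counit (R := K)).rTensor H u) ⊗ₜ 1 := by
        intro u
        induction u using TensorProduct.induction_on with
        | zero => simp
        | add s t hs ht => simp only [map_add, TensorProduct.add_tmul, hs, ht]
        | tmul a b => simp [tensorAlgAct_one, Algebra.algebraMap_eq_smul_one,
            ← TensorProduct.smul_tmul']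
      rw [h1, h2]
      simp
    | smul c x hx =>
      have : IsYDHom (tensorAlgAct act) (tensorAlgCoact coact) (tensorAlgAct act)
          (tensorAlgCoact coact) (c • LinearMap.id) :=
        ⟨fun h v => by simp, fun v => by simp [LinearMap.lTensor_smul]⟩
      exact hx.map this
    | add x y hx hy => exact hx.add hy
    | ι_mul v y hy => exact ((hV.compatAt v).tensor hy).map (isYDHom_consMap act coact)

/-- Colinearity holds because the coaction is an algebra homomorphism. For linearity, `(v x) y` is
rebracketed as `v (x y)`, where the recursive definition of the action and the hypothesis on `x`
apply. -/
theorem isYDHom_tensorAlgebra_mul :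
    IsYDHom (tensorAct (tensorAlgAct act) (tensorAlgAct act))
      (tensorCoact (tensorAlgCoact coact) (tensorAlgCoact coact)) (tensorAlgAct act)
      (tensorAlgCoact coact) (LinearMap.mul' K (TensorAlgebra K V)) := by
  refine .of_tmul (fun h x y => ?_) fun x y => tensorAlgCoact_mul coact x y
  induction x using tensorAlgebra_induction_left generalizing h with
  | one =>
    rw [LinearMap.mul'_apply, one_mul, tensorAct_tmul]
    have h1 : ∀ u : H ⊗[K] H, LinearMap.mul' K _
        (TensorProduct.map ((tensorAlgAct act).flip 1) ((tensorAlgAct act).flip y) u) =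
        tensorAlgAct act (TensorProduct.lid K H ((counit (R := K)).rTensor H u)) y := by
      intro u
      induction u using TensorProduct.induction_on with
      | zero => simp
      | add s t hs ht => simp only [map_add, LinearMap.add_apply, hs, ht]
      | tmul a b => simp [tensorAlgAct_one, Algebra.algebraMap_eq_smul_one]
    rw [h1]
    simp
  | smul c x hx => simp only [map_smul, ← TensorProduct.smul_tmul', hx]
  | add x y hx hy => simp only [map_add, TensorProduct.add_tmul, hx, hy]
  | ι_mul v x hx =>
    have e1 : LinearMap.mul' K (TensorAlgebra K V) ((TensorAlgebra.ι K v * x) ⊗ₜ y) =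
        consMap K V ((LinearMap.mul' K _).lTensor V (v ⊗ₜ (x ⊗ₜ y))) := by
      simp [mul_assoc]
    have e2 : tensorAct act (tensorAlgAct act) h ((LinearMap.mul' K _).lTensor V (v ⊗ₜ (x ⊗ₜ y))) =
        (LinearMap.mul' K _).lTensor V
          (tensorAct act (tensorAct (tensorAlgAct act) (tensorAlgAct act)) h (v ⊗ₜ (x ⊗ₜ y))) := by
      rw [LinearMap.lTensor_tmul, tensorAct_tmul, tensorAct_tmul]
      induction comul (R := K) h using TensorProduct.induction_on with
      | zero => simp
      | add s t hs ht => simp only [map_add, hs, ht]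
      | tmul a b =>
        simp only [TensorProduct.map_tmul, LinearMap.flip_apply, LinearMap.lTensor_tmul, hx]
    have e3 : ∀ t : V ⊗[K] (TensorAlgebra K V ⊗[K] TensorAlgebra K V),
        consMap K V ((LinearMap.mul' K _).lTensor V t) =
          LinearMap.mul' K _ ((consMap K V).rTensor _ ((assoc K _ _ _).symm t)) := by
      intro t
      induction t using TensorProduct.induction_on with
      | zero => simp
      | add s t hs ht => simp only [map_add, hs, ht]
      | tmul v t =>
        induction t using TensorProduct.induction_on with
        | zero => simp
        | add s t hs ht => simp only [map_add, TensorProduct.tmul_add, hs, ht]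
        | tmul x y => simp [mul_assoc]
    have e4 := (isYDHom_assoc (aX := act) (coX := coact) (aY := tensorAlgAct act)
      (coY := tensorAlgCoact coact) (aZ := tensorAlgAct act)
      (coZ := tensorAlgCoact coact)).symm.map_act h (v ⊗ₜ (x ⊗ₜ y))
    have e5 := ((isYDHom_consMap act coact).rTensor (aY := tensorAlgAct act)
      (coY := tensorAlgCoact coact)).map_act h ((v ⊗ₜ x) ⊗ₜ y)
    simp only [LinearEquiv.coe_coe, TensorProduct.assoc_symm_tmul, LinearMap.rTensor_tmul,
      consMap_tmul] at e4 e5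
    rw [e1, tensorAlgAct_consMap, e2, e3, e4, e5]

theorem tensorAlgAct_ι (h : H) (v : V) :
    tensorAlgAct act h (TensorAlgebra.ι K v) = TensorAlgebra.ι K (act h v) := by
  have h1 := tensorAlgAct_consMap act h (v ⊗ₜ[K] 1)
  rw [consMap_tmul, mul_one, tensorAct_tmul] at h1
  have h2 : ∀ u : H ⊗[K] H, consMap K V (TensorProduct.map (act.flip v)
      ((tensorAlgAct act).flip 1) u) = TensorAlgebra.ι K
        (act (TensorProduct.rid K H ((counit (R := K)).lTensor H u)) v) := by
    intro u
    induction u using TensorProduct.induction_on with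
    | zero => simp
    | add s t hs ht => simp only [map_add, LinearMap.add_apply, hs, ht]
    | tmul a b => simp [tensorAlgAct_one, Algebra.algebraMap_eq_smul_one]
  rw [h1, h2]
  simp

theorem isYDHom_ι : IsYDHom act coact (tensorAlgAct act) (tensorAlgCoact coact)
    (TensorAlgebra.ι K) where
  map_act h v := (tensorAlgAct_ι h v).symm
  map_coact v := tensorAlgCoact_ι coact v

/-- The projection of `T(V)` onto its degree `0` part. -/
def degreeZeroProj (K : Type*) [Field K] (V : Type*) [AddCommGroup V] [Module K V] :
    TensorAlgebra K V →ₗ[K] TensorAlgebra K V :=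
  Algebra.linearMap K (TensorAlgebra K V) ∘ₗ tensorCounit

theorem degreeZeroProj_comp_consMap : degreeZeroProj K V ∘ₗ consMap K V = 0 := by
  ext; simp [degreeZeroProj, tensorCounit_ι_mul]

/-- The projection kills the image of `consMap`, which the action and the coaction preserve, and it
fixes `1`, on which they are trivial. -/
theorem isYDHom_degreeZeroProj :
    IsYDHom (tensorAlgAct act) (tensorAlgCoact coact) (tensorAlgAct act) (tensorAlgCoact coact)
      (degreeZeroProj K V) := by
  have h0 : ∀ t, degreeZeroProj K V (consMap K V t) = 0 :=
    LinearMap.congr_fun degreeZeroProj_comp_consMap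
  constructor
  · intro h y
    induction y using tensorAlgebra_induction_left with
    | one => simp [tensorAlgAct_one, degreeZeroProj]
    | smul c x hx => simp only [map_smul, hx]
    | add x y hx hy => simp only [map_add, hx, hy]
    | ι_mul v y hy => rw [← consMap_tmul, tensorAlgAct_consMap, h0, h0, map_zero]
  · intro y
    induction y using tensorAlgebra_induction_left with
    | one => simp [degreeZeroProj]
    | smul c x hx => simp only [map_smul, hx]
    | add x y hx hy => simp only [map_add, hx, hy]
    | ι_mul v y hy =>
      rw [← consMap_tmul, h0, (isYDHom_consMap act coact).map_coact, ← LinearMap.comp_apply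
        (LinearMap.lTensor H _), ← LinearMap.lTensor_comp, degreeZeroProj_comp_consMap]
      simp

theorem tensorAct_one_left (h : H) (y : TensorAlgebra K V) :
    tensorAct (tensorAlgAct act) (tensorAlgAct act) h (1 ⊗ₜ y) = 1 ⊗ₜ tensorAlgAct act h y := by
  rw [tensorAct_tmul]
  have : ∀ u : H ⊗[K] H,
      TensorProduct.map ((tensorAlgAct act).flip 1) ((tensorAlgAct act).flip y) u =
      1 ⊗ₜ tensorAlgAct act (TensorProduct.lid K H ((counit (R := K)).rTensor H u)) y := by
    intro u
    induction u using TensorProduct.induction_on with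
    | zero => simp
    | add s t hs ht => simp only [map_add, LinearMap.add_apply, TensorProduct.tmul_add, hs, ht]
    | tmul a b => simp [tensorAlgAct_one, Algebra.algebraMap_eq_smul_one, TensorProduct.smul_tmul]
  rw [this]
  simp

theorem isYDHom_mk_one :
    IsYDHom (tensorAlgAct act) (tensorAlgCoact coact)
      (tensorAct (tensorAlgAct act) (tensorAlgAct act))
      (tensorCoact (tensorAlgCoact coact) (tensorAlgCoact coact))
      (TensorProduct.mk K (TensorAlgebra K V) (TensorAlgebra K V) 1) where
  map_act h y := (tensorAct_one_left h y).symm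
  map_coact y := by
    rw [TensorProduct.mk_apply, tensorCoact_tmul, tensorAlgCoact_one]
    induction tensorAlgCoact coact y using TensorProduct.induction_on with
    | zero => simp
    | add s t hs ht => simp only [map_add, TensorProduct.tmul_add, hs, ht]
    | tmul a b => simp

/-- By `deconcat_consMap` the value at `v y` is built by morphisms from the value at `y`, so both
properties propagate along the recursion. -/
theorem isYDHom_deconcat :
    IsYDHom (tensorAlgAct act) (tensorAlgCoact coact)
      (tensorAct (tensorAlgAct act) (tensorAlgAct act))
      (tensorCoact (tensorAlgCoact coact) (tensorAlgCoact coact)) deconcat := by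
  have hJ : IsYDHom (tensorAct act (tensorAct (tensorAlgAct act) (tensorAlgAct act)))
      (tensorCoact coact (tensorCoact (tensorAlgCoact coact) (tensorAlgCoact coact)))
      (tensorAct (tensorAlgAct act) (tensorAlgAct act))
      (tensorCoact (tensorAlgCoact coact) (tensorAlgCoact coact))
      ((consMap K V).rTensor _ ∘ₗ (assoc K _ _ _).symm.toLinearMap) :=
    (isYDHom_consMap act coact).rTensor.comp isYDHom_assoc.symm
  have hδ : deconcat ∘ₗ consMap K V =
      TensorProduct.mk K (TensorAlgebra K V) (TensorAlgebra K V) 1 ∘ₗ consMap K V +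
      ((consMap K V).rTensor _ ∘ₗ (assoc K _ _ _).symm.toLinearMap) ∘ₗ deconcat.lTensor V :=
    LinearMap.ext deconcat_consMap
  -- From here on, all that matters about this map is that it is a morphism and occurs in the
  -- recursion.
  generalize (consMap K V).rTensor (TensorAlgebra K V) ∘ₗ
    (assoc K V (TensorAlgebra K V) (TensorAlgebra K V)).symm.toLinearMap = J at hJ hδ
  have hδ' := LinearMap.congr_fun hδ
  simp only [LinearMap.add_apply, LinearMap.comp_apply (f := deconcat)] at hδ'
  constructor
  · intro h y
    induction y using tensorAlgebra_induction_left generalizing h with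
    | one => simp [deconcat_one, tensorAlgAct_one, tensorAct_one_left,
        Algebra.algebraMap_eq_smul_one]
    | smul c x hx => simp only [map_smul, hx]
    | add x y hx hy => simp only [map_add, hx, hy]
    | ι_mul v y hy =>
      have e : deconcat.lTensor V (tensorAct act (tensorAlgAct act) h (v ⊗ₜ y)) =
          tensorAct act (tensorAct (tensorAlgAct act) (tensorAlgAct act)) h
            (deconcat.lTensor V (v ⊗ₜ[K] y)) := by
        rw [LinearMap.lTensor_tmul, tensorAct_tmul, tensorAct_tmul]
        induction comul (R := K) h using TensorProduct.induction_on with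
        | zero => simp
        | add s t hs ht => simp only [map_add, hs, ht]
        | tmul a b => simp [hy]
      rw [← consMap_tmul, tensorAlgAct_consMap, hδ', hδ', map_add, LinearMap.comp_apply,
        LinearMap.comp_apply, LinearMap.comp_apply, LinearMap.comp_apply _ (deconcat.lTensor V), e,
        hJ.map_act, ← tensorAlgAct_consMap, isYDHom_mk_one (coact := coact).map_act]
  · intro y
    induction y using tensorAlgebra_induction_left with
    | one => simp [deconcat_one, tensorCoact_tmul]
    | smul c x hx => simp only [map_smul, hx]
    | add x y hx hy => simp only [map_add, hx, hy]
    | ι_mul v y hy =>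
      have e := coMerge_lTensor LinearMap.id deconcat (coact v) (tensorAlgCoact coact y)
      rw [LinearMap.lTensor_id, LinearMap.id_apply, ← hy, ← tensorCoact_tmul,
        ← tensorCoact_tmul, ← LinearMap.lTensor_tmul] at e
      rw [← consMap_tmul, (isYDHom_consMap act coact).map_coact, hδ', map_add,
        LinearMap.comp_apply, LinearMap.comp_apply _ (deconcat.lTensor V),
        (isYDHom_mk_one (act := act)).map_coact, (isYDHom_consMap act coact).map_coact,
        hJ.map_coact, e, ← LinearMap.comp_apply (deconcat.lTensor H), ← LinearMap.lTensor_comp,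
        hδ, LinearMap.lTensor_add, LinearMap.lTensor_comp, LinearMap.lTensor_comp]
      rfl

/-- The hexagon for the crossing of `v` past `V ⊗ T(V)`, with naturality in `consMap`, shows that
the natural braiding obeys the recursion defining `betaOne`. -/
theorem betaOne_natBraiding (hV : IsYetterDrinfeld act coact) (y : TensorAlgebra K V) (v : V) :
    betaOne (natBraiding coact act) y v = natBraiding coact (tensorAlgAct act) (v ⊗ₜ y) := by
  induction y using tensorAlgebra_induction_left generalizing v with
  | one =>
    rw [betaOne_one, natBraiding_tmul]
    conv_lhs => rw [← hV.counit_coact v]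
    induction coact v using TensorProduct.induction_on with
    | zero => simp
    | add s t hs ht => simp only [map_add, TensorProduct.tmul_add, hs, ht]
    | tmul h v =>
      simp [tensorAlgAct_one, Algebra.algebraMap_eq_smul_one, TensorProduct.smul_tmul']
  | smul c x hx => simp only [map_smul, LinearMap.smul_apply, TensorProduct.tmul_smul, hx]
  | add x y hx hy => simp only [map_add, LinearMap.add_apply, TensorProduct.tmul_add, hx, hy]
  | ι_mul w y hy =>
    have h1 := natBraiding_lTensor (coX := coact) (consMap K V)
      (isYDHom_consMap act coact).map_act (v ⊗ₜ[K] (w ⊗ₜ[K] y))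
    rw [LinearMap.lTensor_tmul, consMap_tmul, natBraiding_tensor_right hV.coassoc] at h1
    rw [betaOne_ι_mul, h1]
    congr 2
    induction natBraiding coact act (v ⊗ₜ w) using TensorProduct.induction_on with
    | zero => simp
    | add s t hs ht => simp only [map_add, TensorProduct.add_tmul, hs, ht]
    | tmul a b => simp [hy]

/-- The other hexagon, peeling vectors off the first argument. Thus `β` acquires naturality and both
hexagons without any combinatorics of reduced words. -/
theorem beta_natBraiding (hV : IsYetterDrinfeld act coact) :
    beta (natBraiding coact act) = natBraiding (tensorAlgCoact coact) (tensorAlgAct act) := by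
  refine TensorProduct.ext' fun x y => ?_
  rw [beta, TensorProduct.lift.tmul]
  induction x using tensorAlgebra_induction_left with
  | one =>
    rw [betaCurried_one, natBraiding_tmul, tensorAlgCoact_one, LinearMap.rTensor_tmul,
      LinearMap.flip_apply, (isYetterDrinfeld_tensorAlgebra hV).one_act]
  | smul c x hx => simp only [map_smul, LinearMap.smul_apply, ← TensorProduct.smul_tmul', hx]
  | add x y hx hy => simp only [map_add, LinearMap.add_apply, TensorProduct.add_tmul, hx, hy]
  | ι_mul v x hx =>
    have h1 := natBraiding_rTensor (aY := tensorAlgAct act) (consMap K V)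
      (isYDHom_consMap act coact).map_coact ((v ⊗ₜ[K] x) ⊗ₜ[K] y)
    rw [LinearMap.rTensor_tmul, consMap_tmul,
      natBraiding_tensor_left (isYetterDrinfeld_tensorAlgebra hV).mul_act] at h1
    rw [betaCurried_ι_mul, h1, hx]
    congr 2
    induction natBraiding (tensorAlgCoact coact) (tensorAlgAct act) (x ⊗ₜ y)
      using TensorProduct.induction_on with
    | zero => simp
    | add s t hs ht => simp only [map_add, TensorProduct.tmul_add, hs, ht]
    | tmul a b => simp [betaOne_natBraiding hV]

end TensorAlgebraYD

/-! ### Coproducts of twisted tensor products of coalgebras. -/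

section TwistedCoproduct

open TensorProduct (assoc)

variable {K : Type*} [Field K]
variable {X : Type*} [AddCommGroup X] [Module K X] {Y : Type*} [AddCommGroup Y] [Module K Y]
variable {ΔX : X →ₗ[K] X ⊗[K] X} {ΔY : Y →ₗ[K] Y ⊗[K] Y} {c : X ⊗[K] Y →ₗ[K] Y ⊗[K] X}

/-- The twisted tensor product of two coassociative coproducts is coassociative if the twist is
compatible with both coproducts. -/
theorem coassoc_twist
    (hX : ∀ x, assoc K X X X (ΔX.rTensor X (ΔX x)) = ΔX.lTensor X (ΔX x))
    (hY : ∀ y, assoc K Y Y Y (ΔY.rTensor Y (ΔY y)) = ΔY.lTensor Y (ΔY y))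
    (h₁ : ∀ x y, ΔY.rTensor X (c (x ⊗ₜ y)) = (assoc K Y Y X).symm (c.lTensor Y (assoc K Y X Y
      (c.rTensor Y ((assoc K X Y Y).symm (x ⊗ₜ ΔY y))))))
    (h₂ : ∀ x y, ΔX.lTensor Y (c (x ⊗ₜ y)) = assoc K Y X X (c.rTensor X ((assoc K X Y X).symm
      (c.lTensor X (assoc K X X Y (ΔX x ⊗ₜ y)))))) (x : X) (y : Y) :
    assoc K _ _ _ ((midMap c ∘ₗ TensorProduct.map ΔX ΔY).rTensor _
        ((midMap c ∘ₗ TensorProduct.map ΔX ΔY) (x ⊗ₜ y))) =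
      (midMap c ∘ₗ TensorProduct.map ΔX ΔY).lTensor _
        ((midMap c ∘ₗ TensorProduct.map ΔX ΔY) (x ⊗ₜ y)) := by
  set D := midMap c ∘ₗ TensorProduct.map ΔX ΔY with hD
  have hDx : D (x ⊗ₜ y) = midMap c (ΔX x ⊗ₜ ΔY y) := rfl
  -- `c₂` moves a pair past one element. Both iterated coproducts are `midMap c₂` followed by
  -- `midMap c`, applied to threefold coproducts of `x` and `y`; coassociativity of the factors then
  -- identifies them.
  set c₂ : (X ⊗[K] X) ⊗[K] Y →ₗ[K] Y ⊗[K] (X ⊗[K] X) := (assoc K Y X X).toLinearMap ∘ₗ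
    c.rTensor X ∘ₗ (assoc K X Y X).symm.toLinearMap ∘ₗ c.lTensor X ∘ₗ
    (assoc K X X Y).toLinearMap with hc₂
  have r : ∀ (s : X ⊗[K] X) (t : Y ⊗[K] Y), D.lTensor _ (midMap c (s ⊗ₜ t)) =
      (midMap c).lTensor _ (midMap c₂ (ΔX.lTensor X s ⊗ₜ ΔY.lTensor Y t)) := by
    intro s t
    induction s using TensorProduct.induction_on with
    | zero => simp
    | add s t hs ht => simp only [map_add, TensorProduct.add_tmul, hs, ht]
    | tmul a b =>
    induction t using TensorProduct.induction_on with
    | zero => simp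
    | add s t hs ht => simp only [map_add, TensorProduct.tmul_add, hs, ht]
    | tmul p q =>
    have e : c₂ (ΔX b ⊗ₜ p) = ΔX.lTensor Y (c (b ⊗ₜ p)) := (h₂ b p).symm
    rw [midMap_tmul, LinearMap.lTensor_tmul, LinearMap.lTensor_tmul, midMap_tmul, e]
    induction c (b ⊗ₜ p) using TensorProduct.induction_on with
    | zero => simp
    | add s t hs ht => simp only [map_add, hs, ht]
    | tmul p b => simp [hD]
  have l : ∀ (s : X ⊗[K] X) (t : Y ⊗[K] Y), assoc K _ _ _ (D.rTensor _ (midMap c (s ⊗ₜ t))) =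
      (midMap c).lTensor _ (midMap c₂ (assoc K _ _ _ (ΔX.rTensor X s) ⊗ₜ
        assoc K _ _ _ (ΔY.rTensor Y t))) := by
    intro s t
    induction s using TensorProduct.induction_on with
    | zero => simp
    | add s t hs ht => simp only [map_add, TensorProduct.add_tmul, hs, ht]
    | tmul a b =>
    induction t using TensorProduct.induction_on with
    | zero => simp
    | add s t hs ht => simp only [map_add, TensorProduct.tmul_add, hs, ht]
    | tmul p q =>
    have e : ∀ w : Y ⊗[K] X, assoc K _ _ _ (D.rTensor _ (insertMid a q w)) =
        assoc K _ _ _ (TensorProduct.map (midMap c) ((TensorProduct.mk K X Y).flip q)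
          ((assoc K (X ⊗[K] X) (Y ⊗[K] Y) X).symm (ΔX a ⊗ₜ ΔY.rTensor X w))) := by
      intro w
      induction w using TensorProduct.induction_on with
      | zero => simp
      | add s t hs ht => simp only [map_add, TensorProduct.tmul_add, hs, ht]
      | tmul p b => simp [hD]
    rw [midMap_tmul, e, h₁, LinearMap.rTensor_tmul, LinearMap.rTensor_tmul]
    induction ΔX a using TensorProduct.induction_on with
    | zero => simp
    | add s t hs ht => simp only [map_add, TensorProduct.add_tmul, hs, ht]
    | tmul a a' =>
    induction ΔY p using TensorProduct.induction_on with
    | zero => simp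
    | add s t hs ht => simp only [map_add, TensorProduct.add_tmul, TensorProduct.tmul_add, hs, ht]
    | tmul p p' =>
    simp only [hc₂, TensorProduct.assoc_tmul, TensorProduct.assoc_symm_tmul,
      LinearMap.rTensor_tmul, midMap_tmul, LinearMap.comp_apply, LinearEquiv.coe_coe,
      LinearMap.lTensor_tmul]
    induction c (b ⊗ₜ p) using TensorProduct.induction_on with
    | zero => simp
    | add s t hs ht => simp only [map_add, TensorProduct.add_tmul, TensorProduct.tmul_add, hs, ht]
    | tmul p b =>
    simp only [TensorProduct.assoc_tmul, TensorProduct.assoc_symm_tmul,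
      LinearMap.rTensor_tmul, LinearMap.lTensor_tmul]
    -- `Ψ ((p ⊗ a') ⊗ (p' ⊗ b)) = (a ⊗ p) ⊗ ((a' ⊗ p') ⊗ (b ⊗ q))`. After the crossing of `b` and
    -- `p`, both sides are `Ψ` of the two crossings that remain.
    let Ψ : (Y ⊗[K] X) ⊗[K] (Y ⊗[K] X) →ₗ[K] (X ⊗[K] Y) ⊗[K] ((X ⊗[K] Y) ⊗[K] (X ⊗[K] Y)) :=
      TensorProduct.map (TensorProduct.mk K X Y a)
        (((TensorProduct.mk K X Y).flip q).lTensor (X ⊗[K] Y) ∘ₗ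
          (assoc K X Y X).symm.toLinearMap) ∘ₗ (assoc K Y X (Y ⊗[K] X)).toLinearMap
    have e₁ : ∀ v : Y ⊗[K] X, assoc K _ _ _ (TensorProduct.map (midMap c)
        ((TensorProduct.mk K X Y).flip q) ((assoc K (X ⊗[K] X) (Y ⊗[K] Y) X).symm
          ((a ⊗ₜ a') ⊗ₜ (assoc K Y Y X).symm (p ⊗ₜ v)))) = Ψ (c (a' ⊗ₜ p) ⊗ₜ v) := by
      intro v
      induction v using TensorProduct.induction_on with
      | zero => simp
      | add s t hs ht => simp only [map_add, TensorProduct.tmul_add, hs, ht]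
      | tmul p' b =>
        simp only [TensorProduct.assoc_symm_tmul, TensorProduct.map_tmul, midMap_tmul]
        induction c (a' ⊗ₜ p) using TensorProduct.induction_on with
        | zero => simp
        | add s t hs ht => simp only [map_add, TensorProduct.add_tmul, hs, ht]
        | tmul p a' => simp [Ψ]
    have e₂ : ∀ u : Y ⊗[K] X, (midMap c).lTensor (X ⊗[K] Y)
        (insertMid a (p' ⊗ₜ q) (assoc K Y X X (u ⊗ₜ b))) = Ψ (u ⊗ₜ c (b ⊗ₜ p')) := by
      intro u
      induction u using TensorProduct.induction_on with
      | zero => simp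
      | add s t hs ht => simp only [map_add, TensorProduct.add_tmul, hs, ht]
      | tmul p a' =>
        simp only [TensorProduct.assoc_tmul, insertMid_tmul, LinearMap.lTensor_tmul, midMap_tmul]
        induction c (b ⊗ₜ p') using TensorProduct.induction_on with
        | zero => simp
        | add s t hs ht => simp only [map_add, TensorProduct.tmul_add, hs, ht]
        | tmul p' b => simp [Ψ]
    rw [e₁, e₂]
  rw [hDx, l, r, hX, hY]

variable {εX : X →ₗ[K] K} {εY : Y →ₗ[K] K}

/-- By `hc` the counit of `Y` passes through the twist, after which the counit axioms of the two
factors apply separately. -/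
theorem lid_counit_twist (hX : ∀ x, TensorProduct.lid K X (εX.rTensor X (ΔX x)) = x)
    (hY : ∀ y, TensorProduct.lid K Y (εY.rTensor Y (ΔY y)) = y)
    (hc : ∀ x y, TensorProduct.lid K X (εY.rTensor X (c (x ⊗ₜ y))) = εY y • x)
    (t : X ⊗[K] Y) :
    TensorProduct.lid K _ ((LinearMap.mul' K K ∘ₗ TensorProduct.map εX εY).rTensor _
      ((midMap c ∘ₗ TensorProduct.map ΔX ΔY) t)) = t := by
  induction t using TensorProduct.induction_on with
  | zero => simp
  | add s t hs ht => simp only [map_add, hs, ht]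
  | tmul x y =>
  conv_rhs => rw [← hX x, ← hY y]
  rw [LinearMap.comp_apply, TensorProduct.map_tmul]
  induction ΔX x using TensorProduct.induction_on with
  | zero => simp
  | add s t hs ht => simp only [map_add, TensorProduct.add_tmul, hs, ht]
  | tmul a b =>
  induction ΔY y using TensorProduct.induction_on with
  | zero => simp
  | add s t hs ht => simp only [map_add, TensorProduct.tmul_add, hs, ht]
  | tmul p q =>
  have e : ∀ w : Y ⊗[K] X, TensorProduct.lid K _ ((LinearMap.mul' K K ∘ₗ
      TensorProduct.map εX εY).rTensor _ (insertMid a q w)) =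
      εX a • (TensorProduct.lid K X (εY.rTensor X w) ⊗ₜ q) := by
    intro w
    induction w using TensorProduct.induction_on with
    | zero => simp
    | add s t hs ht => simp only [map_add, TensorProduct.add_tmul, smul_add, hs, ht]
    | tmul p b => simp [TensorProduct.smul_tmul', smul_smul]
  rw [midMap_tmul, e, hc]
  simp [TensorProduct.smul_tmul', TensorProduct.tmul_smul, smul_smul, mul_comm]

theorem rid_counit_twist (hX : ∀ x, TensorProduct.rid K X (εX.lTensor X (ΔX x)) = x)
    (hY : ∀ y, TensorProduct.rid K Y (εY.lTensor Y (ΔY y)) = y)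
    (hc : ∀ x y, TensorProduct.rid K Y (εX.lTensor Y (c (x ⊗ₜ y))) = εX x • y)
    (t : X ⊗[K] Y) :
    TensorProduct.rid K _ ((LinearMap.mul' K K ∘ₗ TensorProduct.map εX εY).lTensor _
      ((midMap c ∘ₗ TensorProduct.map ΔX ΔY) t)) = t := by
  induction t using TensorProduct.induction_on with
  | zero => simp
  | add s t hs ht => simp only [map_add, hs, ht]
  | tmul x y =>
  conv_rhs => rw [← hX x, ← hY y]
  rw [LinearMap.comp_apply, TensorProduct.map_tmul]
  induction ΔX x using TensorProduct.induction_on with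
  | zero => simp
  | add s t hs ht => simp only [map_add, TensorProduct.add_tmul, hs, ht]
  | tmul a b =>
  induction ΔY y using TensorProduct.induction_on with
  | zero => simp
  | add s t hs ht => simp only [map_add, TensorProduct.tmul_add, hs, ht]
  | tmul p q =>
  have e : ∀ w : Y ⊗[K] X, TensorProduct.rid K _ ((LinearMap.mul' K K ∘ₗ
      TensorProduct.map εX εY).lTensor _ (insertMid a q w)) =
      εY q • (a ⊗ₜ TensorProduct.rid K Y (εX.lTensor Y w)) := by
    intro w
    induction w using TensorProduct.induction_on with
    | zero => simp
    | add s t hs ht => simp only [map_add, TensorProduct.tmul_add, smul_add, hs, ht]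
    | tmul p b => simp [TensorProduct.tmul_smul, smul_smul, mul_comm]
  rw [midMap_tmul, e, hc]
  simp [TensorProduct.smul_tmul', TensorProduct.tmul_smul, smul_smul, mul_comm]

/-- The two twisted coproducts of a threefold tensor product agree. -/
theorem twist_assoc {c : X ⊗[K] X →ₗ[K] X ⊗[K] X}
    {cL : (X ⊗[K] X) ⊗[K] X →ₗ[K] X ⊗[K] (X ⊗[K] X)}
    {cR : X ⊗[K] (X ⊗[K] X) →ₗ[K] (X ⊗[K] X) ⊗[K] X}
    (hL : ∀ x y z, cL ((x ⊗ₜ y) ⊗ₜ z) = assoc K _ _ _ (c.rTensor _ ((assoc K _ _ _).symm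
      (x ⊗ₜ c (y ⊗ₜ z)))))
    (hR : ∀ x y z, cR (x ⊗ₜ (y ⊗ₜ z)) = (assoc K _ _ _).symm (c.lTensor _ (assoc K _ _ _
      (c (x ⊗ₜ y) ⊗ₜ z)))) (s t r : X ⊗[K] X) :
    TensorProduct.map (assoc K X X X).toLinearMap (assoc K X X X).toLinearMap
        (midMap cL (midMap c (s ⊗ₜ t) ⊗ₜ r)) = midMap cR (s ⊗ₜ midMap c (t ⊗ₜ r)) := by
  induction s using TensorProduct.induction_on with
  | zero => simp
  | add s t hs ht => simp only [map_add, TensorProduct.add_tmul, hs, ht]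
  | tmul a b =>
  induction t using TensorProduct.induction_on with
  | zero => simp
  | add s t hs ht => simp only [map_add, TensorProduct.tmul_add, TensorProduct.add_tmul, hs, ht]
  | tmul p q =>
  induction r using TensorProduct.induction_on with
  | zero => simp
  | add s t hs ht => simp only [map_add, TensorProduct.tmul_add, hs, ht]
  | tmul e f =>
  -- On either side `b` crosses `p`, `q` crosses `e`, and then `b` crosses `e`; `Ψ` puts back the
  -- outer factors `a` and `f`.
  set Ψ : (X ⊗[K] X) ⊗[K] (X ⊗[K] X) →ₗ[K] _ := TensorProduct.map
    (TensorProduct.mk K X (X ⊗[K] X) a) ((assoc K X X X).toLinearMap ∘ₗ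
      (TensorProduct.mk K (X ⊗[K] X) X).flip f) with hΨ
  have e₁ : ∀ w, TensorProduct.map (assoc K X X X).toLinearMap (assoc K X X X).toLinearMap
      (midMap cL (insertMid a q w ⊗ₜ (e ⊗ₜ f))) = Ψ (midMap c (w ⊗ₜ c (q ⊗ₜ e))) := by
    intro w
    induction w using TensorProduct.induction_on with
    | zero => simp
    | add s t hs ht => simp only [map_add, TensorProduct.add_tmul, hs, ht]
    | tmul p b =>
      simp only [insertMid_tmul, midMap_tmul, hL]
      induction c (q ⊗ₜ e) using TensorProduct.induction_on with
      | zero => simp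
      | add s t hs ht => simp only [map_add, TensorProduct.tmul_add, hs, ht]
      | tmul e q =>
        simp only [TensorProduct.assoc_symm_tmul, LinearMap.rTensor_tmul, midMap_tmul]
        induction c (b ⊗ₜ e) using TensorProduct.induction_on with
        | zero => simp
        | add s t hs ht => simp only [map_add, TensorProduct.add_tmul, hs, ht]
        | tmul e b => simp [hΨ]
  have e₂ : ∀ v, midMap cR ((a ⊗ₜ b) ⊗ₜ insertMid p f v) = Ψ (midMap c (c (b ⊗ₜ p) ⊗ₜ v)) := by
    intro v
    induction v using TensorProduct.induction_on with
    | zero => simp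
    | add s t hs ht => simp only [map_add, TensorProduct.tmul_add, hs, ht]
    | tmul e q =>
      simp only [insertMid_tmul, midMap_tmul, hR]
      induction c (b ⊗ₜ p) using TensorProduct.induction_on with
      | zero => simp
      | add s t hs ht => simp only [map_add, TensorProduct.add_tmul, hs, ht]
      | tmul p b =>
        simp only [TensorProduct.assoc_tmul, LinearMap.lTensor_tmul, midMap_tmul]
        induction c (b ⊗ₜ e) using TensorProduct.induction_on with
        | zero => simp
        | add s t hs ht => simp only [map_add, TensorProduct.tmul_add, hs, ht]
        | tmul e b => simp [hΨ]
  rw [midMap_tmul c, midMap_tmul c, e₁, e₂]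

end TwistedCoproduct

/-! ### Gradings, and uniqueness for recursions along graded coproducts. -/

section Homogeneous

open TensorProduct (assoc)

variable {K : Type*} [Field K] {H : Type*} [Ring H] [HopfAlgebra K H]
variable {X : Type*} [AddCommGroup X] [Module K X] {Y : Type*} [AddCommGroup Y] [Module K Y]
variable {Z : Type*} [AddCommGroup Z] [Module K Z]
variable {X' : Type*} [AddCommGroup X'] [Module K X'] {Y' : Type*} [AddCommGroup Y'] [Module K Y']

/-- The total grading on a tensor product. -/
def gradedTensor (A : ℕ → Submodule K X) (B : ℕ → Submodule K Y) (n : ℕ) :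
    Submodule K (X ⊗[K] Y) :=
  Submodule.span K {t | ∃ i j, i + j = n ∧ ∃ a ∈ A i, ∃ b ∈ B j, a ⊗ₜ b = t}

/-- The grading on `H ⊗ X`, with `H` in degree `0`. -/
def scalarGrading (H : Type*) [Ring H] [HopfAlgebra K H] (A : ℕ → Submodule K X) (n : ℕ) :
    Submodule K (H ⊗[K] X) :=
  Submodule.span K {t | ∃ h : H, ∃ a ∈ A n, h ⊗ₜ a = t}

/-- `f` is homogeneous of degree `0`. -/
def Homogeneous (A : ℕ → Submodule K X) (B : ℕ → Submodule K Y) (f : X →ₗ[K] Y) : Prop :=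
  ∀ n, ∀ x ∈ A n, f x ∈ B n

variable {A : ℕ → Submodule K X} {B : ℕ → Submodule K Y} {C : ℕ → Submodule K Z}
variable {A' : ℕ → Submodule K X'} {B' : ℕ → Submodule K Y'}

theorem tmul_mem_gradedTensor {i j n : ℕ} (h : i + j = n) {a : X} {b : Y} (ha : a ∈ A i)
    (hb : b ∈ B j) : a ⊗ₜ b ∈ gradedTensor A B n :=
  Submodule.subset_span ⟨i, j, h, a, ha, b, hb, rfl⟩

theorem tmul_mem_scalarGrading {n : ℕ} (h : H) {a : X} (ha : a ∈ A n) :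
    h ⊗ₜ a ∈ scalarGrading H A n :=
  Submodule.subset_span ⟨h, a, ha, rfl⟩

theorem homogeneous_gradedTensor {f : X ⊗[K] Y →ₗ[K] Z}
    (h : ∀ i j, ∀ a ∈ A i, ∀ b ∈ B j, f (a ⊗ₜ b) ∈ C (i + j)) :
    Homogeneous (gradedTensor A B) C f := by
  intro n
  change gradedTensor A B n ≤ (C n).comap f
  refine Submodule.span_le.2 ?_
  rintro _ ⟨i, j, rfl, a, ha, b, hb, rfl⟩
  exact h i j a ha b hb

theorem homogeneous_scalarGrading {f : H ⊗[K] X →ₗ[K] Y}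
    (h : ∀ k n, ∀ a ∈ A n, f (k ⊗ₜ a) ∈ B n) : Homogeneous (scalarGrading H A) B f := by
  intro n
  change scalarGrading H A n ≤ (B n).comap f
  refine Submodule.span_le.2 ?_
  rintro _ ⟨k, a, ha, rfl⟩
  exact h k n a ha

theorem Homogeneous.comp {g : Y →ₗ[K] Z} {f : X →ₗ[K] Y} (hg : Homogeneous B C g)
    (hf : Homogeneous A B f) : Homogeneous A C (g ∘ₗ f) :=
  fun n x hx => hg n _ (hf n x hx)

theorem Homogeneous.id : Homogeneous A A LinearMap.id := fun _ _ hx => hx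

theorem Homogeneous.map {f : X →ₗ[K] X'} {g : Y →ₗ[K] Y'} (hf : Homogeneous A A' f)
    (hg : Homogeneous B B' g) :
    Homogeneous (gradedTensor A B) (gradedTensor A' B') (TensorProduct.map f g) :=
  homogeneous_gradedTensor fun i j a ha b hb =>
    tmul_mem_gradedTensor rfl (hf i a ha) (hg j b hb)

theorem homogeneous_assoc : Homogeneous (gradedTensor (gradedTensor A B) C)
    (gradedTensor A (gradedTensor B C)) (assoc K X Y Z).toLinearMap := by
  refine homogeneous_gradedTensor fun n k t ht c hc => ?_
  suffices Homogeneous (gradedTensor A B) (fun n => gradedTensor A (gradedTensor B C) (n + k))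
    ((assoc K X Y Z).toLinearMap ∘ₗ (TensorProduct.mk K _ _).flip c) from this n t ht
  refine homogeneous_gradedTensor fun i j a ha b hb => ?_
  exact tmul_mem_gradedTensor (add_assoc i j k).symm ha (tmul_mem_gradedTensor rfl hb hc)

theorem homogeneous_assoc_symm : Homogeneous (gradedTensor A (gradedTensor B C))
    (gradedTensor (gradedTensor A B) C) (assoc K X Y Z).symm.toLinearMap := by
  refine homogeneous_gradedTensor fun i n a ha t ht => ?_
  suffices Homogeneous (gradedTensor B C) (fun n => gradedTensor (gradedTensor A B) C (i + n))
    ((assoc K X Y Z).symm.toLinearMap ∘ₗ TensorProduct.mk K _ _ a) from this n t ht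
  refine homogeneous_gradedTensor fun j k b hb c hc => ?_
  exact tmul_mem_gradedTensor (add_assoc i j k) (tmul_mem_gradedTensor rfl ha hb) hc

theorem Homogeneous.midMap {W : Type*} [AddCommGroup W] [Module K W] {D : ℕ → Submodule K W}
    {c : Y ⊗[K] Z →ₗ[K] X' ⊗[K] Y'} (hc : Homogeneous (gradedTensor B C) (gradedTensor A' B') c) :
    Homogeneous (gradedTensor (gradedTensor A B) (gradedTensor C D))
      (gradedTensor (gradedTensor A A') (gradedTensor B' D)) (midMap c) :=
  homogeneous_assoc_symm.comp ((Homogeneous.id.map (homogeneous_assoc.comp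
    ((hc.map .id).comp homogeneous_assoc_symm))).comp homogeneous_assoc)

variable {aX : H →ₗ[K] Module.End K X} {coX : X →ₗ[K] H ⊗[K] X}
variable {aY : H →ₗ[K] Module.End K Y} {coY : Y →ₗ[K] H ⊗[K] Y}

theorem homogeneous_natBraiding (hco : Homogeneous A (scalarGrading H A) coX)
    (ha : ∀ h, Homogeneous B B (aY h)) :
    Homogeneous (gradedTensor A B) (gradedTensor B A) (natBraiding coX aY) := by
  refine homogeneous_gradedTensor fun i j x hx y hy => ?_
  rw [natBraiding_tmul]
  suffices Homogeneous (scalarGrading H A) (fun n => gradedTensor B A (n + j))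
    ((aY.flip y).rTensor X) from this i _ (hco i x hx)
  refine homogeneous_scalarGrading fun k n a ha' => ?_
  exact tmul_mem_gradedTensor (add_comm j n) (ha k j y hy) ha'

theorem homogeneous_tensorAct (hX : ∀ h, Homogeneous A A (aX h))
    (hY : ∀ h, Homogeneous B B (aY h)) (h : H) :
    Homogeneous (gradedTensor A B) (gradedTensor A B) (tensorAct aX aY h) := by
  refine homogeneous_gradedTensor fun i j x hx y hy => ?_
  rw [tensorAct_tmul]
  induction Coalgebra.comul (R := K) h using TensorProduct.induction_on with
  | zero => simp
  | add s t hs ht => rw [map_add]; exact add_mem hs ht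
  | tmul a b => exact tmul_mem_gradedTensor rfl (hX a i x hx) (hY b j y hy)

theorem homogeneous_tensorCoact (hX : Homogeneous A (scalarGrading H A) coX)
    (hY : Homogeneous B (scalarGrading H B) coY) :
    Homogeneous (gradedTensor A B) (scalarGrading H (gradedTensor A B)) (tensorCoact coX coY) := by
  refine homogeneous_gradedTensor fun i j x hx y hy => ?_
  rw [tensorCoact_tmul]
  suffices Homogeneous (scalarGrading H A) (fun n => scalarGrading H (gradedTensor A B) (n + j))
    (coMerge ∘ₗ (TensorProduct.mk K _ _).flip (coY y)) from this i _ (hX i x hx)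
  refine homogeneous_scalarGrading fun k n a ha => ?_
  suffices Homogeneous (scalarGrading H B) (fun j => scalarGrading H (gradedTensor A B) (n + j))
    (coMerge ∘ₗ TensorProduct.mk K _ _ (k ⊗ₜ a)) from this j _ (hY j y hy)
  refine homogeneous_scalarGrading fun l m b hb => ?_
  exact tmul_mem_scalarGrading _ (tmul_mem_gradedTensor rfl ha hb)

theorem iSup_gradedTensor (hA : ⨆ n, A n = ⊤) (hB : ⨆ n, B n = ⊤) :
    ⨆ n, gradedTensor A B n = ⊤ := by
  rw [eq_top_iff, ← TensorProduct.span_tmul_eq_top, Submodule.span_le]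
  rintro _ ⟨x, y, rfl⟩
  have hx : x ∈ ⨆ n, A n := hA ▸ Submodule.mem_top
  have hy : y ∈ ⨆ n, B n := hB ▸ Submodule.mem_top
  induction hx using Submodule.iSup_induction' with
  | zero => simp
  | add s t _ _ hs ht => rw [TensorProduct.add_tmul]; exact add_mem hs ht
  | mem i a ha =>
    induction hy using Submodule.iSup_induction' with
    | zero => simp
    | add s t _ _ hs ht => rw [TensorProduct.tmul_add]; exact add_mem hs ht
    | mem j b hb => exact Submodule.mem_iSup_of_mem (i + j) (tmul_mem_gradedTensor rfl ha hb)

/-- A linear map that solves a homogeneous recursion along a graded coproduct vanishes. -/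
theorem eq_zero_of_recursion (hA : ⨆ n, A n = ⊤) {Δ : X →ₗ[K] X ⊗[K] X}
    (hΔ : Homogeneous A (gradedTensor A A) Δ) (Φ : Z ⊗[K] X →ₗ[K] Z)
    (hΦ : ∀ z, ∀ x ∈ A 0, Φ (z ⊗ₜ x) = 0) {D : X →ₗ[K] Z}
    (hD : ∀ x, D x = Φ (D.rTensor X (Δ x))) : D = 0 := by
  have key : ∀ n, A n ≤ LinearMap.ker D := by
    intro n
    induction n using Nat.strong_induction_on with
    | _ n ih =>
      intro x hx
      rw [LinearMap.mem_ker, hD]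
      have : gradedTensor A A n ≤ LinearMap.ker (Φ ∘ₗ D.rTensor X) := by
        refine Submodule.span_le.2 ?_
        rintro _ ⟨i, j, rfl, a, ha, b, hb, rfl⟩
        simp only [SetLike.mem_coe, LinearMap.mem_ker, LinearMap.comp_apply, LinearMap.rTensor_tmul]
        -- A right leg of degree `0` is killed by `Φ`. Otherwise the left leg has degree smaller
        -- than `i + j`, and `D` kills it by induction.
        rcases Nat.eq_zero_or_pos j with rfl | hj
        · exact hΦ _ _ hb
        · rw [LinearMap.mem_ker.1 (ih i (by omega) ha)]
          simp
      exact this (hΔ n x hx)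
  rw [← LinearMap.ker_eq_top, eq_top_iff, ← hA]
  exact iSup_le key

/-- A homogeneous recursion along a graded coproduct has at most one linear solution. -/
theorem eq_of_recursion (hA : ⨆ n, A n = ⊤) {Δ : X →ₗ[K] X ⊗[K] X}
    (hΔ : Homogeneous A (gradedTensor A A) Δ) (Φ : Z ⊗[K] X →ₗ[K] Z)
    (hΦ : ∀ z, ∀ x ∈ A 0, Φ (z ⊗ₜ x) = 0) {f g : X →ₗ[K] Z} (r : X → Z)
    (hf : ∀ x, f x = r x + Φ (f.rTensor X (Δ x))) (hg : ∀ x, g x = r x + Φ (g.rTensor X (Δ x))) :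
    f = g := by
  refine sub_eq_zero.1 (eq_zero_of_recursion hA hΔ Φ hΦ fun x => ?_)
  rw [LinearMap.rTensor_sub, LinearMap.sub_apply, LinearMap.sub_apply, map_sub]
  nth_rewrite 1 [hf x, hg x]
  abel

end Homogeneous

/-! ### The degree filtration data of `T(V)` and the braided coproduct of `T(V) ⊗ T(V)`. -/

section TensorDegree

open Coalgebra (comul counit)
open TensorProduct (assoc)

variable (K : Type*) [Field K] (V : Type*) [AddCommGroup V] [Module K V]

/-- The degree `n` part of `T(V)`. -/
def tensorDegree (n : ℕ) : Submodule K (TensorAlgebra K V) :=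
  LinearMap.range (TensorAlgebra.ι K (M := V)) ^ n

theorem iSup_tensorDegree : ⨆ n, tensorDegree K V n = ⊤ :=
  (DirectSum.Decomposition.isInternal
    (LinearMap.range (TensorAlgebra.ι K (M := V)) ^ ·)).submodule_iSup_eq_top

variable {K V}

theorem one_mem_tensorDegree : (1 : TensorAlgebra K V) ∈ tensorDegree K V 0 := by
  simp [tensorDegree, Submodule.one_le.1 le_rfl]

theorem ι_mul_mem_tensorDegree {n : ℕ} (v : V) {y : TensorAlgebra K V}
    (hy : y ∈ tensorDegree K V n) : TensorAlgebra.ι K v * y ∈ tensorDegree K V (n + 1) := by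
  rw [tensorDegree, pow_succ']
  exact Submodule.mul_mem_mul ⟨v, rfl⟩ hy

theorem mem_tensorDegree_zero {x : TensorAlgebra K V} (hx : x ∈ tensorDegree K V 0) :
    ∃ r : K, x = algebraMap K _ r := by
  rw [tensorDegree, pow_zero, Submodule.mem_one] at hx
  exact ⟨_, hx.choose_spec.symm⟩

theorem tensorDegree_induction {P : ℕ → TensorAlgebra K V → Prop} (one : P 0 1)
    (smul : ∀ (c : K) n x, P n x → P n (c • x)) (add : ∀ n x y, P n x → P n y → P n (x + y))
    (ι_mul : ∀ v n y, y ∈ tensorDegree K V n → P n y → P (n + 1) (TensorAlgebra.ι K v * y))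
    {n : ℕ} {x : TensorAlgebra K V} (hx : x ∈ tensorDegree K V n) : P n x := by
  induction hx using Submodule.pow_induction_on_left' with
  | algebraMap r => rw [Algebra.algebraMap_eq_smul_one]; exact smul _ _ _ one
  | add x y i _ _ hx hy => exact add _ _ _ hx hy
  | mem_mul m hm i x hx h => obtain ⟨v, rfl⟩ := hm; exact ι_mul v i x hx h

theorem incl_mem_tensorDegree {n : ℕ} (x : ⨂[K]^n V) : incl x ∈ tensorDegree K V n := by
  induction x using PiTensorProduct.induction_on with
  | smul_tprod r f =>
    rw [show incl (r • PiTensorProduct.tprod K f) = r • incl (PiTensorProduct.tprod K f) from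
      map_smul _ _ _]
    refine Submodule.smul_mem _ _ ?_
    have e : incl (PiTensorProduct.tprod K f) = (List.ofFn fun i => TensorAlgebra.ι K (f i)).prod :=
      (TensorPower.toTensorAlgebra_tprod f).trans (TensorAlgebra.tprod_apply K V f)
    rw [e]
    clear e
    induction n with
    | zero => simpa using one_mem_tensorDegree
    | succ n ih =>
      rw [List.ofFn_succ, List.prod_cons]
      exact ι_mul_mem_tensorDegree _ (ih fun i => f i.succ)
  | add x y hx hy =>
    rw [show incl (x + y) = incl x + incl y from map_add _ _ _]
    exact add_mem hx hy

/-- Translates concatenation of tensor powers, in which `iterCoprod` is written, into multiplication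
in `T(V)`. -/
theorem incl_mulEquiv {p q : ℕ} (t : (⨂[K]^p V) ⊗[K] (⨂[K]^q V)) :
    incl (TensorPower.mulEquiv t) = LinearMap.mul' K _
      (TensorProduct.map TensorPower.toTensorAlgebra TensorPower.toTensorAlgebra t) := by
  induction t using TensorProduct.induction_on with
  | zero => simp
  | add s t hs ht => simp only [map_add, hs, ht]
  | tmul x y =>
    exact (congrArg _ (TensorPower.gMul_def x y)).symm.trans (TensorPower.toTensorAlgebra_gMul x y)

theorem incl_elim0 : incl (PiTensorProduct.tprod K (fun i : Fin 0 => (i.elim0 : V))) =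
    (1 : TensorAlgebra K V) := by
  simp [TensorPower.toTensorAlgebra_tprod, TensorAlgebra.tprod_apply]

theorem incl_single (v : V) : incl (PiTensorProduct.tprod K (fun _ : Fin 1 => v)) =
    TensorAlgebra.ι K v := by
  simp [TensorPower.toTensorAlgebra_tprod, TensorAlgebra.tprod_apply]

theorem exists_incl_eq {n : ℕ} {x : TensorAlgebra K V} (hx : x ∈ tensorDegree K V n) :
    ∃ t : ⨂[K]^n V, incl t = x := by
  refine tensorDegree_induction (P := fun n x => ∃ t : ⨂[K]^n V, incl t = x) ⟨_, incl_elim0⟩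
    ?_ ?_ ?_ hx
  · rintro c n _ ⟨t, rfl⟩; exact ⟨c • t, map_smul _ _ _⟩
  · rintro n _ _ ⟨s, rfl⟩ ⟨t, rfl⟩; exact ⟨s + t, map_add _ _ _⟩
  · rintro v n _ - ⟨t, rfl⟩
    -- Prepending a vector yields a tensor power of exponent `1 + n` instead of `n + 1`; the cast
    -- does not change the image in `T(V)`.
    refine ⟨TensorPower.cast K V (add_comm 1 n) (TensorPower.mulEquiv
      (PiTensorProduct.tprod K (fun _ : Fin 1 => v) ⊗ₜ t)), ?_⟩
    have : ∀ (m m' : ℕ) (h : m = m') (s : ⨂[K]^m V),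
        incl (TensorPower.cast K V h s) = incl s := by
      rintro m _ rfl s
      rw [TensorPower.cast_refl]
      rfl
    rw [this, incl_mulEquiv, TensorProduct.map_tmul]
    exact congrArg₂ (· * ·) (incl_single (K := K) v) rfl

theorem degreePart_incl {n : ℕ} (t : ⨂[K]^n V) : degreePart n (incl t) = t := by
  simp only [degreePart, LinearMap.comp_apply, AlgHom.toLinearMap_apply, toDirectSum_incl]
  exact DirectSum.component.lof_self (R := K) (M := fun n => ⨂[K]^n V) n t

theorem incl_degreePart {n : ℕ} {x : TensorAlgebra K V} (hx : x ∈ tensorDegree K V n) :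
    incl (degreePart n x) = x := by
  obtain ⟨t, rfl⟩ := exists_incl_eq hx
  rw [degreePart_incl]

theorem tensorCounit_of_mem {n : ℕ} (hn : n ≠ 0) {x : TensorAlgebra K V}
    (hx : x ∈ tensorDegree K V n) : tensorCounit x = 0 := by
  refine tensorDegree_induction (P := fun n x => n ≠ 0 → tensorCounit x = 0) (fun h => absurd rfl h)
    ?_ ?_ ?_ hx hn
  · intro c n x h hn; rw [map_smul, h hn, smul_zero]
  · intro n x y hx hy hn; rw [map_add, hx hn, hy hn, add_zero]
  · intro v n y _ _ _; exact tensorCounit_ι_mul v y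

theorem tensorCounit_mul_ι (y : TensorAlgebra K V) (v : V) :
    tensorCounit (y * TensorAlgebra.ι K v) = 0 := by
  simp [tensorCounit_mul]

variable (K V) in
/-- The recursion step for `degreeOneProj`. -/
def degreeOneStep : V →ₗ[K] (TensorAlgebra K V × V) →ₗ[K] (TensorAlgebra K V × V) :=
  LinearMap.mk₂ K (fun v p => (TensorAlgebra.ι K v * p.1, tensorCounit p.1 • v))
    (by intro v w p; simp [add_mul])
    (by intro c v p; simp [smul_smul, mul_comm])
    (by intro v p q; simp [mul_add, add_smul])
    (by intro c v p; simp [smul_smul])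

variable (K V) in
/-- The projection `T(V) → V` onto the degree `1` part. -/
def degreeOneProj : TensorAlgebra K V →ₗ[K] V :=
  LinearMap.snd K (TensorAlgebra K V) V ∘ₗ tensorFold (1, 0) (degreeOneStep K V)

@[simp] theorem degreeOneProj_one : degreeOneProj K V 1 = 0 := by
  simp [degreeOneProj, tensorFold_one]

@[simp] theorem degreeOneProj_algebraMap (r : K) : degreeOneProj K V (algebraMap K _ r) = 0 := by
  rw [Algebra.algebraMap_eq_smul_one, map_smul, degreeOneProj_one, smul_zero]

theorem degreeOneProj_ι_mul (v : V) (y : TensorAlgebra K V) :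
    degreeOneProj K V (TensorAlgebra.ι K v * y) = tensorCounit y • v := by
  -- The first coordinate only remembers the argument, so that the recursion can read the counit of
  -- the tail.
  have : ∀ y, (tensorFold (1, 0) (degreeOneStep K V) y).1 = y := by
    intro y
    induction y using tensorAlgebra_induction_left with
    | one => simp [tensorFold_one]
    | smul c x hx => rw [map_smul, Prod.smul_fst, hx]
    | add x y hx hy => rw [map_add, Prod.fst_add, hx, hy]
    | ι_mul v y hy => rw [tensorFold_ι_mul, degreeOneStep, LinearMap.mk₂_apply, ← degreeOneStep, hy]
  simp only [degreeOneProj, LinearMap.comp_apply, tensorFold_ι_mul]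
  rw [degreeOneStep, LinearMap.mk₂_apply, ← degreeOneStep, this]
  rfl

@[simp] theorem degreeOneProj_ι (v : V) : degreeOneProj K V (TensorAlgebra.ι K v) = v := by
  simpa using degreeOneProj_ι_mul v 1

theorem degreeOneProj_mul_ι (y : TensorAlgebra K V) (v : V) :
    degreeOneProj K V (y * TensorAlgebra.ι K v) = tensorCounit y • v := by
  induction y using tensorAlgebra_induction_left with
  | one => simp
  | smul c x hx => simp only [smul_mul_assoc, map_smul, hx, smul_assoc]
  | add x y hx hy => simp only [add_mul, map_add, hx, hy, add_smul]
  | ι_mul w y hy => rw [mul_assoc, degreeOneProj_ι_mul, tensorCounit_mul_ι, tensorCounit_ι_mul,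
      zero_smul, zero_smul]

theorem degreeOneProj_of_mem {n : ℕ} (hn : 2 ≤ n) {x : TensorAlgebra K V}
    (hx : x ∈ tensorDegree K V n) : degreeOneProj K V x = 0 := by
  refine tensorDegree_induction (P := fun n x => 2 ≤ n → degreeOneProj K V x = 0)
    (fun h => absurd h (by omega)) ?_ ?_ ?_ hx hn
  · intro c n x h hn; rw [map_smul, h hn, smul_zero]
  · intro n x y hx hy hn; rw [map_add, hx hn, hy hn, add_zero]
  · intro v n y hy _ hn; rw [degreeOneProj_ι_mul, tensorCounit_of_mem (by omega) hy, zero_smul]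

/-- `y = ε(y) 1 + ∑ y₁ π(y₂)`, where `π` is the projection onto degree `1`. -/
theorem eq_add_mul_degreeOneProj (y : TensorAlgebra K V) :
    y = degreeZeroProj K V y + LinearMap.mul' K _
      ((TensorAlgebra.ι K ∘ₗ degreeOneProj K V).lTensor _ (deconcat y)) := by
  induction y using tensorAlgebra_induction_left with
  | one => simp [degreeZeroProj, deconcat_one]
  | smul c x hx => rw [map_smul, map_smul, map_smul, map_smul, ← smul_add, ← hx]
  | add x y hx hy =>
    simp only [map_add]
    nth_rewrite 1 [hx, hy]
    abel
  | ι_mul v y hy =>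
    have h1 : ∀ s, LinearMap.mul' K _ ((TensorAlgebra.ι K ∘ₗ degreeOneProj K V).lTensor _
        ((TensorAlgebra.ι K v ⊗ₜ[K] (1 : TensorAlgebra K V)) * s)) = TensorAlgebra.ι K v *
        LinearMap.mul' K _ ((TensorAlgebra.ι K ∘ₗ degreeOneProj K V).lTensor _ s) := by
      intro s
      induction s using TensorProduct.induction_on with
      | zero => simp
      | add s t hs ht => simp only [map_add, mul_add, hs, ht]
      | tmul p q => simp [mul_assoc]
    have h2 : TensorAlgebra.ι K v * y = _ := congrArg (TensorAlgebra.ι K v * ·) hy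
    rw [deconcat_ι_mul, map_add, map_add, h1]
    rw [h2]
    nth_rewrite 1 [mul_add]
    rw [← hy, ← add_assoc]
    congr 1
    simp [degreeZeroProj, degreeOneProj_ι_mul, tensorCounit_ι_mul, Algebra.algebraMap_eq_smul_one]

theorem homogeneous_deconcat : Homogeneous (tensorDegree K V)
    (gradedTensor (tensorDegree K V) (tensorDegree K V)) deconcat := by
  intro n x hx
  refine tensorDegree_induction (P := fun n x => deconcat x ∈ gradedTensor (tensorDegree K V)
    (tensorDegree K V) n) ?_ ?_ ?_ ?_ hx
  · rw [deconcat_one];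
    exact tmul_mem_gradedTensor (zero_add 0) one_mem_tensorDegree one_mem_tensorDegree
  · intro c n x h; rw [map_smul]; exact Submodule.smul_mem _ _ h
  · intro n x y hx hy; rw [map_add]; exact add_mem hx hy
  · intro v n y hy h
    rw [deconcat_ι_mul]
    refine add_mem (tmul_mem_gradedTensor (zero_add _) one_mem_tensorDegree
      (ι_mul_mem_tensorDegree v hy)) ?_
    suffices Homogeneous (gradedTensor (tensorDegree K V) (tensorDegree K V))
        (fun n => gradedTensor (tensorDegree K V) (tensorDegree K V) (n + 1))
        (LinearMap.mulLeft K (TensorAlgebra.ι K v ⊗ₜ 1)) from this n _ h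
    refine homogeneous_gradedTensor fun i j a ha b hb => ?_
    rw [LinearMap.mulLeft_apply, Algebra.TensorProduct.tmul_mul_tmul, one_mul]
    exact tmul_mem_gradedTensor (by omega) (ι_mul_mem_tensorDegree v ha) hb

variable {H : Type*} [Ring H] [HopfAlgebra K H]
variable {act : H →ₗ[K] Module.End K V} {coact : V →ₗ[K] H ⊗[K] V}

theorem homogeneous_tensorAlgAct (h : H) :
    Homogeneous (tensorDegree K V) (tensorDegree K V) (tensorAlgAct act h) := by
  intro n x hx
  revert h
  refine tensorDegree_induction (P := fun n x => ∀ h, tensorAlgAct act h x ∈ tensorDegree K V n)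
    ?_ ?_ ?_ ?_ hx
  · intro h
    rw [tensorAlgAct_one, Algebra.algebraMap_eq_smul_one]
    exact Submodule.smul_mem _ _ one_mem_tensorDegree
  · intro c n x hx h; rw [map_smul]; exact Submodule.smul_mem _ _ (hx h)
  · intro n x y hx hy h; rw [map_add]; exact add_mem (hx h) (hy h)
  · intro v n y _ hy h
    rw [← consMap_tmul, tensorAlgAct_consMap, tensorAct_tmul]
    induction comul (R := K) h using TensorProduct.induction_on with
    | zero => simp
    | add s t hs ht => rw [map_add, map_add]; exact add_mem hs ht
    | tmul a b => exact ι_mul_mem_tensorDegree _ (hy b)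

theorem homogeneous_tensorAlgCoact :
    Homogeneous (tensorDegree K V) (scalarGrading H (tensorDegree K V)) (tensorAlgCoact coact) := by
  intro n x hx
  refine tensorDegree_induction (P := fun n x => tensorAlgCoact coact x ∈
    scalarGrading H (tensorDegree K V) n) ?_ ?_ ?_ ?_ hx
  · rw [tensorAlgCoact_one]; exact tmul_mem_scalarGrading _ one_mem_tensorDegree
  · intro c n x h; rw [map_smul]; exact Submodule.smul_mem _ _ h
  · intro n x y hx hy; rw [map_add]; exact add_mem hx hy
  · intro v n y _ h
    rw [tensorAlgCoact_mul, tensorAlgCoact_ι]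
    induction coact v using TensorProduct.induction_on with
    | zero => simp
    | add s t hs ht =>
      simp only [map_add, TensorProduct.add_tmul]
      exact add_mem hs ht
    | tmul k v =>
      suffices Homogeneous (scalarGrading H (tensorDegree K V))
          (fun n => scalarGrading H (tensorDegree K V) (n + 1))
          ((LinearMap.mul' K _).lTensor H ∘ₗ coMerge ∘ₗ TensorProduct.mk K _ _
            ((TensorAlgebra.ι K).lTensor H (k ⊗ₜ v))) from this n _ h
      refine homogeneous_scalarGrading fun l n a ha => ?_
      simp only [LinearMap.comp_apply, LinearMap.lTensor_tmul, TensorProduct.mk_apply,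
        coMerge_tmul, LinearMap.mul'_apply]
      exact tmul_mem_scalarGrading _ (ι_mul_mem_tensorDegree v ha)

variable (act coact) in
/-- The natural braiding of `T(V)`. -/
def tensorAlgBraiding : TensorAlgebra K V ⊗[K] TensorAlgebra K V →ₗ[K]
    TensorAlgebra K V ⊗[K] TensorAlgebra K V :=
  natBraiding (tensorAlgCoact coact) (tensorAlgAct act)

variable (act coact) in
/-- The coproduct of the braided tensor square of `T(V)`. -/
def braidedCoprod : TensorAlgebra K V ⊗[K] TensorAlgebra K V →ₗ[K]
    (TensorAlgebra K V ⊗[K] TensorAlgebra K V) ⊗[K] (TensorAlgebra K V ⊗[K] TensorAlgebra K V) :=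
  midMap (tensorAlgBraiding act coact) ∘ₗ TensorProduct.map deconcat deconcat

theorem twistedCoprod_eq (hV : IsYetterDrinfeld act coact) :
    twistedCoprod (natBraiding coact act) = braidedCoprod act coact := by
  rw [twistedCoprod, beta_natBraiding hV, braidedCoprod, tensorAlgBraiding]

variable (K V) in
/-- The total grading of `T(V) ⊗ T(V)`. -/
abbrev tensorSqDegree : ℕ → Submodule K (TensorAlgebra K V ⊗[K] TensorAlgebra K V) :=
  gradedTensor (tensorDegree K V) (tensorDegree K V)

variable (K V) in
/-- The counit of `T(V) ⊗ T(V)`. -/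
def tensorSqCounit : TensorAlgebra K V ⊗[K] TensorAlgebra K V →ₗ[K] K :=
  LinearMap.mul' K K ∘ₗ TensorProduct.map tensorCounit tensorCounit

@[simp] theorem tensorSqCounit_tmul (x y : TensorAlgebra K V) :
    tensorSqCounit K V (x ⊗ₜ y) = tensorCounit x * tensorCounit y := rfl

theorem homogeneous_braidedCoprod : Homogeneous (tensorSqDegree K V)
    (gradedTensor (tensorSqDegree K V) (tensorSqDegree K V)) (braidedCoprod act coact) :=
  (homogeneous_natBraiding homogeneous_tensorAlgCoact homogeneous_tensorAlgAct).midMap.comp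
    (homogeneous_deconcat.map homogeneous_deconcat)

theorem isYDHom_braidedCoprod (hV : IsYetterDrinfeld act coact) :
    IsYDHom (tensorAct (tensorAlgAct act) (tensorAlgAct act))
      (tensorCoact (tensorAlgCoact coact) (tensorAlgCoact coact))
      (tensorAct (tensorAct (tensorAlgAct act) (tensorAlgAct act))
        (tensorAct (tensorAlgAct act) (tensorAlgAct act)))
      (tensorCoact (tensorCoact (tensorAlgCoact coact) (tensorAlgCoact coact))
        (tensorCoact (tensorAlgCoact coact) (tensorAlgCoact coact)))
      (braidedCoprod act coact) :=
  (isYDHom_natBraiding (isYetterDrinfeld_tensorAlgebra hV)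
    (isYetterDrinfeld_tensorAlgebra hV)).midMap.comp (isYDHom_deconcat.map isYDHom_deconcat)

/-- The compatibility of the twist with each deconcatenation is naturality of the braiding in the
morphism `deconcat`, followed by a hexagon. -/
theorem braidedCoprod_coassoc (hV : IsYetterDrinfeld act coact)
    (t : TensorAlgebra K V ⊗[K] TensorAlgebra K V) :
    assoc K _ _ _ ((braidedCoprod act coact).rTensor _ (braidedCoprod act coact t)) =
      (braidedCoprod act coact).lTensor _ (braidedCoprod act coact t) := by
  have hT := isYetterDrinfeld_tensorAlgebra hV
  induction t using TensorProduct.induction_on with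
  | zero => simp
  | add s t hs ht => simp only [map_add, hs, ht]
  | tmul x y =>
    refine coassoc_twist deconcat_coassoc deconcat_coassoc (fun x y => ?_) (fun x y => ?_) x y
    · have := natBraiding_lTensor (coX := tensorAlgCoact coact) (deconcat (K := K) (V := V))
        (isYDHom_deconcat (act := act) (coact := coact)).map_act (x ⊗ₜ y)
      rw [tensorAlgBraiding, ← this, LinearMap.lTensor_tmul]
      induction deconcat y using TensorProduct.induction_on with
      | zero => simp
      | add s t hs ht => simp only [map_add, TensorProduct.tmul_add, hs, ht]
      | tmul p q => rw [natBraiding_tensor_right hT.coassoc]; simp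
    · have := natBraiding_rTensor (aY := tensorAlgAct act) (deconcat (K := K) (V := V))
        (isYDHom_deconcat (act := act) (coact := coact)).map_coact (x ⊗ₜ y)
      rw [tensorAlgBraiding, ← this, LinearMap.rTensor_tmul]
      induction deconcat x using TensorProduct.induction_on with
      | zero => simp
      | add s t hs ht => simp only [map_add, TensorProduct.add_tmul, hs, ht]
      | tmul p q => rw [natBraiding_tensor_left hT.mul_act]; simp

theorem tensorCounit_tensorAlgAct (h : H) (x : TensorAlgebra K V) :
    tensorCounit (tensorAlgAct act h x) = counit (R := K) h * tensorCounit x := by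
  have := congrArg tensorCounit
    -- The linearity half does not involve the coaction, so the zero map fills that slot. The next
    -- lemma fills the action slot in the same way.
    ((isYDHom_degreeZeroProj (act := act) (coact := (0 : V →ₗ[K] H ⊗[K] V))).map_act h x)
  simpa [degreeZeroProj, tensorAlgAct_one, Algebra.algebraMap_eq_smul_one, mul_comm] using this

theorem tensorCounit_lTensor_tensorAlgCoact (x : TensorAlgebra K V) :
    tensorCounit.lTensor H (tensorAlgCoact coact x) = 1 ⊗ₜ tensorCounit x := by
  have h0 : (tensorCounit : TensorAlgebra K V →ₗ[K] K) =
      tensorCounit ∘ₗ degreeZeroProj K V := by ext; simp [degreeZeroProj]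
  rw [h0, LinearMap.lTensor_comp, LinearMap.comp_apply,
    ← (isYDHom_degreeZeroProj (act := (0 : H →ₗ[K] Module.End K V))).map_coact]
  simp [degreeZeroProj, Algebra.algebraMap_eq_smul_one, ← TensorProduct.tmul_smul]

theorem lid_tensorSqCounit (hV : IsYetterDrinfeld act coact)
    (t : TensorAlgebra K V ⊗[K] TensorAlgebra K V) :
    TensorProduct.lid K _ ((tensorSqCounit K V).rTensor _ (braidedCoprod act coact t)) = t := by
  refine lid_counit_twist lid_tensorCounit_deconcat lid_tensorCounit_deconcat (fun x y => ?_) t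
  conv_rhs => rw [← (isYetterDrinfeld_tensorAlgebra hV).counit_coact x]
  rw [tensorAlgBraiding, natBraiding_tmul]
  induction tensorAlgCoact coact x using TensorProduct.induction_on with
  | zero => simp
  | add s t hs ht => simp only [map_add, smul_add, hs, ht]
  | tmul h x => simp [tensorCounit_tensorAlgAct, smul_smul, mul_comm]

theorem rid_tensorSqCounit (hV : IsYetterDrinfeld act coact)
    (t : TensorAlgebra K V ⊗[K] TensorAlgebra K V) :
    TensorProduct.rid K _ ((tensorSqCounit K V).lTensor _ (braidedCoprod act coact t)) = t := by
  refine rid_counit_twist rid_tensorCounit_deconcat rid_tensorCounit_deconcat (fun x y => ?_) t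
  have h1 : ∀ t : H ⊗[K] TensorAlgebra K V, TensorProduct.rid K _ (tensorCounit.lTensor _
      (((tensorAlgAct act).flip y).rTensor _ t)) = TensorProduct.rid K _
        (((tensorAlgAct act).flip y).rTensor K (tensorCounit.lTensor H t)) := by
    intro t
    induction t using TensorProduct.induction_on with
    | zero => simp
    | add s t hs ht => simp only [map_add, hs, ht]
    | tmul h x => simp
  rw [tensorAlgBraiding, natBraiding_tmul, h1, tensorCounit_lTensor_tensorAlgCoact]
  simp [(isYetterDrinfeld_tensorAlgebra hV).one_act]

end TensorDegree

/-! ### Consequences of the convolution recursion: coalgebra map, unit, associativity. -/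

section StarProduct

open Coalgebra (comul counit)
open TensorProduct (assoc)

variable {K : Type*} [Field K] {V : Type*} [AddCommGroup V] [Module K V]
variable {H : Type*} [Ring H] [HopfAlgebra K H]

theorem eq_zero_of_mem_tensorSqDegree_zero {X : Type*} [AddCommGroup X] [Module K X]
    {f : TensorAlgebra K V ⊗[K] TensorAlgebra K V →ₗ[K] X} (hf : f (1 ⊗ₜ 1) = 0)
    {t : TensorAlgebra K V ⊗[K] TensorAlgebra K V} (ht : t ∈ tensorSqDegree K V 0) : f t = 0 := by
  suffices tensorSqDegree K V 0 ≤ LinearMap.ker f from this ht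
  refine Submodule.span_le.2 ?_
  rintro _ ⟨i, j, hij, a, ha, b, hb, rfl⟩
  obtain ⟨rfl, rfl⟩ : i = 0 ∧ j = 0 := by omega
  obtain ⟨r, rfl⟩ := mem_tensorDegree_zero ha
  obtain ⟨s, rfl⟩ := mem_tensorDegree_zero hb
  simp [Algebra.algebraMap_eq_smul_one, ← TensorProduct.smul_tmul', hf]

variable (act : H →ₗ[K] Module.End K V) (coact : V →ₗ[K] H ⊗[K] V)
variable (μ : TensorAlgebra K V ⊗[K] TensorAlgebra K V →ₗ[K] V)
variable (star : TensorAlgebra K V ⊗[K] TensorAlgebra K V →ₗ[K] TensorAlgebra K V)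

/-- The recursion `star = η ε + star ⋆ μ` in the convolution algebra of `T(V) ⊗ T(V)`, for a
morphism `star` and a map `μ` that vanishes in degree `0`. -/
structure IsStarProduct : Prop where
  yetterDrinfeld : IsYetterDrinfeld act coact
  isYDHom : IsYDHom (tensorAct (tensorAlgAct act) (tensorAlgAct act))
    (tensorCoact (tensorAlgCoact coact) (tensorAlgCoact coact)) (tensorAlgAct act)
    (tensorAlgCoact coact) star
  brace_one : μ (1 ⊗ₜ 1) = 0
  recursion : ∀ t, star t = algebraMap K _ (tensorSqCounit K V t) + LinearMap.mul' K _
    (TensorProduct.map star (TensorAlgebra.ι K ∘ₗ μ) (braidedCoprod act coact t))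

variable {act coact μ star}

namespace IsStarProduct

variable (h : IsStarProduct act coact μ star)
include h

theorem brace_of_mem_zero {t : TensorAlgebra K V ⊗[K] TensorAlgebra K V}
    (ht : t ∈ tensorSqDegree K V 0) : μ t = 0 :=
  eq_zero_of_mem_tensorSqDegree_zero h.brace_one ht

/-- Every convolution term of the recursion ends with a factor in `V`, which `ε` kills. -/
theorem counit_star (t : TensorAlgebra K V ⊗[K] TensorAlgebra K V) :
    tensorCounit (star t) = tensorSqCounit K V t := by
  have : ∀ u, tensorCounit (LinearMap.mul' K _
      (TensorProduct.map star (TensorAlgebra.ι K ∘ₗ μ) u)) = 0 := by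
    intro u
    induction u using TensorProduct.induction_on with
    | zero => simp
    | add s t hs ht => simp only [map_add, hs, ht, add_zero]
    | tmul a b => simp [tensorCounit_mul]
  rw [h.recursion, map_add, this]
  simp

/-- The degree one part of `star a · μ b` is `ε(star a) μ b`, so the counit axiom reduces the
convolution term to `μ t`. -/
theorem degreeOneProj_star (t : TensorAlgebra K V ⊗[K] TensorAlgebra K V) :
    degreeOneProj K V (star t) = μ t := by
  have : ∀ u, degreeOneProj K V (LinearMap.mul' K _
      (TensorProduct.map star (TensorAlgebra.ι K ∘ₗ μ) u)) =
      μ (TensorProduct.lid K _ ((tensorSqCounit K V).rTensor _ u)) := by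
    intro u
    induction u using TensorProduct.induction_on with
    | zero => simp
    | add s t hs ht => simp only [map_add, hs, ht]
    | tmul a b => simp [degreeOneProj_mul_ι, h.counit_star]
  rw [h.recursion, map_add, this, lid_tensorSqCounit h.yetterDrinfeld]
  simp

/-- Both sides solve `F t = star t ⊗ 1 + ∑ F(t₁)(1 ⊗ μ t₂)`, and such a recursion has one solution
because `μ` vanishes in degree `0`. -/
theorem deconcat_star (t : TensorAlgebra K V ⊗[K] TensorAlgebra K V) :
    deconcat (star t) = TensorProduct.map star star (braidedCoprod act coact t) := by
  let Φ : (TensorAlgebra K V ⊗[K] TensorAlgebra K V) ⊗[K]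
      (TensorAlgebra K V ⊗[K] TensorAlgebra K V) →ₗ[K]
      TensorAlgebra K V ⊗[K] TensorAlgebra K V :=
    LinearMap.mul' K _ ∘ₗ (TensorProduct.mk K (TensorAlgebra K V) (TensorAlgebra K V) 1 ∘ₗ
      TensorAlgebra.ι K ∘ₗ μ).lTensor (TensorAlgebra K V ⊗[K] TensorAlgebra K V)
  have e₁ : ∀ t, deconcat (star t) =
      star t ⊗ₜ 1 + Φ ((deconcat ∘ₗ star).rTensor _ (braidedCoprod act coact t)) := by
    intro t
    have : ∀ u, deconcat (LinearMap.mul' K _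
        (TensorProduct.map star (TensorAlgebra.ι K ∘ₗ μ) u)) =
        LinearMap.mul' K _ (TensorProduct.map star (TensorAlgebra.ι K ∘ₗ μ) u) ⊗ₜ 1 +
        Φ ((deconcat ∘ₗ star).rTensor _ u) := by
      intro u
      induction u using TensorProduct.induction_on with
      | zero => simp
      | add s t hs ht => simp only [map_add, hs, ht, TensorProduct.add_tmul]; abel
      | tmul a b => simp [deconcat_mul_ι, Φ]
    nth_rewrite 1 2 [h.recursion t]
    rw [map_add, this, TensorProduct.add_tmul, add_assoc, Algebra.algebraMap_eq_smul_one, map_smul,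
      deconcat_one, TensorProduct.smul_tmul']
  -- Expand `star` on the right leg by its recursion: the counit term gives `star t ⊗ 1`, and
  -- coassociativity regroups the rest.
  have e₂ : ∀ t, TensorProduct.map star star (braidedCoprod act coact t) =
      star t ⊗ₜ 1 + Φ ((TensorProduct.map star star ∘ₗ braidedCoprod act coact).rTensor _
        (braidedCoprod act coact t)) := by
    intro t
    have e : ∀ u, TensorProduct.map star star u =
        star (TensorProduct.rid K _ ((tensorSqCounit K V).lTensor _ u)) ⊗ₜ 1 +
        Φ ((TensorProduct.map star star).rTensor _ ((assoc K _ _ _).symm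
          ((braidedCoprod act coact).lTensor _ u))) := by
      intro u
      induction u using TensorProduct.induction_on with
      | zero => simp
      | add s t hs ht => simp only [map_add, hs, ht, TensorProduct.add_tmul]; abel
      | tmul a b =>
        rw [TensorProduct.map_tmul, h.recursion b, TensorProduct.tmul_add]
        congr 1
        · simp [Algebra.algebraMap_eq_smul_one, TensorProduct.smul_tmul]
        · rw [LinearMap.lTensor_tmul]
          induction braidedCoprod act coact b using TensorProduct.induction_on with
          | zero => simp
          | add s t hs ht => simp only [map_add, TensorProduct.tmul_add, hs, ht]
          | tmul b c => simp [Φ]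
    rw [e, rid_tensorSqCounit h.yetterDrinfeld, ← braidedCoprod_coassoc h.yetterDrinfeld,
      LinearEquiv.symm_apply_apply, LinearMap.rTensor_comp]
    rfl
  have e₃ : deconcat ∘ₗ star = TensorProduct.map star star ∘ₗ braidedCoprod act coact :=
    eq_of_recursion (iSup_gradedTensor (iSup_tensorDegree K V) (iSup_tensorDegree K V))
      (homogeneous_braidedCoprod (act := act) (coact := coact)) Φ
      (fun z x hx => by simp [Φ, h.brace_of_mem_zero hx]) (fun t => star t ⊗ₜ 1) e₁ e₂
  exact LinearMap.congr_fun e₃ t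

/-- For a coalgebra map `j` with degree one component `degreeOneProj`, the composite with `star`
solves the same recursion as the identity, namely `eq_add_mul_degreeOneProj`. The maps `1 ⊗ -` and
`- ⊗ 1` are of this kind. -/
theorem star_unit {j : TensorAlgebra K V →ₗ[K] TensorAlgebra K V ⊗[K] TensorAlgebra K V}
    (hj : ∀ x, braidedCoprod act coact (j x) = TensorProduct.map j j (deconcat x))
    (hε : ∀ x, tensorSqCounit K V (j x) = tensorCounit x)
    (hμ : ∀ x, μ (j x) = degreeOneProj K V x) (x : TensorAlgebra K V) : star (j x) = x := by
  have e : star ∘ₗ j = LinearMap.id := by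
    refine eq_of_recursion (iSup_tensorDegree K V) homogeneous_deconcat
      (LinearMap.mul' K _ ∘ₗ (TensorAlgebra.ι K ∘ₗ degreeOneProj K V).lTensor _)
      (fun z x hx => ?_) (degreeZeroProj K V) (fun x => ?_) fun x => ?_
    · obtain ⟨r, rfl⟩ := mem_tensorDegree_zero hx
      simp
    · have h1 : ∀ u, LinearMap.mul' K _ (TensorProduct.map star (TensorAlgebra.ι K ∘ₗ μ)
          (TensorProduct.map j j u)) = LinearMap.mul' K _
            ((TensorAlgebra.ι K ∘ₗ degreeOneProj K V).lTensor _ ((star ∘ₗ j).rTensor _ u)) := by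
        intro u
        induction u using TensorProduct.induction_on with
        | zero => simp
        | add s t hs ht => simp only [map_add, hs, ht]
        | tmul a b => simp [hμ]
      have h2 : star (j x) = _ := h.recursion (j x)
      rw [hj, h1, hε] at h2
      exact h2
    · rw [LinearMap.rTensor_id]
      exact eq_add_mul_degreeOneProj x
  exact LinearMap.congr_fun e x

theorem one_star (hμ : ∀ x, μ (1 ⊗ₜ x) = degreeOneProj K V x) (x : TensorAlgebra K V) :
    star (1 ⊗ₜ x) = x := by
  refine h.star_unit (j := TensorProduct.mk K _ _ 1) (fun x => ?_) (fun x => by simp) hμ x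
  have hT := isYetterDrinfeld_tensorAlgebra h.yetterDrinfeld
  rw [TensorProduct.mk_apply, braidedCoprod, LinearMap.comp_apply, TensorProduct.map_tmul,
    deconcat_one]
  induction deconcat x using TensorProduct.induction_on with
  | zero => simp
  | add s t hs ht => simp only [map_add, TensorProduct.tmul_add, hs, ht]
  | tmul p q => simp [midMap_tmul, tensorAlgBraiding, natBraiding_tmul, hT.one_act]

theorem star_one (hμ : ∀ x, μ (x ⊗ₜ 1) = degreeOneProj K V x) (x : TensorAlgebra K V) :
    star (x ⊗ₜ 1) = x := by
  refine h.star_unit (j := (TensorProduct.mk K _ _).flip 1) (fun x => ?_) (fun x => by simp) hμ x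
  have hT := isYetterDrinfeld_tensorAlgebra h.yetterDrinfeld
  rw [LinearMap.flip_apply, TensorProduct.mk_apply, braidedCoprod, LinearMap.comp_apply,
    TensorProduct.map_tmul, deconcat_one]
  induction deconcat x using TensorProduct.induction_on with
  | zero => simp
  | add s t hs ht => simp only [map_add, TensorProduct.add_tmul, hs, ht]
  | tmul p q =>
    have : tensorAlgBraiding act coact (q ⊗ₜ 1) = 1 ⊗ₜ q := by
      conv_rhs => rw [← hT.counit_coact q]
      rw [tensorAlgBraiding, natBraiding_tmul]
      induction tensorAlgCoact coact q using TensorProduct.induction_on with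
      | zero => simp
      | add s t hs ht => simp only [map_add, TensorProduct.tmul_add, hs, ht]
      | tmul k x => simp [tensorAlgAct_one, Algebra.algebraMap_eq_smul_one,
          TensorProduct.smul_tmul']
    simp [midMap_tmul, this]

/-- The coproduct of the braided tensor cube of `T(V)`. -/
theorem braidedCoprod_star_left (s : TensorAlgebra K V ⊗[K] TensorAlgebra K V)
    (z : TensorAlgebra K V) :
    braidedCoprod act coact (star s ⊗ₜ z) = TensorProduct.map (star.rTensor _) (star.rTensor _)
      (midMap (natBraiding (tensorCoact (tensorAlgCoact coact) (tensorAlgCoact coact))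
        (tensorAlgAct act)) (braidedCoprod act coact s ⊗ₜ deconcat z)) := by
  rw [braidedCoprod, LinearMap.comp_apply, TensorProduct.map_tmul, h.deconcat_star,
    ← braidedCoprod]
  induction braidedCoprod act coact s using TensorProduct.induction_on with
  | zero => simp
  | add s t hs ht => simp only [map_add, TensorProduct.add_tmul, hs, ht]
  | tmul p q =>
  induction deconcat z using TensorProduct.induction_on with
  | zero => simp
  | add s t hs ht => simp only [map_add, TensorProduct.tmul_add, hs, ht]
  | tmul e r =>
    have := natBraiding_rTensor (aY := tensorAlgAct act) star h.isYDHom.map_coact (q ⊗ₜ e)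
    rw [LinearMap.rTensor_tmul] at this
    rw [TensorProduct.map_tmul, midMap_tmul, midMap_tmul, tensorAlgBraiding, this]
    induction natBraiding (tensorCoact (tensorAlgCoact coact) (tensorAlgCoact coact))
        (tensorAlgAct act) (q ⊗ₜ e) using TensorProduct.induction_on with
    | zero => simp
    | add s t hs ht => simp only [map_add, hs, ht]
    | tmul a b => simp

/-- Combines `deconcat_star` with naturality of the braiding in `star`: multiplying the last two
factors respects the coproducts of the braided cube and square. -/
theorem braidedCoprod_star_right (x : TensorAlgebra K V)
    (s : TensorAlgebra K V ⊗[K] TensorAlgebra K V) :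
    braidedCoprod act coact (x ⊗ₜ star s) = TensorProduct.map (star.lTensor _) (star.lTensor _)
      (midMap (natBraiding (tensorAlgCoact coact) (tensorAct (tensorAlgAct act)
        (tensorAlgAct act))) (deconcat x ⊗ₜ braidedCoprod act coact s)) := by
  rw [braidedCoprod, LinearMap.comp_apply, TensorProduct.map_tmul, h.deconcat_star,
    ← braidedCoprod]
  induction braidedCoprod act coact s using TensorProduct.induction_on with
  | zero => simp
  | add s t hs ht => simp only [map_add, TensorProduct.tmul_add, hs, ht]
  | tmul p q =>
  induction deconcat x using TensorProduct.induction_on with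
  | zero => simp
  | add s t hs ht => simp only [map_add, TensorProduct.add_tmul, hs, ht]
  | tmul e r =>
    have := natBraiding_lTensor (coX := tensorAlgCoact coact) star h.isYDHom.map_act (r ⊗ₜ p)
    rw [LinearMap.lTensor_tmul] at this
    rw [TensorProduct.map_tmul, midMap_tmul, midMap_tmul, tensorAlgBraiding, this]
    induction natBraiding (tensorAlgCoact coact) (tensorAct (tensorAlgAct act)
        (tensorAlgAct act)) (r ⊗ₜ p) using TensorProduct.induction_on with
    | zero => simp
    | add s t hs ht => simp only [map_add, hs, ht]
    | tmul a b => simp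

omit h in
-- The brace identity is assumed only in positive degrees. When one argument is a scalar, the unit
-- laws and `h5` supply it.
theorem brace_assoc_total (h1 : ∀ x, star (1 ⊗ₜ x) = x) (h2 : ∀ x, star (x ⊗ₜ 1) = x)
    (h3 : ∀ x, μ (1 ⊗ₜ x) = degreeOneProj K V x) (h4 : ∀ x, μ (x ⊗ₜ 1) = degreeOneProj K V x)
    (h5 : ∀ t, degreeOneProj K V (star t) = μ t)
    (hassoc : ∀ i j k, 1 ≤ i → 1 ≤ j → 1 ≤ k → ∀ x ∈ tensorDegree K V i,
      ∀ y ∈ tensorDegree K V j, ∀ z ∈ tensorDegree K V k,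
      μ (star (x ⊗ₜ y) ⊗ₜ z) = μ (x ⊗ₜ star (y ⊗ₜ z))) (x y z : TensorAlgebra K V) :
    μ (star (x ⊗ₜ y) ⊗ₜ z) = μ (x ⊗ₜ star (y ⊗ₜ z)) := by
  have mem : ∀ x, x ∈ ⨆ n, tensorDegree K V n := fun x => by
    rw [iSup_tensorDegree]; exact Submodule.mem_top
  induction mem x using Submodule.iSup_induction' with
  | zero => simp
  | add s t _ _ hs ht => simp only [map_add, TensorProduct.add_tmul, hs, ht]
  | mem i x hx =>
  induction mem y using Submodule.iSup_induction' with
  | zero => simp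
  | add s t _ _ hs ht =>
    simp only [map_add, TensorProduct.add_tmul, TensorProduct.tmul_add, hs, ht]
  | mem j y hy =>
  induction mem z using Submodule.iSup_induction' with
  | zero => simp
  | add s t _ _ hs ht => simp only [map_add, TensorProduct.tmul_add, hs, ht]
  | mem k z hz =>
  rcases Nat.eq_zero_or_pos i with rfl | hi
  · obtain ⟨r, rfl⟩ := mem_tensorDegree_zero hx
    simp [Algebra.algebraMap_eq_smul_one, ← TensorProduct.smul_tmul', h1, h3, h5]
  rcases Nat.eq_zero_or_pos j with rfl | hj
  · obtain ⟨r, rfl⟩ := mem_tensorDegree_zero hy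
    simp [Algebra.algebraMap_eq_smul_one, ← TensorProduct.smul_tmul', h1, h2]
  rcases Nat.eq_zero_or_pos k with rfl | hk
  · obtain ⟨r, rfl⟩ := mem_tensorDegree_zero hz
    simp [Algebra.algebraMap_eq_smul_one, h2, h4, h5]
  exact hassoc i j k hi hj hk x hx y hy z hz

/-- The star product is associative if its degree one part is. -/
theorem isAssocAlgebra (hone : star (1 ⊗ₜ 1) = 1)
    (hassoc : ∀ x y z, μ (star (x ⊗ₜ y) ⊗ₜ z) = μ (x ⊗ₜ star (y ⊗ₜ z))) :
    IsAssocAlgebra star := by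
  have hT := isYetterDrinfeld_tensorAlgebra h.yetterDrinfeld
  set cL := natBraiding (tensorCoact (tensorAlgCoact coact) (tensorAlgCoact coact))
    (tensorAlgAct act) with hcL
  set cR := natBraiding (tensorAlgCoact coact) (tensorAct (tensorAlgAct act) (tensorAlgAct act))
    with hcR
  -- The coproduct of the braided cube, bracketed to the left. For the right bracketing,
  -- `twist_assoc` provides the comparison along the associator.
  set Δ₃ := midMap cL ∘ₗ TensorProduct.map (braidedCoprod act coact) deconcat with hΔ₃
  set α := (assoc K (TensorAlgebra K V) (TensorAlgebra K V) (TensorAlgebra K V)).toLinearMap with hα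
  set φ := μ ∘ₗ star.rTensor (TensorAlgebra K V) with hφ
  have hφ' : φ = μ ∘ₗ star.lTensor (TensorAlgebra K V) ∘ₗ α :=
    TensorProduct.ext_threefold hassoc
  have left : ∀ t, braidedCoprod act coact (star.rTensor _ t) =
      TensorProduct.map (star.rTensor _) (star.rTensor _) (Δ₃ t) := by
    intro t
    induction t using TensorProduct.induction_on with
    | zero => simp
    | add s t hs ht => simp only [map_add, hs, ht]
    | tmul s z => exact h.braidedCoprod_star_left s z
  have right : ∀ t, braidedCoprod act coact (star.lTensor _ (α t)) =
      TensorProduct.map (star.lTensor _ ∘ₗ α) (star.lTensor _ ∘ₗ α) (Δ₃ t) := by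
    intro t
    suffices braidedCoprod act coact ∘ₗ star.lTensor _ ∘ₗ α =
      TensorProduct.map (star.lTensor _ ∘ₗ α) (star.lTensor _ ∘ₗ α) ∘ₗ Δ₃ from
      LinearMap.congr_fun this t
    refine TensorProduct.ext_threefold fun x y z => ?_
    have := twist_assoc (c := tensorAlgBraiding act coact) (cL := cL) (cR := cR)
      (natBraiding_tensor_left hT.mul_act) (natBraiding_tensor_right hT.coassoc)
      (deconcat x) (deconcat y) (deconcat z)
    rw [TensorProduct.map_comp, LinearMap.comp_apply, LinearMap.comp_apply]
    exact (h.braidedCoprod_star_right x (y ⊗ₜ z)).trans (congrArg _ this.symm)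
  let Φ : TensorAlgebra K V ⊗[K] ((TensorAlgebra K V ⊗[K] TensorAlgebra K V) ⊗[K]
      TensorAlgebra K V) →ₗ[K] TensorAlgebra K V :=
    LinearMap.mul' K _ ∘ₗ (TensorAlgebra.ι K ∘ₗ φ).lTensor (TensorAlgebra K V)
  -- Any `f` that respects the coproducts and satisfies `μ ∘ f = φ` makes `star ∘ f` solve one
  -- recursion, whose convolution part depends only on `φ`. Both bracketings are of this form, with
  -- the same `φ` by `hassoc`.
  have hrec : ∀ f : (TensorAlgebra K V ⊗[K] TensorAlgebra K V) ⊗[K] TensorAlgebra K V →ₗ[K]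
      TensorAlgebra K V ⊗[K] TensorAlgebra K V, φ = μ ∘ₗ f →
      (∀ t, braidedCoprod act coact (f t) = TensorProduct.map f f (Δ₃ t)) → ∀ t,
      star (f t) = algebraMap K _ (tensorSqCounit K V (f t)) + Φ ((star ∘ₗ f).rTensor _ (Δ₃ t)) := by
    intro f hf hΔ t
    rw [h.recursion, hΔ]
    congr 1
    induction Δ₃ t using TensorProduct.induction_on with
    | zero => simp
    | add s t hs ht => simp only [map_add, hs, ht]
    | tmul a b => simp [Φ, hf]
  have counits : ∀ t, tensorSqCounit K V (star.rTensor _ t) =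
      tensorSqCounit K V (star.lTensor _ (α t)) := by
    intro t
    suffices tensorSqCounit K V ∘ₗ star.rTensor _ = tensorSqCounit K V ∘ₗ star.lTensor _ ∘ₗ α from
      LinearMap.congr_fun this t
    refine TensorProduct.ext_threefold fun x y z => ?_
    simp [h.counit_star, hα, mul_assoc]
  have e : star ∘ₗ star.rTensor _ = star ∘ₗ star.lTensor _ ∘ₗ α := by
    refine eq_of_recursion (A := gradedTensor (tensorSqDegree K V) (tensorDegree K V))
      (iSup_gradedTensor (iSup_gradedTensor (iSup_tensorDegree K V) (iSup_tensorDegree K V))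
        (iSup_tensorDegree K V)) (Δ := Δ₃) ?_ Φ (fun z t ht => ?_)
      (fun t => algebraMap K _ (tensorSqCounit K V (star.rTensor _ t)))
      (hrec (star.rTensor _) rfl left) fun t => ?_
    · exact (homogeneous_natBraiding (homogeneous_tensorCoact homogeneous_tensorAlgCoact
        homogeneous_tensorAlgCoact) homogeneous_tensorAlgAct).midMap.comp
        (homogeneous_braidedCoprod.map homogeneous_deconcat)
    -- `φ` vanishes in degree `0` because `star (1 ⊗ 1) = 1` and `μ (1 ⊗ 1) = 0`.
    · suffices gradedTensor (tensorSqDegree K V) (tensorDegree K V) 0 ≤ LinearMap.ker φ by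
        have : φ t = 0 := this ht
        simp [Φ, this]
      refine Submodule.span_le.2 ?_
      rintro _ ⟨i, j, hij, s, hs, z, hz, rfl⟩
      obtain ⟨rfl, rfl⟩ : i = 0 ∧ j = 0 := by omega
      obtain ⟨r, rfl⟩ := mem_tensorDegree_zero hz
      suffices tensorSqDegree K V 0 ≤ LinearMap.ker
        (φ ∘ₗ (TensorProduct.mk K _ _).flip (algebraMap K (TensorAlgebra K V) r)) from this hs
      refine Submodule.span_le.2 ?_
      rintro _ ⟨i, j, hij, a, ha, b, hb, rfl⟩
      obtain ⟨rfl, rfl⟩ : i = 0 ∧ j = 0 := by omega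
      obtain ⟨a, rfl⟩ := mem_tensorDegree_zero ha
      obtain ⟨b, rfl⟩ := mem_tensorDegree_zero hb
      simp [Algebra.algebraMap_eq_smul_one, ← TensorProduct.smul_tmul', hφ, hone, h.brace_one]
    · rw [counits]
      exact hrec (star.lTensor _ ∘ₗ α) hφ' right t
  intro x y z
  exact LinearMap.congr_fun e ((x ⊗ₜ y) ⊗ₜ z)

end IsStarProduct

end StarProduct

/-! ### The product `*` as a geometric series in the braces. -/

section BraceProduct

open Coalgebra (comul counit)
open TensorProduct (assoc)

variable {K : Type*} [Field K] {V : Type*} [AddCommGroup V] [Module K V]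

theorem mulEquiv_tprod {p q : ℕ} (a : Fin p → V) (b : Fin q → V) :
    TensorPower.mulEquiv (PiTensorProduct.tprod K a ⊗ₜ PiTensorProduct.tprod K b) =
      PiTensorProduct.tprod K (Fin.append a b) :=
  (TensorPower.gMul_def _ _).symm.trans (TensorPower.tprod_mul_tprod K a b)

theorem map_mulEquiv {C : Type*} [AddCommGroup C] [Module K C] (f : C →ₗ[K] V) {p q : ℕ}
    (t : (⨂[K]^p C) ⊗[K] (⨂[K]^q C)) :
    PiTensorProduct.map (fun _ => f) (TensorPower.mulEquiv t) =
      TensorPower.mulEquiv (TensorProduct.map (PiTensorProduct.map fun _ => f)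
        (PiTensorProduct.map fun _ => f) t) := by
  induction t using TensorProduct.induction_on with
  | zero => simp
  | add s t hs ht => simp only [map_add, hs, ht]
  | tmul x y =>
  induction x using PiTensorProduct.induction_on with
  | add s t hs ht => simp only [map_add, TensorProduct.add_tmul, hs, ht]
  | smul_tprod r a =>
  induction y using PiTensorProduct.induction_on with
  | add s t hs ht => simp only [map_add, TensorProduct.tmul_add, hs, ht]
  | smul_tprod s b =>
  have key : PiTensorProduct.map (fun _ => f) (TensorPower.mulEquiv
      (PiTensorProduct.tprod K a ⊗ₜ PiTensorProduct.tprod K b)) = TensorPower.mulEquiv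
        (PiTensorProduct.tprod K (f ∘ a) ⊗ₜ PiTensorProduct.tprod K (f ∘ b)) := by
    refine (congrArg _ (mulEquiv_tprod a b)).trans ((PiTensorProduct.map_tprod _ _).trans
      (Eq.trans (congrArg _ ?_) (mulEquiv_tprod _ _).symm))
    funext i
    refine Fin.addCases (fun i => ?_) (fun i => ?_) i <;> simp
  simp only [← TensorProduct.smul_tmul', TensorProduct.tmul_smul, map_smul,
    TensorProduct.map_tmul, PiTensorProduct.map_tprod]
  exact congrArg _ (congrArg _ key)

variable {H : Type*} [Ring H] [HopfAlgebra K H]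
variable {act : H →ₗ[K] Module.End K V} {coact : V →ₗ[K] H ⊗[K] V}
variable (M : ∀ p q : ℕ, (⨂[K]^p V) ⊗[K] (⨂[K]^q V) →ₗ[K] V)
variable (σ : V ⊗[K] V →ₗ[K] V ⊗[K] V)

/-- `M^{⊗(n+1)} ∘ Δ_β^{(n)}`, with values in `T(V)`. -/
def braceTerm (n : ℕ) : TensorAlgebra K V ⊗[K] TensorAlgebra K V →ₗ[K] TensorAlgebra K V :=
  TensorPower.toTensorAlgebra ∘ₗ bracePow M σ n

theorem braceTerm_zero : braceTerm M σ 0 = TensorAlgebra.ι K ∘ₗ totalBrace M := by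
  refine LinearMap.ext fun t => ?_
  have : bracePow M σ 0 t = PiTensorProduct.tprod K (fun _ : Fin 1 => totalBrace M t) := by
    simp [bracePow, iterCoprod]
  rw [braceTerm, LinearMap.comp_apply, this]
  exact incl_single _

/-- The iterated coproduct splits off its last leg, so `braceTerm M σ n` is the `(n + 1)`-st
convolution power of the total brace. -/
theorem braceTerm_succ (n : ℕ) : braceTerm M σ (n + 1) = LinearMap.mul' K _ ∘ₗ
    TensorProduct.map (braceTerm M σ n) (TensorAlgebra.ι K ∘ₗ totalBrace M) ∘ₗ
      twistedCoprod σ := by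
  refine LinearMap.ext fun t => ?_
  rw [← braceTerm_zero M σ]
  simp only [braceTerm, bracePow, iterCoprod, LinearMap.comp_apply, LinearEquiv.coe_coe]
  rw [map_mulEquiv]
  refine (incl_mulEquiv _).trans ?_
  induction twistedCoprod σ t using TensorProduct.induction_on with
  | zero => simp
  | add s t hs ht => simp only [map_add, hs, ht]
  | tmul a b => simp

theorem tensorSq_induction {P : TensorAlgebra K V ⊗[K] TensorAlgebra K V → Prop}
    (zero : P 0) (add : ∀ s t, P s → P t → P (s + t))
    (incl : ∀ (p q : ℕ) (x : ⨂[K]^p V) (y : ⨂[K]^q V), P (incl x ⊗ₜ incl y))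
    (t : TensorAlgebra K V ⊗[K] TensorAlgebra K V) : P t := by
  have mem : ∀ x, x ∈ ⨆ n, tensorDegree K V n := fun x => by
    rw [iSup_tensorDegree]; exact Submodule.mem_top
  induction t using TensorProduct.induction_on with
  | zero => exact zero
  | add s t hs ht => exact add s t hs ht
  | tmul x y =>
  induction mem x using Submodule.iSup_induction' with
  | zero => rw [TensorProduct.zero_tmul]; exact zero
  | add s t _ _ hs ht => rw [TensorProduct.add_tmul]; exact add _ _ hs ht
  | mem i x hx =>
  induction mem y using Submodule.iSup_induction' with
  | zero => rw [TensorProduct.tmul_zero]; exact zero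
  | add s t _ _ hs ht => rw [TensorProduct.tmul_add]; exact add _ _ hs ht
  | mem j y hy =>
  obtain ⟨x, rfl⟩ := exists_incl_eq hx
  obtain ⟨y, rfl⟩ := exists_incl_eq hy
  exact incl i j x y

theorem tensorSqDegree_induction {n : ℕ}
    {P : TensorAlgebra K V ⊗[K] TensorAlgebra K V → Prop}
    (zero : P 0) (add : ∀ s t, P s → P t → P (s + t)) (smul : ∀ (c : K) s, P s → P (c • s))
    (incl : ∀ (p q : ℕ), p + q = n → ∀ (x : ⨂[K]^p V) (y : ⨂[K]^q V), P (incl x ⊗ₜ incl y))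
    {t : TensorAlgebra K V ⊗[K] TensorAlgebra K V} (ht : t ∈ tensorSqDegree K V n) : P t := by
  induction ht using Submodule.span_induction with
  | zero => exact zero
  | add s t _ _ hs ht => exact add s t hs ht
  | smul c s _ hs => exact smul c s hs
  | mem _ h =>
    obtain ⟨p, q, hpq, x, hx, y, hy, rfl⟩ := h
    obtain ⟨x, rfl⟩ := exists_incl_eq hx
    obtain ⟨y, rfl⟩ := exists_incl_eq hy
    exact incl p q hpq x y

/-- The truncation of the star product to the terms of length less than `n`. -/
def braceSum (n : ℕ) : TensorAlgebra K V ⊗[K] TensorAlgebra K V →ₗ[K] TensorAlgebra K V :=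
  Algebra.linearMap K _ ∘ₗ tensorSqCounit K V + ∑ i ∈ Finset.range n, braceTerm M σ i

variable {M}

theorem totalBrace_one_tmul_one (h0 : M 0 0 = 0) : totalBrace M (1 ⊗ₜ 1) = 0 := by
  rw [← incl_elim0, totalBrace, bigradedMap_incl, h0, LinearMap.zero_apply]

/-- The term of index `n` has `n + 1` factors; if the total degree is at most `n`, some leg has
degree `0`, where the brace vanishes. -/
theorem braceTerm_eq_zero (hV : IsYetterDrinfeld act coact) (h0 : M 0 0 = 0) {n m : ℕ} (h : m ≤ n)
    {t : TensorAlgebra K V ⊗[K] TensorAlgebra K V} (ht : t ∈ tensorSqDegree K V m) :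
    braceTerm M (natBraiding coact act) n t = 0 := by
  have h1 := totalBrace_one_tmul_one h0
  induction n generalizing m t with
  | zero =>
    obtain rfl : m = 0 := by omega
    rw [braceTerm_zero, LinearMap.comp_apply, eq_zero_of_mem_tensorSqDegree_zero h1 ht, map_zero]
  | succ n ih =>
    rw [braceTerm_succ, twistedCoprod_eq hV]
    suffices gradedTensor (tensorSqDegree K V) (tensorSqDegree K V) m ≤ LinearMap.ker
        (LinearMap.mul' K _ ∘ₗ TensorProduct.map (braceTerm M (natBraiding coact act) n)
          (TensorAlgebra.ι K ∘ₗ totalBrace M)) from this (homogeneous_braidedCoprod m t ht)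
    refine Submodule.span_le.2 ?_
    rintro _ ⟨i, j, rfl, a, ha, b, hb, rfl⟩
    rcases Nat.eq_zero_or_pos j with rfl | hj
    · simp [eq_zero_of_mem_tensorSqDegree_zero h1 hb]
    · simp [ih (show i ≤ n by omega) ha]

/-- Replaces the bound `p + q` in the definition, which varies with the bidegree, by any
sufficiently large truncation. On each degree `*` thus agrees with a single finite sum of linear
maps. -/
theorem starProd_eq_braceSum (hV : IsYetterDrinfeld act coact) (h0 : M 0 0 = 0) {n m : ℕ}
    (h : m ≤ n) {t : TensorAlgebra K V ⊗[K] TensorAlgebra K V} (ht : t ∈ tensorSqDegree K V m) :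
    starProd M (natBraiding coact act) t = braceSum M (natBraiding coact act) n t := by
  refine tensorSqDegree_induction (P := fun t => starProd M (natBraiding coact act) t =
    braceSum M (natBraiding coact act) n t) ?_ ?_ ?_ ?_ ht
  · simp only [map_zero]
  · intro s t hs ht; simp only [map_add, hs, ht]
  · intro c s hs; simp only [map_smul, hs]
  · rintro p q rfl x y
    have hxy : incl x ⊗ₜ incl y ∈ tensorSqDegree K V (p + q) :=
      tmul_mem_gradedTensor rfl (incl_mem_tensorDegree x) (incl_mem_tensorDegree y)
    rw [starProd, braceSum, LinearMap.add_apply, LinearMap.add_apply, bigradedMap_incl]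
    refine congrArg₂ (· + ·) rfl ?_
    rw [LinearMap.sum_apply, LinearMap.sum_apply]
    exact Finset.sum_subset (Finset.range_mono h) fun k _ hk =>
      braceTerm_eq_zero hV h0 (by simpa using hk) hxy

/-- The identity `1 + a + ⋯ + aⁿ⁺¹ = 1 + (1 + a + ⋯ + aⁿ) a` in the convolution algebra. -/
theorem braceSum_succ (hV : IsYetterDrinfeld act coact) (n : ℕ)
    (t : TensorAlgebra K V ⊗[K] TensorAlgebra K V) :
    braceSum M (natBraiding coact act) (n + 1) t = algebraMap K _ (tensorSqCounit K V t) +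
      LinearMap.mul' K _ (TensorProduct.map (braceSum M (natBraiding coact act) n)
        (TensorAlgebra.ι K ∘ₗ totalBrace M) (braidedCoprod act coact t)) := by
  have e : ∀ u, LinearMap.mul' K _ (TensorProduct.map (Algebra.linearMap K _ ∘ₗ
      tensorSqCounit K V) (TensorAlgebra.ι K ∘ₗ totalBrace M) u) = TensorAlgebra.ι K
        (totalBrace M (TensorProduct.lid K _ ((tensorSqCounit K V).rTensor _ u))) := by
    intro u
    induction u using TensorProduct.induction_on with
    | zero => simp
    | add s t hs ht => simp only [map_add, hs, ht]
    | tmul a b => simp [Algebra.algebraMap_eq_smul_one]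
  have e' : ∀ u, LinearMap.mul' K _ (TensorProduct.map (∑ i ∈ Finset.range n,
      braceTerm M (natBraiding coact act) i) (TensorAlgebra.ι K ∘ₗ totalBrace M) u) =
      ∑ i ∈ Finset.range n, LinearMap.mul' K _ (TensorProduct.map
        (braceTerm M (natBraiding coact act) i) (TensorAlgebra.ι K ∘ₗ totalBrace M) u) := by
    intro u
    induction u using TensorProduct.induction_on with
    | zero => simp
    | add s t hs ht => simp only [map_add, hs, ht, Finset.sum_add_distrib]
    | tmul a b => simp [LinearMap.sum_apply, Finset.sum_mul]
  rw [braceSum, braceSum, TensorProduct.map_add_left, LinearMap.add_apply, LinearMap.add_apply,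
    map_add, e, e', lid_tensorSqCounit hV, Finset.sum_range_succ', LinearMap.add_apply,
    LinearMap.sum_apply, braceTerm_zero, add_comm (∑ i ∈ _, _)]
  simp only [braceTerm_succ, twistedCoprod_eq hV]
  rfl

theorem starProd_recursion (hV : IsYetterDrinfeld act coact) (h0 : M 0 0 = 0)
    (t : TensorAlgebra K V ⊗[K] TensorAlgebra K V) :
    starProd M (natBraiding coact act) t = algebraMap K _ (tensorSqCounit K V t) +
      LinearMap.mul' K _ (TensorProduct.map (starProd M (natBraiding coact act))
        (TensorAlgebra.ι K ∘ₗ totalBrace M) (braidedCoprod act coact t)) := by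
  have mem : t ∈ ⨆ n, tensorSqDegree K V n := by
    rw [iSup_gradedTensor (iSup_tensorDegree K V) (iSup_tensorDegree K V)]
    exact Submodule.mem_top
  induction mem using Submodule.iSup_induction' with
  | zero => simp
  | add s t _ _ hs ht => simp only [map_add, hs, ht]; abel
  | mem n t ht =>
    -- Truncating at `n + 1` rather than `n` leaves `braceSum` at `n` inside the convolution; the
    -- left legs have degree at most `n`, so it agrees with `*` there.
    rw [starProd_eq_braceSum hV h0 (Nat.le_succ n) ht, braceSum_succ hV]
    congr 2
    refine LinearMap.eqOn_span (s := {u | ∃ i j, i + j = n ∧ ∃ a ∈ tensorSqDegree K V i,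
      ∃ b ∈ tensorSqDegree K V j, a ⊗ₜ b = u}) ?_ (homogeneous_braidedCoprod n t ht)
    rintro _ ⟨i, j, rfl, a, ha, b, hb, rfl⟩
    rw [TensorProduct.map_tmul, TensorProduct.map_tmul,
      starProd_eq_braceSum hV h0 (Nat.le_add_right i j) ha]

/-- The action and coaction of `T(V)` preserve degree, so the projection in the definitions of
`powAct` and `powCoact` loses nothing. -/
theorem isYDHom_incl (n : ℕ) : IsYDHom (powAct act n) (powCoact coact n) (tensorAlgAct act)
    (tensorAlgCoact coact) (TensorPower.toTensorAlgebra (R := K) (M := V) (n := n)) where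
  map_act h x := incl_degreePart (homogeneous_tensorAlgAct h n _ (incl_mem_tensorDegree x))
  map_coact x := by
    have : ∀ u ∈ scalarGrading H (tensorDegree K V) n,
        TensorPower.toTensorAlgebra.lTensor H ((degreePart n).lTensor H u) = u := by
      intro u hu
      induction hu using Submodule.span_induction with
      | zero => simp
      | add s t _ _ hs ht => simp only [map_add, hs, ht]
      | smul c s _ hs => simp only [map_smul, hs]
      | mem _ h =>
        obtain ⟨k, a, ha, rfl⟩ := h
        rw [LinearMap.lTensor_tmul, LinearMap.lTensor_tmul]
        exact congrArg _ (incl_degreePart ha)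
    exact (this _ (homogeneous_tensorAlgCoact n _ (incl_mem_tensorDegree x))).symm

theorem isYDHom_totalBrace (hM : ∀ p q : ℕ, IsYDHom (tensorAct (powAct act p) (powAct act q))
      (tensorCoact (powCoact coact p) (powCoact coact q)) act coact (M p q)) :
    IsYDHom (tensorAct (tensorAlgAct act) (tensorAlgAct act))
      (tensorCoact (tensorAlgCoact coact) (tensorAlgCoact coact)) act coact (totalBrace M) := by
  have e : ∀ (p q : ℕ) (t : (⨂[K]^p V) ⊗[K] (⨂[K]^q V)), totalBrace M
      (TensorProduct.map TensorPower.toTensorAlgebra TensorPower.toTensorAlgebra t) = M p q t := by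
    intro p q t
    induction t using TensorProduct.induction_on with
    | zero => simp
    | add s t hs ht => simp only [map_add, hs, ht]
    | tmul x y => exact bigradedMap_incl M x y
  have hI : ∀ p q : ℕ, IsYDHom _ _ _ _ (TensorProduct.map
      (TensorPower.toTensorAlgebra (R := K) (M := V) (n := p))
      (TensorPower.toTensorAlgebra (R := K) (M := V) (n := q))) := fun p q =>
    (isYDHom_incl (act := act) (coact := coact) p).map
      (isYDHom_incl (act := act) (coact := coact) q)
  constructor
  · intro h t
    induction t using tensorSq_induction with
    | zero => simp
    | add s t hs ht => simp only [map_add, hs, ht]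
    | incl p q x y =>
      rw [← TensorProduct.map_tmul, ← (hI p q).map_act, e, e, (hM p q).map_act]
  · intro t
    induction t using tensorSq_induction with
    | zero => simp
    | add s t hs ht => simp only [map_add, hs, ht]
    | incl p q x y =>
      rw [← TensorProduct.map_tmul, e, (hI p q).map_coact, (hM p q).map_coact,
        ← LinearMap.comp_apply (LinearMap.lTensor H (totalBrace M)), ← LinearMap.lTensor_comp,
        show totalBrace M ∘ₗ _ = M p q from LinearMap.ext (e p q)]

/-- Each term is composed of morphisms: the braided coproduct, the brace followed by `ι`, and
concatenation. -/
theorem isYDHom_braceSum (hV : IsYetterDrinfeld act coact)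
    (hM : ∀ p q : ℕ, IsYDHom (tensorAct (powAct act p) (powAct act q))
      (tensorCoact (powCoact coact p) (powCoact coact q)) act coact (M p q)) (n : ℕ) :
    IsYDHom (tensorAct (tensorAlgAct act) (tensorAlgAct act))
      (tensorCoact (tensorAlgCoact coact) (tensorAlgCoact coact)) (tensorAlgAct act)
      (tensorAlgCoact coact) (braceSum M (natBraiding coact act) n) := by
  have hμ := isYDHom_ι.comp (isYDHom_totalBrace hM)
  have hterm : ∀ n, IsYDHom (tensorAct (tensorAlgAct act) (tensorAlgAct act))
      (tensorCoact (tensorAlgCoact coact) (tensorAlgCoact coact)) (tensorAlgAct act)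
      (tensorAlgCoact coact) (braceTerm M (natBraiding coact act) n) := by
    intro n
    induction n with
    | zero => rw [braceTerm_zero]; exact hμ
    | succ n ih =>
      rw [braceTerm_succ, twistedCoprod_eq hV]
      exact isYDHom_tensorAlgebra_mul.comp ((ih.map hμ).comp (isYDHom_braidedCoprod hV))
  induction n with
  | zero =>
    have : braceSum M (natBraiding coact act) 0 = LinearMap.mul' K _ ∘ₗ
        TensorProduct.map (degreeZeroProj K V) (degreeZeroProj K V) := by
      refine TensorProduct.ext' fun x y => ?_
      simp [braceSum, degreeZeroProj]
    rw [this]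
    exact isYDHom_tensorAlgebra_mul.comp (isYDHom_degreeZeroProj.map isYDHom_degreeZeroProj)
  | succ n ih =>
    have : braceSum M (natBraiding coact act) (n + 1) =
        braceSum M (natBraiding coact act) n + braceTerm M (natBraiding coact act) n := by
      rw [braceSum, braceSum, Finset.sum_range_succ, add_assoc]
    rw [this]
    exact ih.add (hterm n)

/-- No single truncation equals `*` on all degrees, but the action and coaction preserve the total
degree, so the argument can be made one degree at a time. -/
theorem isYDHom_starProd (hV : IsYetterDrinfeld act coact) (h0 : M 0 0 = 0)
    (hM : ∀ p q : ℕ, IsYDHom (tensorAct (powAct act p) (powAct act q))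
      (tensorCoact (powCoact coact p) (powCoact coact q)) act coact (M p q)) :
    IsYDHom (tensorAct (tensorAlgAct act) (tensorAlgAct act))
      (tensorCoact (tensorAlgCoact coact) (tensorAlgCoact coact)) (tensorAlgAct act)
      (tensorAlgCoact coact) (starProd M (natBraiding coact act)) := by
  have mem : ∀ t, t ∈ ⨆ n, tensorSqDegree K V n := fun t => by
    rw [iSup_gradedTensor (iSup_tensorDegree K V) (iSup_tensorDegree K V)]
    exact Submodule.mem_top
  constructor
  · intro h t
    induction mem t using Submodule.iSup_induction' with
    | zero => simp
    | add s t _ _ hs ht => simp only [map_add, hs, ht]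
    | mem n t ht =>
      rw [starProd_eq_braceSum hV h0 le_rfl ht, starProd_eq_braceSum hV h0 le_rfl
        (homogeneous_tensorAct homogeneous_tensorAlgAct homogeneous_tensorAlgAct h n t ht),
        (isYDHom_braceSum hV hM n).map_act]
  · intro t
    induction mem t using Submodule.iSup_induction' with
    | zero => simp
    | add s t _ _ hs ht => simp only [map_add, hs, ht]
    | mem n t ht =>
      rw [starProd_eq_braceSum hV h0 le_rfl ht, (isYDHom_braceSum hV hM n).map_coact]
      refine (LinearMap.eqOn_span (s := {u | ∃ h : H, ∃ a ∈ tensorSqDegree K V n, h ⊗ₜ a = u}) ?_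
        (homogeneous_tensorCoact homogeneous_tensorAlgCoact homogeneous_tensorAlgCoact n t ht))
      rintro _ ⟨k, a, ha, rfl⟩
      rw [LinearMap.lTensor_tmul, LinearMap.lTensor_tmul, starProd_eq_braceSum hV h0 le_rfl ha]

theorem isStarProduct_starProd (hV : IsYetterDrinfeld act coact) (h0 : M 0 0 = 0)
    (hM : ∀ p q : ℕ, IsYDHom (tensorAct (powAct act p) (powAct act q))
      (tensorCoact (powCoact coact p) (powCoact coact q)) act coact (M p q)) :
    IsStarProduct act coact (totalBrace M) (starProd M (natBraiding coact act)) where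
  yetterDrinfeld := hV
  isYDHom := isYDHom_starProd hV h0 hM
  brace_one := totalBrace_one_tmul_one h0
  recursion := starProd_recursion hV h0

variable {σ}

theorem IsQuantumMultiBrace.totalBrace_one_tmul (hM : IsQuantumMultiBrace M σ)
    (x : TensorAlgebra K V) : totalBrace M (1 ⊗ₜ x) = degreeOneProj K V x := by
  have mem : x ∈ ⨆ n, tensorDegree K V n := by
    rw [iSup_tensorDegree]; exact Submodule.mem_top
  induction mem using Submodule.iSup_induction' with
  | zero => simp
  | add s t _ _ hs ht => simp only [map_add, TensorProduct.tmul_add, hs, ht]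
  | mem n x hx =>
    match n with
    | 0 =>
      obtain ⟨r, rfl⟩ := mem_tensorDegree_zero hx
      simp [Algebra.algebraMap_eq_smul_one, totalBrace_one_tmul_one hM.zero_zero]
    | 1 =>
      rw [tensorDegree, pow_one] at hx
      obtain ⟨v, rfl⟩ := hx
      rw [degreeOneProj_ι, ← incl_single, ← incl_elim0, totalBrace, bigradedMap_incl, hM.zero_one]
    | n + 2 =>
      rw [degreeOneProj_of_mem (by omega) hx]
      obtain ⟨x, rfl⟩ := exists_incl_eq hx
      rw [← incl_elim0, totalBrace, bigradedMap_incl, hM.left_zero _ (by omega),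
        LinearMap.zero_apply]

theorem IsQuantumMultiBrace.totalBrace_tmul_one (hM : IsQuantumMultiBrace M σ)
    (x : TensorAlgebra K V) : totalBrace M (x ⊗ₜ 1) = degreeOneProj K V x := by
  have mem : x ∈ ⨆ n, tensorDegree K V n := by
    rw [iSup_tensorDegree]; exact Submodule.mem_top
  induction mem using Submodule.iSup_induction' with
  | zero => simp
  | add s t _ _ hs ht => simp only [map_add, TensorProduct.add_tmul, hs, ht]
  | mem n x hx =>
    match n with
    | 0 =>
      obtain ⟨r, rfl⟩ := mem_tensorDegree_zero hx
      simp [Algebra.algebraMap_eq_smul_one, ← TensorProduct.smul_tmul',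
        totalBrace_one_tmul_one hM.zero_zero]
    | 1 =>
      rw [tensorDegree, pow_one] at hx
      obtain ⟨v, rfl⟩ := hx
      rw [degreeOneProj_ι, ← incl_single, ← incl_elim0, totalBrace, bigradedMap_incl, hM.one_zero]
    | n + 2 =>
      rw [degreeOneProj_of_mem (by omega) hx]
      obtain ⟨x, rfl⟩ := exists_incl_eq hx
      rw [← incl_elim0, totalBrace, bigradedMap_incl, hM.right_zero _ (by omega),
        LinearMap.zero_apply]

theorem starProd_incl_tmul_incl (hV : IsYetterDrinfeld act coact) (h0 : M 0 0 = 0) {i j : ℕ}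
    (hi : 1 ≤ i) (x : ⨂[K]^i V) (y : ⨂[K]^j V) :
    starProd M (natBraiding coact act) (incl x ⊗ₜ incl y) = ∑ n ∈ Finset.range (i + j),
      incl (bracePow M (natBraiding coact act) n (incl x ⊗ₜ incl y)) := by
  rw [starProd_eq_braceSum hV h0 le_rfl (tmul_mem_gradedTensor rfl (incl_mem_tensorDegree x)
    (incl_mem_tensorDegree y)), braceSum, LinearMap.add_apply, LinearMap.comp_apply,
    tensorSqCounit_tmul, tensorCounit_of_mem (by omega) (incl_mem_tensorDegree x), zero_mul,
    map_zero, zero_add, LinearMap.sum_apply]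
  rfl

/-- Expanding the inner products into braces turns the degree one part of associativity into the
brace identity; condition 1 of the multi-brace structure supplies the unit laws. -/
theorem isAssocAlgebra_starProd (hV : IsYetterDrinfeld act coact)
    (hM : IsQuantumMultiBrace M (natBraiding coact act))
    (hM' : ∀ p q : ℕ, IsYDHom (tensorAct (powAct act p) (powAct act q))
      (tensorCoact (powCoact coact p) (powCoact coact q)) act coact (M p q)) :
    IsAssocAlgebra (starProd M (natBraiding coact act)) := by
  have h := isStarProduct_starProd hV hM.zero_zero hM'
  have h1 := h.one_star hM.totalBrace_one_tmul
  have h2 := h.star_one hM.totalBrace_tmul_one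
  refine h.isAssocAlgebra (h1 1) (IsStarProduct.brace_assoc_total h1 h2 hM.totalBrace_one_tmul
    hM.totalBrace_tmul_one h.degreeOneProj_star ?_)
  intro i j k hi hj hk x hx y hy z hz
  obtain ⟨x, rfl⟩ := exists_incl_eq hx
  obtain ⟨y, rfl⟩ := exists_incl_eq hy
  obtain ⟨z, rfl⟩ := exists_incl_eq hz
  rw [starProd_incl_tmul_incl hV hM.zero_zero hi, starProd_incl_tmul_incl hV hM.zero_zero hj,
    TensorProduct.sum_tmul, TensorProduct.tmul_sum, map_sum, map_sum]
  simp only [totalBrace, bigradedMap_incl]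
  exact hM.brace_assoc i j k hi hj hk x y z

end BraceProduct

/-! ### The projection `P₀` on the smash product. -/

section Bosonization

open Coalgebra (comul counit)

variable {K : Type*} [Field K] {V : Type*} [AddCommGroup V] [Module K V]
variable {H : Type*} [Ring H] [HopfAlgebra K H]
variable {act : H →ₗ[K] Module.End K V} {coact : V →ₗ[K] H ⊗[K] V}
variable {M : ∀ p q : ℕ, (⨂[K]^p V) ⊗[K] (⨂[K]^q V) →ₗ[K] V}

theorem bosonProj_tmul (x : TensorAlgebra K V) (h : H) :
    bosonProj K H V (x ⊗ₜ h) = tensorCounit x • (1 ⊗ₜ h) := by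
  simp [bosonProj, Algebra.algebraMap_eq_smul_one, TensorProduct.smul_tmul']

theorem bosonMul_tmul (x y : TensorAlgebra K V) (h k : H) :
    bosonMul act coact M ((x ⊗ₜ h) ⊗ₜ (y ⊗ₜ k)) =
      TensorProduct.map (starProd M (natBraiding coact act)) (LinearMap.mul' K H)
        (insertMid x k (((tensorAlgAct act).flip y).rTensor H (comul (R := K) h))) := by
  rw [bosonMul, LinearMap.comp_apply, midMap_tmul, natBraiding_tmul]

/-- `P₀` is multiplicative. -/
theorem bosonProj_bosonMul
    (hε : ∀ x y, tensorCounit (starProd M (natBraiding coact act) (x ⊗ₜ y)) =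
      tensorCounit x * tensorCounit y) (x y : TensorAlgebra K V) (h k : H) :
    bosonProj K H V (bosonMul act coact M ((x ⊗ₜ h) ⊗ₜ (y ⊗ₜ k))) =
      (tensorCounit x * tensorCounit y) • (1 ⊗ₜ (h * k)) := by
  rw [bosonMul_tmul]
  -- The factor `ε(h₁)` coming from `ε(h₁ · y)` must be absorbed by `h₂`, so `h` is written as `∑
  -- ε(h₁) h₂` in the same Sweedler representation.
  conv_rhs => rw [← Coalgebra.sum_counit_smul (R := K) (Coalgebra.Repr.arbitrary K h)]
  conv_lhs => rw [← (Coalgebra.Repr.arbitrary K h).eq]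
  simp only [map_sum, LinearMap.rTensor_tmul, insertMid_tmul, TensorProduct.map_tmul,
    LinearMap.mul'_apply, LinearMap.flip_apply, bosonProj_tmul, hε, tensorCounit_tensorAlgAct,
    Finset.sum_mul, TensorProduct.tmul_sum, Finset.smul_sum, smul_mul_assoc,
    TensorProduct.tmul_smul, smul_smul]
  refine Finset.sum_congr rfl fun i _ => ?_
  congr 1
  ring

theorem bosonMul_one_tmul (h1 : starProd M (natBraiding coact act) (1 ⊗ₜ 1) = 1) (h k : H) :
    bosonMul act coact M ((1 ⊗ₜ h) ⊗ₜ (1 ⊗ₜ k)) = 1 ⊗ₜ (h * k) := by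
  rw [bosonMul_tmul]
  conv_rhs => rw [← Coalgebra.sum_counit_smul (R := K) (Coalgebra.Repr.arbitrary K h)]
  conv_lhs => rw [← (Coalgebra.Repr.arbitrary K h).eq]
  simp only [map_sum, LinearMap.rTensor_tmul, insertMid_tmul, TensorProduct.map_tmul,
    LinearMap.mul'_apply, LinearMap.flip_apply, tensorAlgAct_one, Algebra.algebraMap_eq_smul_one,
    TensorProduct.tmul_smul, map_smul, h1, Finset.sum_mul, TensorProduct.tmul_sum, smul_mul_assoc,
    ← TensorProduct.smul_tmul']

/-- `P₀` is multiplicative and idempotent, so all four expressions equal one element `w`, and `w = w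
+ w - w`. -/
theorem bosonMul_rotaBaxter
    (hε : ∀ x y, tensorCounit (starProd M (natBraiding coact act) (x ⊗ₜ y)) =
      tensorCounit x * tensorCounit y) (h1 : starProd M (natBraiding coact act) (1 ⊗ₜ 1) = 1)
    (a b : TensorAlgebra K V ⊗[K] H) :
    bosonMul act coact M (bosonProj K H V a ⊗ₜ bosonProj K H V b) =
      bosonProj K H V (bosonMul act coact M (a ⊗ₜ bosonProj K H V b)) +
        bosonProj K H V (bosonMul act coact M (bosonProj K H V a ⊗ₜ b)) +
          (-1 : K) • bosonProj K H V (bosonMul act coact M (a ⊗ₜ b)) := by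
  induction a using TensorProduct.induction_on with
  | zero => simp
  | add s t hs ht =>
    simp only [map_add, TensorProduct.add_tmul, smul_add, hs, ht]
    abel
  | tmul x h =>
  induction b using TensorProduct.induction_on with
  | zero => simp
  | add s t hs ht =>
    simp only [map_add, TensorProduct.tmul_add, smul_add, hs, ht]
    abel
  | tmul y k =>
  simp only [bosonProj_tmul, ← TensorProduct.smul_tmul', TensorProduct.tmul_smul, map_smul,
    bosonMul_one_tmul h1, bosonProj_bosonMul hε, tensorCounit_one, one_mul, mul_one]
  module

end Bosonization

end BraidedRB

end

theorem theorem3p8 {K : Type*} [Field K] [CharZero K]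
    {H : Type*} [Ring H] [HopfAlgebra K H]
    (hS : Function.Bijective (HopfAlgebra.antipode K : H →ₗ[K] H))
    {V : Type*} [AddCommGroup V] [Module K V]
    (act : H →ₗ[K] Module.End K V) (coact : V →ₗ[K] H ⊗[K] V)
    (hV : BraidedRB.IsYetterDrinfeld act coact)
    (M : ∀ p q : ℕ, (⨂[K]^p V) ⊗[K] (⨂[K]^q V) →ₗ[K] V)
    (hM : BraidedRB.IsQuantumMultiBrace M (BraidedRB.natBraiding coact act))
    (hMorph : ∀ p q : ℕ, BraidedRB.IsYDHom
      (BraidedRB.tensorAct (BraidedRB.powAct act p) (BraidedRB.powAct act q))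
      (BraidedRB.tensorCoact (BraidedRB.powCoact coact p) (BraidedRB.powCoact coact q))
      act coact (M p q)) :
    BraidedRB.IsBraidedRotaBaxter (BraidedRB.bosonMul act coact M) (BraidedRB.bosonProj K H V)
      (BraidedRB.bosonBraiding act coact) (-1 : K) := by
  have hT := BraidedRB.isYetterDrinfeld_tensorAlgebra hV
  have hH := BraidedRB.isYetterDrinfeld_adjoint (K := K) (H := H)
  have hstar := BraidedRB.isStarProduct_starProd hV hM.zero_zero hMorph
  have hHmul : BraidedRB.IsAssocAlgebra (LinearMap.mul' K H) := fun x y z => mul_assoc x y z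
  -- `bosonMul` is by definition the braided tensor product of `(T(V), *)` with `H`, where `H` has
  -- coaction `comul`.
  have hassoc : BraidedRB.IsAssocAlgebra (BraidedRB.bosonMul act coact M) :=
    BraidedRB.isAssocAlgebra_braidedTensor hT hH (BraidedRB.isAssocAlgebra_starProd hV hM hMorph)
      hHmul hstar.isYDHom BraidedRB.isYDHom_mul
  exact ⟨BraidedRB.isBraidedAlgebra_natBraiding hS (hT.tensor hH) hassoc
      (BraidedRB.isYDHom_braidedTensor_mul hT hH hstar.isYDHom BraidedRB.isYDHom_mul),
    ⟨hassoc, BraidedRB.bosonMul_rotaBaxter (fun x y => hstar.counit_star (x ⊗ₜ y))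
      (hstar.one_star hM.totalBrace_one_tmul 1)⟩,
    -- `P₀` is the degree zero projection of `T(V)` tensored with the identity of `H`, hence a
    -- morphism.
    BraidedRB.natBraiding_map BraidedRB.isYDHom_degreeZeroProj.rTensor⟩
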